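/- **Setting.** For a polynomial $h:\mathbb R^r\to\mathbb R$ let $G(h)=\mathbb E_{g\sim N(0,\mathrm{Id}_r)}[\nabla h(g)\nabla h(g)^\top]$. Let $P:\mathbb R^n\to\mathbb R$ be a polynomial of the form $P(x)=h(U^\top x)$, where $U\in\mathbb R^{n\times r}$ has orthonormal columns, with span $U^*$ (the hidden subspace), and $h$ has degree at most $d$, is $\alpha$-non-degenerate, i.e. $G(h)\succeq\alpha\|G(h)\|_2\,\mathrm{Id}_r$, and is normalized by $\mathbb E[h(g)]=0$ and $\alpha\,\mathrm{Id}_r\preceq G(h)\preceq \mathrm{Id}_r$. Samples are $(x,P(x))$ with independent $x\sim N(0,\mathrm{Id}_n)$. For $V,W\in\mathbb R^{n\times r}$ with orthonormal columns, the Procrustes distance of their spans is $d_P(V,W)=\min_{O\in O(r)}\|V-WO\|_F$. **Algorithm.** TrimmedPCA with threshold $\tau$ splits $N$ samples into $r$ batches of $m=\lfloor N/r\rfloor$. In round $\ell=0,\dots,r-1$, given $v_1,\dots,v_\ell$ from the earlier rounds and the fresh batch $(x_a,y_a)_{a\le m}$, it forms $$\widehat M=\Pi\Big(\frac1m\sum_{a=1}^m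 \mathbf 1\{|y_a|>\tau,\ |\langle v_j,x_a\rangle|\le1\ \forall j\le\ell\}\,(x_ax_a^\top-\mathrm{Id})\Big)\Pi,\qquad \Pi=\mathrm{Id}-\sum_{j\le\ell}v_jv_j^\top,$$ and lets $v_{\ell+1}$ be the output of a top-eigenvector subroutine on $\widehat M$. It outputs $v_1,\dots,v_r$. The subroutine may use an independent vector $g_\ell\sim N(0,\mathrm{Id}_n)$ (passed to it as $\Pi g_\ell$). Running time is the number of arithmetic operations on reals (including absolute value and square root), comparisons, and array writes, with schoolbook linear algebra. **Theorem.** There is an absolute constant $K$, and for all $r\ge1$, $d\ge0$, $\alpha>0$ there are $C=C(r,d,\alpha)>0$ and $\tau=\tau(r,d,\alpha)>0$, such that the following holds for all $n$, all $P,U$ as above, all $\varepsilon\in(0,1]$, all $\delta\in(0,1)$ with $\delta\le r/2$ (a restriction only for $r=1$), and every total number of samples $N\ge C\,n\log(r/\delta)/\varepsilon^2$, with $m=\lfloor N/r\rfloor$. 1. *Exact eigenvectors.* If the subroutine returns a unit eigenvector for the largest eigenvalue of every symmetric matrix (chosen in any Borel measurable way), then with probability at least $1-\delta$ the output $v_1,\dots,v_r$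 of TrimmedPCA is orthonormal and its span is within Procrustes distance $\varepsilon$ of $U^*$. If each call of the subroutine takes at most $T$ steps, the total running time is at most $K\,r\,(n^2m+n^3)+rT$ on every input; so it is $O(r(n^2N+n^3))$ when $T=O(n^3)$. 2. *Eigenvectors computed numerically, all steps counted.* If the subroutine is $m$ steps of power iteration with $\widehat M+2\,\mathrm{Id}$ started at $\Pi g_\ell$, followed by normalization to unit length, then again with probability at least $1-\delta$ the output is orthonormal and its span is within Procrustes distance $\varepsilon$ of $U^*$, and the total running time is at most $K\,r\,(n^2m+n^3)$, hence $O(r(n^2N+n^3))$, on every input. -/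

import Mathlib

open MeasureTheory ProbabilityTheory Matrix

noncomputable section

namespace TrimPCA

/-! ### Step counting

`Timed α` is a value of type `α` together with the number of elementary steps spent on producing it.
The elementary steps are: one arithmetic operation on real numbers (sum, difference, product,
quotient, absolute value, square root), one comparison of two real numbers, and writing one entry
of an array. -/

structure Timed (α : Type) where
  val : α
  steps : ℕ

instance : Monad Timed where
  pure a := ⟨a, 0⟩
  bind t f := ⟨(f t.val).val, t.steps + (f t.val).steps⟩

namespace Timed

def add (x y : ℝ) : Timed ℝ := ⟨x + y, 1⟩
def sub (x y : ℝ) : Timed ℝ := ⟨x - y, 1⟩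
def mul (x y : ℝ) : Timed ℝ := ⟨x * y, 1⟩
def div (x y : ℝ) : Timed ℝ := ⟨x / y, 1⟩
def abs (x : ℝ) : Timed ℝ := ⟨|x|, 1⟩
def sqrt (x : ℝ) : Timed ℝ := ⟨Real.sqrt x, 1⟩

/-- Compare `x` with `y`, then continue with `a` if `x ≤ y` and with `b` otherwise. -/
def ifLe {α : Type} (x y : ℝ) (a b : Timed α) : Timed α :=
  ⟨if x ≤ y then a.val else b.val, 1 + if x ≤ y then a.steps else b.steps⟩

/-- Compute and store the entries of an array, one after the other. -/
def tabulate {α : Type} {k : ℕ} (f : Fin k → Timed α) : Timed (Fin k → α) :=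
  ⟨fun i => (f i).val, ∑ i, ((f i).steps + 1)⟩

/-- Compute `k` numbers and accumulate their sum (one addition for each). -/
def sum {k : ℕ} (f : Fin k → Timed ℝ) : Timed ℝ :=
  ⟨∑ i, (f i).val, ∑ i, ((f i).steps + 1)⟩

/-- Compute `k` numbers and accumulate their product (one multiplication for each). -/
def prod {k : ℕ} (f : Fin k → Timed ℝ) : Timed ℝ :=
  ⟨∏ i, (f i).val, ∑ i, ((f i).steps + 1)⟩

/-- Repeat a computation `k` times, feeding each result into the next repetition. -/
def iterate {α : Type} (f : α → Timed α) : ℕ → α → Timed α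
  | 0, a => pure a
  | k + 1, a => do
    let b ← iterate f k a
    f b

/-- Schoolbook inner product. -/
def dot {k : ℕ} (v w : Fin k → ℝ) : Timed ℝ := sum fun i => mul (v i) (w i)

/-- Schoolbook matrix-vector product. -/
def matVec {n : ℕ} (A : Matrix (Fin n) (Fin n) ℝ) (v : Fin n → ℝ) : Timed (Fin n → ℝ) :=
  tabulate fun i => dot (A i) v

/-- Schoolbook matrix product. -/
def matMul {n : ℕ} (A B : Matrix (Fin n) (Fin n) ℝ) : Timed (Matrix (Fin n) (Fin n) ℝ) :=
  tabulate fun i => tabulate fun j => sum fun k => mul (A i k) (B k j)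

end Timed

/-! ### The algorithm -/

/-- The indicator of the event that `|y| > τ` and `|⟨v_j, x⟩| ≤ 1` for all `j`. -/
def keep {n ℓ : ℕ} (τ : ℝ) (V : Fin ℓ → Fin n → ℝ) (x : Fin n → ℝ) (y : ℝ) : Timed ℝ := do
  let a ← Timed.abs y
  Timed.ifLe a τ (pure 0) <|
    Timed.prod fun j => do
      let c ← Timed.dot (V j) x
      let b ← Timed.abs c
      Timed.ifLe b 1 (pure 1) (pure 0)

/-- The trimmed and thresholded empirical second-moment matrix
`(1/m) ∑ a, keep (x a, y a) * (x a (x a)ᵀ - Id)`. -/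
def secondMoment {n m ℓ : ℕ} (τ : ℝ) (V : Fin ℓ → Fin n → ℝ)
    (x : Fin m → Fin n → ℝ) (y : Fin m → ℝ) : Timed (Matrix (Fin n) (Fin n) ℝ) := do
  let b ← Timed.tabulate fun a => keep τ V (x a) (y a)
  Timed.tabulate fun i => Timed.tabulate fun j => do
    let s ← Timed.sum fun a => do
      let p ← Timed.mul (x a i) (x a j)
      let q ← Timed.sub p (if i = j then 1 else 0)
      Timed.mul (b a) q
    Timed.div s m

/-- The matrix `Id - ∑ k, v_k v_kᵀ`; for orthonormal `v_k` this is the orthogonal projection onto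
the orthogonal complement of their span. -/
def projPerp {n ℓ : ℕ} (V : Fin ℓ → Fin n → ℝ) : Timed (Matrix (Fin n) (Fin n) ℝ) :=
  Timed.tabulate fun i => Timed.tabulate fun j => do
    let s ← Timed.sum fun k => Timed.mul (V k i) (V k j)
    Timed.sub (if i = j then 1 else 0) s

/-- One round: form the projected empirical matrix from a fresh batch of samples `(x a, y a)` and
call the subroutine `eig` for a top eigenvector of it.  The subroutine may use a random start
vector; it receives the random vector `g`, projected onto the complement of the vectors found. -/
def oneRound {n m ℓ : ℕ} (τ : ℝ)
    (eig : (Fin n → ℝ) → Matrix (Fin n) (Fin n) ℝ → Timed (Fin n → ℝ))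
    (V : Fin ℓ → Fin n → ℝ) (x : Fin m → Fin n → ℝ) (y : Fin m → ℝ) (g : Fin n → ℝ) :
    Timed (Fin n → ℝ) := do
  let S ← secondMoment τ V x y
  let Q ← projPerp V
  let QS ← Timed.matMul Q S
  let M ← Timed.matMul QS Q
  let s ← Timed.matVec Q g
  eig s M

/-- The first `ℓ` rounds; round `k` uses batch `k` of the samples and the random vector `g k`. -/
def rounds {n r m : ℕ} (τ : ℝ)
    (eig : (Fin n → ℝ) → Matrix (Fin n) (Fin n) ℝ → Timed (Fin n → ℝ))
    (x : Fin r → Fin m → Fin n → ℝ) (y : Fin r → Fin m → ℝ) (g : Fin r → Fin n → ℝ) :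
    (ℓ : ℕ) → ℓ ≤ r → Timed (Fin ℓ → Fin n → ℝ)
  | 0, _ => pure Fin.elim0
  | ℓ + 1, h => do
    let V ← rounds τ eig x y g ℓ (Nat.le_of_succ_le h)
    let v ← oneRound τ eig V (x ⟨ℓ, h⟩) (y ⟨ℓ, h⟩) (g ⟨ℓ, h⟩)
    let v' ← Timed.tabulate fun i => pure (v i)
    pure (Fin.snoc V v')

/-- TrimmedPCA with threshold `τ` and eigenvector subroutine `eig`, run for `r` rounds on `r` batches
of `m` samples each. -/
def trimmedPCA {n r m : ℕ} (τ : ℝ)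
    (eig : (Fin n → ℝ) → Matrix (Fin n) (Fin n) ℝ → Timed (Fin n → ℝ))
    (x : Fin r → Fin m → Fin n → ℝ) (y : Fin r → Fin m → ℝ) (g : Fin r → Fin n → ℝ) :
    Timed (Fin r → Fin n → ℝ) :=
  rounds τ eig x y g r le_rfl

/-! ### Eigenvector subroutines -/

/-- `v` is a unit eigenvector of `M` for the largest eigenvalue of `M`. -/
def IsTopEigenvector {n : ℕ} (M : Matrix (Fin n) (Fin n) ℝ) (v : Fin n → ℝ) : Prop :=
  v ⬝ᵥ v = 1 ∧ ∃ lam : ℝ, M *ᵥ v = lam • v ∧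
    ∀ (mu : ℝ) (w : Fin n → ℝ), w ≠ 0 → M *ᵥ w = mu • w → mu ≤ lam

/-- The subroutine returns an exact top eigenvector of every symmetric matrix (with any rule for
signs and for breaking ties, as long as it is Borel measurable). -/
def IsExactEig {n : ℕ}
    (eig : (Fin n → ℝ) → Matrix (Fin n) (Fin n) ℝ → Timed (Fin n → ℝ)) : Prop :=
  Measurable (fun p : (Fin n → ℝ) × (Fin n → Fin n → ℝ) => (eig p.1 (Matrix.of p.2)).val) ∧
    ∀ (g : Fin n → ℝ) (M : Matrix (Fin n) (Fin n) ℝ), M.IsSymm → IsTopEigenvector M (eig g M).val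

/-- Numerical top eigenvector: `k` steps of power iteration with the shifted matrix `M + 2 Id`,
started at `g` and normalized at the end. -/
def powerIteration {n : ℕ} (k : ℕ) (g : Fin n → ℝ) (M : Matrix (Fin n) (Fin n) ℝ) :
    Timed (Fin n → ℝ) := do
  let A ← Timed.tabulate fun i => Timed.tabulate fun j => Timed.add (M i j) (if i = j then 2 else 0)
  let w ← Timed.iterate (Timed.matVec (Matrix.of A)) k g
  let s ← Timed.dot w w
  let t ← Timed.sqrt s
  Timed.tabulate fun i => Timed.div (w i) t

/-! ### Low-rank polynomials, Gaussian data, distance of subspaces -/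

/-- The standard Gaussian measure on `ℝⁿ`. -/
def gauss (n : ℕ) : Measure (Fin n → ℝ) := Measure.pi fun _ => gaussianReal 0 1

/-- The matrix `E[∇h(g) ∇h(g)ᵀ]` for a standard Gaussian `g` in `ℝʳ`. -/
def gradCov {r : ℕ} (h : MvPolynomial (Fin r) ℝ) : Matrix (Fin r) (Fin r) ℝ :=
  Matrix.of fun i j => ∫ z, MvPolynomial.eval z (MvPolynomial.pderiv i h) *
    MvPolynomial.eval z (MvPolynomial.pderiv j h) ∂(gauss r)

/-- `h` is `α`-non-degenerate: `G ⪰ α ‖G‖ Id` for `G = E[∇h ∇hᵀ]` and the operator norm. -/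
def IsNondegenerate {r : ℕ} (α : ℝ) (h : MvPolynomial (Fin r) ℝ) : Prop :=
  (gradCov h - (α * ‖Matrix.toEuclideanCLM (𝕜 := ℝ) (gradCov h)‖) •
    (1 : Matrix (Fin r) (Fin r) ℝ)).PosSemidef

/-- The normalization `E[h] = 0` and `α Id ⪯ E[∇h ∇hᵀ] ⪯ Id`. -/
def IsNormalized {r : ℕ} (α : ℝ) (h : MvPolynomial (Fin r) ℝ) : Prop :=
  ∫ z, MvPolynomial.eval z h ∂(gauss r) = 0 ∧
    (gradCov h - α • (1 : Matrix (Fin r) (Fin r) ℝ)).PosSemidef ∧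
    ((1 : Matrix (Fin r) (Fin r) ℝ) - gradCov h).PosSemidef

/-- `P` is a normalized `α`-non-degenerate polynomial of rank `r` and degree at most `d`, and the
columns of `U` are an orthonormal basis of its hidden subspace. -/
def IsLowRank {n r : ℕ} (d : ℕ) (α : ℝ) (P : MvPolynomial (Fin n) ℝ)
    (U : Matrix (Fin n) (Fin r) ℝ) : Prop :=
  Uᵀ * U = 1 ∧ ∃ h : MvPolynomial (Fin r) ℝ, h.totalDegree ≤ d ∧ IsNondegenerate α h ∧
    IsNormalized α h ∧ ∀ x : Fin n → ℝ, MvPolynomial.eval x P = MvPolynomial.eval (Uᵀ *ᵥ x) h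

/-- The law of `r` batches of `m` independent standard Gaussian covariates, together with `r`
further independent standard Gaussian vectors (the internal randomness of the subroutine). -/
def inputLaw (n r m : ℕ) : Measure ((Fin r → Fin m → Fin n → ℝ) × (Fin r → Fin n → ℝ)) :=
  (Measure.pi fun _ => Measure.pi fun _ => gauss n).prod (Measure.pi fun _ => gauss n)

/-- The run of TrimmedPCA on the data `(x, P(x))`. -/
def runOn {n r m : ℕ} (τ : ℝ)
    (eig : (Fin n → ℝ) → Matrix (Fin n) (Fin n) ℝ → Timed (Fin n → ℝ))
    (P : MvPolynomial (Fin n) ℝ) (ω : (Fin r → Fin m → Fin n → ℝ) × (Fin r → Fin n → ℝ)) :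
    Timed (Fin r → Fin n → ℝ) :=
  trimmedPCA τ eig ω.1 (fun k a => MvPolynomial.eval (ω.1 k a) P) ω.2

/-- The Frobenius norm. -/
def frob {n r : ℕ} (A : Matrix (Fin n) (Fin r) ℝ) : ℝ := Real.sqrt (∑ i, ∑ j, A i j ^ 2)

/-- The Procrustes distance `min_O ‖V - W O‖_F` over orthogonal `O`, of the subspaces spanned by
the orthonormal columns of `V` and of `W`. -/
def procrustes {n r : ℕ} (V W : Matrix (Fin n) (Fin r) ℝ) : ℝ :=
  ⨅ O : Matrix.orthogonalGroup (Fin r) ℝ, frob (V - W * (O : Matrix (Fin r) (Fin r) ℝ))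

/-- The output vectors are orthonormal and their span is within Procrustes distance `ε` of the
span of the columns of `U`. -/
def Succeeds {n r : ℕ} (ε : ℝ) (U : Matrix (Fin n) (Fin r) ℝ) (v : Fin r → Fin n → ℝ) : Prop :=
  (∀ i j, v i ⬝ᵥ v j = if i = j then 1 else 0) ∧ procrustes (Matrix.of v)ᵀ U ≤ ε

end TrimPCA

end

namespace TrimPCA

/-! Population picture. Split `x` into `z = Uᵀ x` and an independent Gaussian part off the hidden
subspace. If the trimming directions lay in that subspace, the weight would depend on `z` alone, and
`E[w (x xᵀ - Id)]` would vanish exactly off the subspace (`integral_trim_eq_zero`). Inside it there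
is a gap: `τ` dominates `|h|` on `|z|² ≤ 3r + 1`, so a surviving `z` has `|z|² > 3r + 1`; the slabs
leave at most `2r` of this for the span of the trimming directions. The at most `r` complementary
unit directions `c` therefore satisfy `∑ ((c ⬝ᵥ z)² - 1) ≥ 1` on survival, and one of them has
expected excess at least `P(survival) / r` (`exists_direction`).

The survival probability is bounded below uniformly. Normalized polynomials of bounded degree have
bounded coefficients (`exists_coeff_bound`). A polynomial bounded on a slab of codimension less than
`r` has zero derivative in some direction, contradicting `G ⪰ α Id`, so survival contains a nonempty
open event (`exists_large_in_slab`). Compactness of the parameters finishes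
(`exists_measure_lower_bound`, `exists_threshold_gap`).

Perturbation. The computed directions leave the subspace by some `e`. Replacing them by their
projections changes the second moment by `O(r e)`, since a slab indicator flips only near its
boundary (`integral_abs_slab_sub_le`, `abs_integral_trim_sub_le`). A Chernoff bound for trimmed
quadratic forms and a net of at most `5 ^ n` points make the empirical matrix uniformly close to its
mean (`measure_empMat_deviation_le`). Hence the projected matrix has an eigenvalue at least `lam /
2`, while its range lies within `leakConst r * e` of the subspace (`exists_form_ge_of_deviation`,
`leak_of_deviation`); dividing, a top eigenvector is within `O(e)` (`top_eigenvector_close`). No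
separation between eigenvalues is needed. Power iteration does not have to find the top eigenvector
either: log-convexity of the norms forces geometric growth after a warm-up, and a vector that keeps
growing faster than the factor `2` is pushed into the range (`power_iteration_close`).

Assembly. Each round multiplies the error by the constant `growth r lam`, so after `r` rounds it is
still proportional to the initial deviation `devRatio r lam * ε`. Fresh batches allow conditioning
on the earlier vectors, and a union bound over the rounds gives the probability
(`measure_not_isClose_found_le`). Closeness of the individual vectors becomes Procrustes distance
through the polar factor of `Uᵀ X` (`procrustes_le`). -/

instance (n : ℕ) : IsProbabilityMeasure (gauss n) := by unfold gauss; infer_instance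

instance : (gaussianReal 0 1).IsOpenPosMeasure :=
  (gaussianReal_absolutelyContinuous' 0 one_ne_zero).isOpenPosMeasure

instance (n : ℕ) : (gauss n).IsOpenPosMeasure := by unfold gauss; infer_instance

/-! ### Linear images of the standard Gaussian measure -/

/-- Characteristic functions determine the law, so this formula reduces every statement about linear
images of Gaussians to an identity between covariances. -/
theorem charFunDual_gauss (n : ℕ) (L : StrongDual ℝ (Fin n → ℝ)) :
    charFunDual (gauss n) L = Complex.exp (-(∑ i, L (Pi.single i 1) ^ 2) / 2 : ℝ) := by
  unfold gauss
  rw [charFunDual_pi]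
  have : ∀ i, charFunDual (gaussianReal 0 1)
      (L.comp (ContinuousLinearMap.single ℝ (fun _ : Fin n => ℝ) i)) =
      Complex.exp (-(L (Pi.single i 1) ^ 2) / 2 : ℝ) := by
    intro i
    have h1 : ∀ v : ℝ, (L.comp (ContinuousLinearMap.single ℝ (fun _ : Fin n => ℝ) i)) v =
        L (Pi.single i 1) * v := by
      intro v
      have : Pi.single (M := fun _ : Fin n => ℝ) i v = v • Pi.single (M := fun _ : Fin n => ℝ) i 1 := by
        rw [← Pi.single_smul]; simp
      simp only [ContinuousLinearMap.comp_apply, ContinuousLinearMap.single_apply]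
      rw [this, map_smul, smul_eq_mul, mul_comm]
    rw [charFunDual_apply]
    have h2 := charFun_gaussianReal (μ := 0) (v := 1) (L (Pi.single i 1))
    rw [charFun_apply_real] at h2
    simp only [h1]
    push_cast at h2 ⊢
    rw [h2]
    congr 1
    ring
  simp only [this]
  rw [← Complex.exp_sum]
  congr 1
  push_cast
  rw [neg_div, Finset.sum_div, ← Finset.sum_neg_distrib]
  exact Finset.sum_congr rfl fun i _ => by ring

theorem measurable_mulVec_left {n k : ℕ} (A : Matrix (Fin n) (Fin k) ℝ) :
    Measurable fun x : Fin k → ℝ => A *ᵥ x :=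
  (Continuous.matrix_mulVec continuous_const continuous_id).measurable

theorem measurable_mulVec_add {n k l : ℕ} (A : Matrix (Fin n) (Fin k) ℝ)
    (B : Matrix (Fin n) (Fin l) ℝ) :
    Measurable fun p : (Fin k → ℝ) × (Fin l → ℝ) => A *ᵥ p.1 + B *ᵥ p.2 :=
  ((measurable_mulVec_left A).comp measurable_fst).add
    ((measurable_mulVec_left B).comp measurable_snd)

theorem dual_mulVec {n k : ℕ} (L : StrongDual ℝ (Fin n → ℝ)) (A : Matrix (Fin n) (Fin k) ℝ)
    (x : Fin k → ℝ) : L (A *ᵥ x) = (fun i => L (Pi.single i 1)) ⬝ᵥ A *ᵥ x := by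
  have h : A *ᵥ x = ∑ i, (A *ᵥ x) i • Pi.single (M := fun _ : Fin n => ℝ) i 1 := by
    ext j
    simp [Finset.sum_apply, Pi.single_apply]
  conv_lhs => rw [h]
  simp [map_sum, dotProduct, mul_comm]

/-- The sum is a centred Gaussian with covariance `A * Aᵀ + B * Bᵀ`. The main use is `A = U`, `B =
perp U`: it separates the hidden coordinates from an independent remainder without choosing a basis
of the complement. -/
theorem measurePreserving_mulVec_add {n k l : ℕ} (A : Matrix (Fin n) (Fin k) ℝ)
    (B : Matrix (Fin n) (Fin l) ℝ) (h : A * Aᵀ + B * Bᵀ = 1) :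
    MeasurePreserving (fun p : (Fin k → ℝ) × (Fin l → ℝ) => A *ᵥ p.1 + B *ᵥ p.2)
      ((gauss k).prod (gauss l)) (gauss n) := by
  refine ⟨measurable_mulVec_add A B, ?_⟩
  let F : (Fin k → ℝ) × (Fin l → ℝ) →L[ℝ] (Fin n → ℝ) :=
    LinearMap.toContinuousLinearMap
      (A.mulVecLin.coprod B.mulVecLin)
  have hF : (fun p : (Fin k → ℝ) × (Fin l → ℝ) => A *ᵥ p.1 + B *ᵥ p.2) = F := by
    ext p; simp [F]
  rw [hF]
  have : IsProbabilityMeasure (((gauss k).prod (gauss l)).map F) :=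
    Measure.isProbabilityMeasure_map F.continuous.aemeasurable
  apply Measure.ext_of_charFunDual
  ext L
  rw [charFunDual_map, charFunDual_prod, charFunDual_gauss, charFunDual_gauss, charFunDual_gauss,
    ← Complex.exp_add, ← Complex.ofReal_add]
  congr 2
  set u : Fin n → ℝ := fun i => L (Pi.single i 1) with hu
  have e1 : ∀ j, ((L.comp F).comp (.inl ℝ (Fin k → ℝ) (Fin l → ℝ))) (Pi.single j 1) =
      (u ᵥ* A) j := by
    intro j
    have : F (Pi.single j 1, 0) = A *ᵥ Pi.single j 1 := by simp [F]
    simp only [ContinuousLinearMap.comp_apply, ContinuousLinearMap.inl_apply, this]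
    rw [dual_mulVec, dotProduct_mulVec]
    simp [hu]
  have e2 : ∀ j, ((L.comp F).comp (.inr ℝ (Fin k → ℝ) (Fin l → ℝ))) (Pi.single j 1) =
      (u ᵥ* B) j := by
    intro j
    have : F (0, Pi.single j 1) = B *ᵥ Pi.single j 1 := by simp [F]
    simp only [ContinuousLinearMap.comp_apply, ContinuousLinearMap.inr_apply, this]
    rw [dual_mulVec, dotProduct_mulVec]
    simp [hu]
  have e3 : ∀ {a b : ℕ} (M : Matrix (Fin a) (Fin b) ℝ) (w : Fin a → ℝ),
      ∑ j, (w ᵥ* M) j ^ 2 = w ⬝ᵥ (M * Mᵀ) *ᵥ w := by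
    intro a b M w
    rw [← mulVec_mulVec, dotProduct_mulVec, mulVec_transpose, dotProduct]
    exact Finset.sum_congr rfl fun j _ => by ring
  simp only [e1, e2, e3]
  have : u ⬝ᵥ u = u ⬝ᵥ (A * Aᵀ) *ᵥ u + u ⬝ᵥ (B * Bᵀ) *ᵥ u := by
    rw [← dotProduct_add, ← add_mulVec, h, one_mulVec]
  have h4 : ∑ i, L (Pi.single i 1) ^ 2 = u ⬝ᵥ u := by
    simp [dotProduct, hu, sq]
  rw [h4, this]; ring

theorem measurePreserving_mulVec {n k : ℕ} (A : Matrix (Fin n) (Fin k) ℝ) (h : A * Aᵀ = 1) :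
    MeasurePreserving (fun x : Fin k → ℝ => A *ᵥ x) (gauss k) (gauss n) := by
  have h1 := measurePreserving_mulVec_add A (0 : Matrix (Fin n) (Fin 0) ℝ) (by simpa using h)
  refine ⟨measurable_mulVec_left A, ?_⟩
  rw [← h1.map_eq]
  have : (fun p : (Fin k → ℝ) × (Fin 0 → ℝ) => A *ᵥ p.1 + (0 : Matrix (Fin n) (Fin 0) ℝ) *ᵥ p.2) =
      (fun x => A *ᵥ x) ∘ Prod.fst := by
    ext p; simp
  rw [this, ← Measure.map_map (measurable_mulVec_left A) measurable_fst, Measure.map_fst_prod]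
  simp

/-- One-dimensional marginals. -/
theorem measurePreserving_dotProduct {n : ℕ} (u : Fin n → ℝ) (hu : u ⬝ᵥ u = 1) :
    MeasurePreserving (fun x : Fin n → ℝ => u ⬝ᵥ x) (gauss n) (gaussianReal 0 1) := by
  have h1 := measurePreserving_mulVec (Matrix.of fun _ : Fin 1 => u) (by
    ext i j; fin_cases i; fin_cases j; simpa [Matrix.mul_apply, dotProduct] using hu)
  have h2 : MeasurePreserving (fun x : Fin 1 → ℝ => x 0) (gauss 1) (gaussianReal 0 1) :=
    measurePreserving_eval (fun _ : Fin 1 => gaussianReal 0 1) 0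
  exact h2.comp h1

/-! ### Euclidean length -/

/-- The Euclidean length of a vector. -/
noncomputable def len {n : ℕ} (v : Fin n → ℝ) : ℝ := √(v ⬝ᵥ v)

theorem dot_self_nonneg {n : ℕ} (v : Fin n → ℝ) : 0 ≤ v ⬝ᵥ v :=
  Finset.sum_nonneg fun i _ => mul_self_nonneg (v i)

theorem len_nonneg {n : ℕ} (v : Fin n → ℝ) : 0 ≤ len v := Real.sqrt_nonneg _

theorem len_sq {n : ℕ} (v : Fin n → ℝ) : len v ^ 2 = v ⬝ᵥ v := Real.sq_sqrt (dot_self_nonneg v)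

theorem len_eq_norm {n : ℕ} (v : Fin n → ℝ) : len v = ‖WithLp.toLp 2 v‖ := by
  rw [len, EuclideanSpace.norm_eq]
  congr 1
  exact Finset.sum_congr rfl fun i _ => by simp [sq]

theorem abs_dot_le {n : ℕ} (v w : Fin n → ℝ) : |v ⬝ᵥ w| ≤ len v * len w := by
  have h := abs_real_inner_le_norm (WithLp.toLp 2 w) (WithLp.toLp 2 v)
  rw [EuclideanSpace.inner_toLp_toLp, ← len_eq_norm, ← len_eq_norm] at h
  simpa [mul_comm] using h

theorem dot_le {n : ℕ} (v w : Fin n → ℝ) : v ⬝ᵥ w ≤ len v * len w :=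
  (le_abs_self _).trans (abs_dot_le v w)

theorem dot_sq_le {n : ℕ} (v w : Fin n → ℝ) : (v ⬝ᵥ w) ^ 2 ≤ (v ⬝ᵥ v) * (w ⬝ᵥ w) := by
  rw [← len_sq, ← len_sq, ← mul_pow, ← sq_abs]
  exact pow_le_pow_left₀ (abs_nonneg _) (abs_dot_le v w) 2

theorem len_smul {n : ℕ} (c : ℝ) (v : Fin n → ℝ) : len (c • v) = |c| * len v := by
  rw [len_eq_norm, len_eq_norm, WithLp.toLp_smul, norm_smul, Real.norm_eq_abs]

theorem len_add_le {n : ℕ} (v w : Fin n → ℝ) : len (v + w) ≤ len v + len w := by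
  simp only [len_eq_norm, WithLp.toLp_add]; exact norm_add_le _ _

theorem len_eq_zero {n : ℕ} {v : Fin n → ℝ} : len v = 0 ↔ v = 0 := by
  rw [len_eq_norm, norm_eq_zero]; exact WithLp.toLp_eq_zero 2

theorem len_pos {n : ℕ} {v : Fin n → ℝ} (h : v ≠ 0) : 0 < len v :=
  (len_nonneg v).lt_of_ne fun h' => h (len_eq_zero.1 h'.symm)

theorem len_eq_one {n : ℕ} {v : Fin n → ℝ} (h : v ⬝ᵥ v = 1) : len v = 1 := by
  rw [len, h, Real.sqrt_one]

theorem exists_unit {n : ℕ} {v : Fin n → ℝ} (h : v ≠ 0) :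
    ∃ e : Fin n → ℝ, e ⬝ᵥ e = 1 ∧ v = len v • e := by
  have h0 := len_pos h
  refine ⟨(len v)⁻¹ • v, ?_, ?_⟩
  · rw [smul_dotProduct, dotProduct_smul, ← len_sq, smul_eq_mul, smul_eq_mul]
    field_simp
  · rw [smul_smul, mul_inv_cancel₀ h0.ne', one_smul]

/-- The component orthogonal to the columns of `U`. -/
def perp {n r : ℕ} (U : Matrix (Fin n) (Fin r) ℝ) : Matrix (Fin n) (Fin n) ℝ := 1 - U * Uᵀ

section Perp
variable {n r : ℕ} {U : Matrix (Fin n) (Fin r) ℝ}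

theorem perp_transpose (U : Matrix (Fin n) (Fin r) ℝ) : (perp U)ᵀ = perp U := by
  simp [perp, transpose_mul]

theorem perp_mul_self (hU : Uᵀ * U = 1) : perp U * perp U = perp U := by
  have : U * Uᵀ * (U * Uᵀ) = U * Uᵀ := by
    rw [Matrix.mul_assoc, ← Matrix.mul_assoc Uᵀ, hU, Matrix.one_mul]
  simp only [perp, mul_sub, sub_mul, Matrix.mul_one, Matrix.one_mul, this]
  abel

theorem transpose_mul_perp (hU : Uᵀ * U = 1) : Uᵀ * perp U = 0 := by
  rw [perp, Matrix.mul_sub, Matrix.mul_one, ← Matrix.mul_assoc, hU, Matrix.one_mul, sub_self]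

theorem transpose_mulVec_perp (hU : Uᵀ * U = 1) (v : Fin n → ℝ) : Uᵀ *ᵥ (perp U *ᵥ v) = 0 := by
  rw [mulVec_mulVec, transpose_mul_perp hU, zero_mulVec]

theorem mul_transpose_add_perp (hU : Uᵀ * U = 1) : U * Uᵀ + perp U * (perp U)ᵀ = 1 := by
  rw [perp_transpose, perp_mul_self hU, perp]; abel

theorem perp_mulVec (v : Fin n → ℝ) : perp U *ᵥ v = v - U *ᵥ (Uᵀ *ᵥ v) := by
  rw [perp, sub_mulVec, one_mulVec, mulVec_mulVec]

theorem dot_mulVec_comm {a b : ℕ} (A : Matrix (Fin a) (Fin b) ℝ) (x : Fin a → ℝ) (y : Fin b → ℝ) :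
    x ⬝ᵥ A *ᵥ y = (Aᵀ *ᵥ x) ⬝ᵥ y := by
  rw [dotProduct_mulVec, mulVec_transpose]

theorem perp_dot (v w : Fin n → ℝ) : v ⬝ᵥ perp U *ᵥ w = (perp U *ᵥ v) ⬝ᵥ w := by
  rw [dot_mulVec_comm, perp_transpose]

theorem perp_dot_perp (hU : Uᵀ * U = 1) (v w : Fin n → ℝ) :
    (perp U *ᵥ v) ⬝ᵥ (perp U *ᵥ w) = (perp U *ᵥ v) ⬝ᵥ w := by
  rw [perp_dot, mulVec_mulVec, perp_mul_self hU]

theorem dot_eq_add_perp (hU : Uᵀ * U = 1) (v w : Fin n → ℝ) :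
    v ⬝ᵥ w = (Uᵀ *ᵥ v) ⬝ᵥ (Uᵀ *ᵥ w) + (perp U *ᵥ v) ⬝ᵥ (perp U *ᵥ w) := by
  rw [perp_dot_perp hU, ← dot_mulVec_comm, ← perp_dot, perp_mulVec, dotProduct_sub]; ring

theorem perp_dot_self_le (hU : Uᵀ * U = 1) (v : Fin n → ℝ) :
    (perp U *ᵥ v) ⬝ᵥ (perp U *ᵥ v) ≤ v ⬝ᵥ v := by
  rw [dot_eq_add_perp hU v v]; linarith [dot_self_nonneg (Uᵀ *ᵥ v)]

theorem transpose_dot_self_le (hU : Uᵀ * U = 1) (v : Fin n → ℝ) :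
    (Uᵀ *ᵥ v) ⬝ᵥ (Uᵀ *ᵥ v) ≤ v ⬝ᵥ v := by
  rw [dot_eq_add_perp hU v v]; linarith [dot_self_nonneg (perp U *ᵥ v)]

theorem len_perp_le (hU : Uᵀ * U = 1) (v : Fin n → ℝ) : len (perp U *ᵥ v) ≤ len v :=
  Real.sqrt_le_sqrt (perp_dot_self_le hU v)

theorem perp_of_transpose_eq_zero {b : Fin n → ℝ} (hb : Uᵀ *ᵥ b = 0) : perp U *ᵥ b = b := by
  rw [perp_mulVec, hb, mulVec_zero, sub_zero]

theorem dot_eq_add_mulVec (a : Fin n → ℝ) (z : Fin r → ℝ) (y : Fin n → ℝ) :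
    a ⬝ᵥ (U *ᵥ z + perp U *ᵥ y) = (Uᵀ *ᵥ a) ⬝ᵥ z + (perp U *ᵥ a) ⬝ᵥ y := by
  rw [dotProduct_add, dot_mulVec_comm, perp_dot]

theorem transpose_mulVec_add (hU : Uᵀ * U = 1) (z : Fin r → ℝ) (y : Fin n → ℝ) :
    Uᵀ *ᵥ (U *ᵥ z + perp U *ᵥ y) = z := by
  rw [mulVec_add, transpose_mulVec_perp hU, add_zero, mulVec_mulVec, hU, one_mulVec]

end Perp

/-! ### Gaussian moments -/

theorem integrable_pow_gaussianReal (k : ℕ) : Integrable (fun t : ℝ => t ^ k) (gaussianReal 0 1) := by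
  have h := (memLp_id_gaussianReal (μ := 0) (v := 1) k).integrable_norm_pow'
  rw [← integrable_norm_iff (by fun_prop)]
  simpa using h

theorem integrable_eval {n : ℕ} (h : MvPolynomial (Fin n) ℝ) :
    Integrable (fun z => MvPolynomial.eval z h) (gauss n) := by
  simp only [MvPolynomial.eval_eq']
  refine integrable_finsetSum _ fun s _ => Integrable.const_mul ?_ _
  exact Integrable.fintype_prod (f := fun i t => t ^ s i) fun i => integrable_pow_gaussianReal _

theorem measurable_eval {n : ℕ} (h : MvPolynomial (Fin n) ℝ) :
    Measurable fun z : Fin n → ℝ => MvPolynomial.eval z h :=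
  (MvPolynomial.continuous_eval h).measurable

/-- The linear form `x ↦ u ⬝ᵥ x` as a polynomial. -/
noncomputable def linPoly {n : ℕ} (u : Fin n → ℝ) : MvPolynomial (Fin n) ℝ :=
  ∑ i, MvPolynomial.C (u i) * MvPolynomial.X i

theorem eval_linPoly {n : ℕ} (u x : Fin n → ℝ) : MvPolynomial.eval x (linPoly u) = u ⬝ᵥ x := by
  simp [linPoly, dotProduct]

theorem integrable_dot_pow {n : ℕ} (u : Fin n → ℝ) (k : ℕ) :
    Integrable (fun x => (u ⬝ᵥ x) ^ k) (gauss n) := by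
  simpa [eval_linPoly] using integrable_eval (linPoly u ^ k)

theorem integrable_dot {n : ℕ} (u : Fin n → ℝ) : Integrable (fun x => u ⬝ᵥ x) (gauss n) := by
  simpa using integrable_dot_pow u 1

theorem integrable_dot_mul_dot {n : ℕ} (u w : Fin n → ℝ) :
    Integrable (fun x => (u ⬝ᵥ x) * (w ⬝ᵥ x)) (gauss n) := by
  simpa [eval_linPoly] using integrable_eval (linPoly u * linPoly w)

theorem integral_dot_pow {n : ℕ} (u : Fin n → ℝ) (k : ℕ) :
    ∫ x, (u ⬝ᵥ x) ^ k ∂gauss n = len u ^ k * ∫ t, t ^ k ∂gaussianReal 0 1 := by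
  by_cases hu : u = 0
  · subst hu
    rcases Nat.eq_zero_or_pos k with rfl | hk
    · simp
    · have : len (0 : Fin n → ℝ) = 0 := len_eq_zero.2 rfl
      simp [this, hk.ne']
  · obtain ⟨e, he, hue⟩ := exists_unit hu
    have h1 : ∀ x, (u ⬝ᵥ x) ^ k = len u ^ k * (e ⬝ᵥ x) ^ k := fun x => by
      conv_lhs => rw [hue]
      rw [smul_dotProduct, smul_eq_mul, mul_pow]
    simp only [h1, integral_const_mul]
    have hm := measurePreserving_dotProduct e he
    rw [← hm.map_eq, integral_map hm.measurable.aemeasurable (by fun_prop)]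

theorem integral_sq_gaussianReal : ∫ t, t ^ 2 ∂gaussianReal 0 1 = 1 := by
  have h := variance_fun_id_gaussianReal (μ := 0) (v := 1)
  rw [variance_eq_integral (by fun_prop)] at h
  simpa using h

theorem integral_dot {n : ℕ} (u : Fin n → ℝ) : ∫ x, u ⬝ᵥ x ∂gauss n = 0 := by
  have := integral_dot_pow u 1
  simpa [integral_id_gaussianReal] using this

theorem integral_dot_sq {n : ℕ} (u : Fin n → ℝ) : ∫ x, (u ⬝ᵥ x) ^ 2 ∂gauss n = u ⬝ᵥ u := by
  rw [integral_dot_pow, integral_sq_gaussianReal, mul_one, len_sq]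

theorem integral_dot_mul_dot {n : ℕ} (u w : Fin n → ℝ) :
    ∫ x, (u ⬝ᵥ x) * (w ⬝ᵥ x) ∂gauss n = u ⬝ᵥ w := by
  have h : ∀ x, (u ⬝ᵥ x) * (w ⬝ᵥ x) = 1 / 4 * (((u + w) ⬝ᵥ x) ^ 2 - ((u - w) ⬝ᵥ x) ^ 2) := by
    intro x; rw [add_dotProduct, sub_dotProduct]; ring
  simp only [h]
  rw [integral_const_mul, integral_sub (integrable_dot_pow _ 2) (integrable_dot_pow _ 2),
    integral_dot_sq, integral_dot_sq]
  simp only [add_dotProduct, sub_dotProduct, dotProduct_add, dotProduct_sub, dotProduct_comm w u]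
  ring

/-- The fourth moment of the standard Gaussian. -/
noncomputable def fourthMoment : ℝ := ∫ t, t ^ 4 ∂gaussianReal 0 1

theorem fourthMoment_nonneg : 0 ≤ fourthMoment := integral_nonneg fun t => by positivity

theorem integral_dot_pow_four {n : ℕ} (u : Fin n → ℝ) :
    ∫ x, (u ⬝ᵥ x) ^ 4 ∂gauss n = (u ⬝ᵥ u) ^ 2 * fourthMoment := by
  rw [integral_dot_pow, fourthMoment, ← len_sq]; ring

/-! ### Perturbing a slab -/

/-- The indicator of the event that `|s|` is within `σ` of `1`. -/
noncomputable def nearOne (σ s : ℝ) : ℝ := if |(|s| - 1)| ≤ σ then 1 else 0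

/-- The indicator of the event that `|s| ≤ 1`. -/
noncomputable def slab (s : ℝ) : ℝ := if |s| ≤ 1 then 1 else 0

theorem nearOne_nonneg (σ s : ℝ) : 0 ≤ nearOne σ s := by unfold nearOne; split_ifs <;> simp

theorem nearOne_le_one (σ s : ℝ) : nearOne σ s ≤ 1 := by unfold nearOne; split_ifs <;> simp

theorem slab_nonneg (s : ℝ) : 0 ≤ slab s := by unfold slab; split_ifs <;> simp

theorem slab_le_one (s : ℝ) : slab s ≤ 1 := by unfold slab; split_ifs <;> simp

@[fun_prop]
theorem measurable_slab : Measurable slab :=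
  Measurable.ite (measurableSet_le (by fun_prop) (by fun_prop)) (by fun_prop) (by fun_prop)

theorem measurable_nearOne : Measurable fun q : ℝ × ℝ => nearOne q.1 q.2 :=
  Measurable.ite (measurableSet_le (by fun_prop) (by fun_prop)) (by fun_prop) (by fun_prop)

/-- A shift by `u` moves `|s|` by at most `|u|`, so the indicator can flip only when `|s|` is within
`|u|` of the boundary value `1`. -/
theorem abs_slab_sub_le (s u : ℝ) : |slab (s + u) - slab s| ≤ nearOne |u| s := by
  have h1 := abs_add_le s u
  have h2 := abs_add_le (s + u) (-u)
  simp only [add_neg_cancel_right, abs_neg] at h2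
  by_cases h : |(|s| - 1)| ≤ |u|
  · rw [nearOne, if_pos h, abs_le]
    constructor <;> linarith [slab_nonneg s, slab_le_one s, slab_nonneg (s + u), slab_le_one (s + u)]
  · have : slab (s + u) = slab s := by
      unfold slab
      rw [not_le, lt_abs] at h
      rcases h with h | h
      · rw [if_neg (by linarith), if_neg (by linarith [abs_nonneg u])]
      · rw [if_pos (by linarith), if_pos (by linarith [abs_nonneg u])]
    rw [this, sub_self, abs_zero]
    exact nearOne_nonneg _ _

/-- The event lies in two intervals of length `2σ/ρ ≤ 4σ` around `±1/ρ`, and the Gaussian density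
times `Y + 2t²` never exceeds `Y + 2`. -/
theorem integral_nearOne_gaussianReal_le {ρ σ Y : ℝ} (hρ : 1 / 2 ≤ ρ) (hσ : 0 ≤ σ) (hY : 0 ≤ Y) :
    ∫ t, nearOne σ (ρ * t) * (Y + 2 * t ^ 2) ∂gaussianReal 0 1 ≤ 8 * σ * (Y + 2) := by
  have hρ0 : 0 < ρ := by linarith
  rw [integral_gaussianReal_eq_integral_smul one_ne_zero]
  have hpdf : ∀ t : ℝ, gaussianPDFReal 0 1 t * (Y + 2 * t ^ 2) ≤ Y + 2 := by
    intro t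
    have h1 : (√(2 * Real.pi * (1 : NNReal)))⁻¹ ≤ 1 := by
      apply inv_le_one_of_one_le₀
      rw [Real.one_le_sqrt]
      have := Real.pi_gt_three
      push_cast; linarith
    have h2 : Real.exp (-(t - 0) ^ 2 / (2 * (1 : NNReal))) * (Y + 2 * t ^ 2) ≤ Y + 2 := by
      set s : ℝ := t ^ 2 / 2 with hs
      have hs0 : 0 ≤ s := by positivity
      have e1 : -(t - 0) ^ 2 / (2 * ((1 : NNReal) : ℝ)) = -s := by push_cast; rw [hs]; ring
      have e2 : t ^ 2 = 2 * s := by rw [hs]; ring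
      rw [e1, e2, Real.exp_neg]
      have h3 := Real.quadratic_le_exp_of_nonneg hs0
      rw [inv_mul_le_iff₀ (Real.exp_pos s)]
      nlinarith [sq_nonneg (s - 1), mul_nonneg hs0 hY, mul_nonneg (sq_nonneg s) hY]
    rw [gaussianPDFReal, mul_assoc]
    calc _ ≤ 1 * (Y + 2) := by
          gcongr
      _ = Y + 2 := one_mul _
  let c : ℝ := 1 / ρ
  let δ : ℝ := σ / ρ
  have hδ : 0 ≤ δ := by positivity
  have hint : ∀ x : ℝ, Integrable (fun t => (Set.Icc (x - δ) (x + δ)).indicator (fun _ => Y + 2) t) := by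
    intro x
    rw [integrable_indicator_iff measurableSet_Icc]
    exact integrableOn_const (by simp)
  have hval : ∀ x : ℝ, ∫ t, (Set.Icc (x - δ) (x + δ)).indicator (fun _ => Y + 2) t
      = 2 * δ * (Y + 2) := by
    intro x
    rw [integral_indicator measurableSet_Icc, setIntegral_const]
    simp only [measureReal_def, Real.volume_Icc, smul_eq_mul]
    rw [ENNReal.toReal_ofReal (by linarith)]; ring
  calc _ ≤ ∫ t, ((Set.Icc (c - δ) (c + δ)).indicator (fun _ => Y + 2) t +
        (Set.Icc (-c - δ) (-c + δ)).indicator (fun _ => Y + 2) t) := by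
        refine integral_mono_of_nonneg (ae_of_all _ fun t => ?_) ((hint c).add (hint (-c)))
          (ae_of_all _ fun t => ?_)
        · exact mul_nonneg (gaussianPDFReal_nonneg _ _ _)
            (mul_nonneg (nearOne_nonneg _ _) (by positivity))
        · have hn : ∀ S : Set ℝ, 0 ≤ S.indicator (fun _ => Y + 2) t :=
            fun S => Set.indicator_nonneg (fun _ _ => by linarith) _
          simp only [smul_eq_mul]
          by_cases h : |(|ρ * t| - 1)| ≤ σ
          · simp only [nearOne, h, if_true, one_mul]
            refine (hpdf t).trans ?_
            rw [abs_le] at h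
            have key : t ∈ Set.Icc (c - δ) (c + δ) ∨ t ∈ Set.Icc (-c - δ) (-c + δ) := by
              rcases le_total 0 t with h0 | h0
              · left
                rw [abs_of_nonneg (by positivity)] at h
                simp only [c, δ, ← sub_div, ← add_div, Set.mem_Icc]
                rw [div_le_iff₀ hρ0, le_div_iff₀ hρ0]
                constructor <;> nlinarith
              · right
                rw [abs_of_nonpos (by nlinarith)] at h
                simp only [c, δ, ← sub_div, ← add_div, Set.mem_Icc, ← neg_div]
                rw [div_le_iff₀ hρ0, le_div_iff₀ hρ0]
                constructor <;> nlinarith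
            rcases key with hk | hk
            · rw [Set.indicator_of_mem hk]; linarith [hn (Set.Icc (-c - δ) (-c + δ))]
            · rw [Set.indicator_of_mem hk]; linarith [hn (Set.Icc (c - δ) (c + δ))]
          · simp only [nearOne, h, if_false, zero_mul, mul_zero]
            exact add_nonneg (hn _) (hn _)
    _ = 4 * δ * (Y + 2) := by
        rw [integral_add (hint c) (hint (-c)), hval, hval]; ring
    _ ≤ 8 * σ * (Y + 2) := by
        have : δ ≤ 2 * σ := by
          rw [div_le_iff₀ hρ0]; nlinarith
        nlinarith

theorem integrable_slab_mul {Ω : Type*} [MeasurableSpace Ω] {μ : Measure Ω} {f g : Ω → ℝ} {c : ℝ}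
    (hg : Integrable g μ) (hf : Measurable f) (hb : ∀ x, |f x| ≤ c) :
    Integrable (fun x => f x * g x) μ :=
  hg.bdd_mul hf.aestronglyMeasurable (ae_of_all _ hb)

theorem abs_nearOne_le (σ s : ℝ) : |nearOne σ s| ≤ 1 := by
  rw [abs_of_nonneg (nearOne_nonneg _ _)]; exact nearOne_le_one _ _

theorem measurable_dot {n : ℕ} (u : Fin n → ℝ) : Measurable fun x : Fin n → ℝ => u ⬝ᵥ x :=
  (continuous_const.dotProduct continuous_id).measurable

theorem measurable_nearOne_comp {Ω : Type*} [MeasurableSpace Ω] {f g : Ω → ℝ} (hf : Measurable f)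
    (hg : Measurable g) : Measurable fun x => nearOne (f x) (g x) :=
  measurable_nearOne.comp (hf.prodMk hg)

/-- Rotate `p` onto a coordinate axis. The event then concerns one Gaussian coordinate, and the part
of `a` off that axis is independent of it and contributes only its variance, at most `1`. The lower
bound on `p ⬝ᵥ p` keeps the boundary layer thin. -/
theorem integral_nearOne_le {r : ℕ} {p a : Fin r → ℝ} {σ Y : ℝ} (hp : 1 / 4 ≤ p ⬝ᵥ p)
    (ha : a ⬝ᵥ a ≤ 1) (hσ : 0 ≤ σ) (hY : 0 ≤ Y) :
    ∫ z, nearOne σ (p ⬝ᵥ z) * (Y + (a ⬝ᵥ z) ^ 2) ∂gauss r ≤ 8 * σ * (Y + 4) := by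
  have hp0 : p ≠ 0 := by
    rintro rfl; simp at hp; linarith
  obtain ⟨e, he, hpe⟩ := exists_unit hp0
  set ρ := len p with hρ
  have hρ2 : 1 / 2 ≤ ρ := by
    rw [hρ, len]; apply Real.le_sqrt_of_sq_le; linarith
  let U : Matrix (Fin r) (Fin 1) ℝ := Matrix.of fun i _ => e i
  have hU : Uᵀ * U = 1 := by
    ext i j; fin_cases i; fin_cases j; simpa [U, Matrix.mul_apply, dotProduct] using he
  have hUd : ∀ (b : Fin r → ℝ) (z : Fin 1 → ℝ), (Uᵀ *ᵥ b) ⬝ᵥ z = (e ⬝ᵥ b) * z 0 := by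
    intro b z; simp [U, dotProduct, mulVec]
  have hpp : perp U *ᵥ p = 0 := by
    have h1 : Uᵀ *ᵥ e = fun _ => 1 := by
      ext j; simpa [U, mulVec, dotProduct] using he
    have h2 : U *ᵥ (fun _ => 1) = e := by ext j; simp [U, mulVec, dotProduct]
    rw [hpe, mulVec_smul, perp_mulVec, h1, h2, sub_self, smul_zero]
  have hm := measurePreserving_mulVec_add U (perp U) (mul_transpose_add_perp hU)
  have hint0 : ∀ b : Fin r → ℝ, Integrable (fun x => Y + (b ⬝ᵥ x) ^ 2) (gauss r) := fun b =>
    (integrable_const _).add (integrable_dot_pow b 2)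
  have hmeas : Measurable fun z : Fin r → ℝ => nearOne σ (p ⬝ᵥ z) :=
    measurable_nearOne_comp measurable_const (measurable_dot p)
  have hint := integrable_slab_mul (hint0 a) hmeas fun x => abs_nearOne_le _ _
  rw [← hm.map_eq, integral_map hm.measurable.aemeasurable (by
    rw [hm.map_eq]; exact hint.aestronglyMeasurable)]
  set a' := perp U *ᵥ a with ha'
  have hev : MeasurePreserving (fun x : Fin 1 → ℝ => x 0) (gauss 1) (gaussianReal 0 1) :=
    measurePreserving_eval (fun _ : Fin 1 => gaussianReal 0 1) 0
  have ia : ∀ Z : ℝ, Integrable (fun t : ℝ => nearOne σ (ρ * t) * (Z + 2 * t ^ 2))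
      (gaussianReal 0 1) := fun Z => integrable_slab_mul
        ((integrable_const _).add ((integrable_pow_gaussianReal 2).const_mul 2))
        (measurable_nearOne_comp measurable_const (by fun_prop)) fun x => abs_nearOne_le _ _
  have ib : Integrable (fun t : ℝ => nearOne σ (ρ * t)) (gaussianReal 0 1) := by
    simpa using integrable_slab_mul (integrable_const (1 : ℝ))
        (measurable_nearOne_comp (measurable_const (a := σ)) (measurable_const_mul ρ))
        fun x => abs_nearOne_le _ _
  have ja : Integrable (fun z : Fin 1 → ℝ => nearOne σ (ρ * z 0) * (Y + 2 * z 0 ^ 2)) (gauss 1) :=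
    hev.integrable_comp_of_integrable (ia Y)
  have jb : Integrable (fun z : Fin 1 → ℝ => nearOne σ (ρ * z 0)) (gauss 1) :=
    hev.integrable_comp_of_integrable ib
  have jc := (integrable_dot_pow a' 2).const_mul 2
  have ga : a ⬝ᵥ e * (a ⬝ᵥ e) ≤ 1 := by
    have := dot_sq_le a e; rw [he] at this; nlinarith
  calc _ ≤ ∫ q : (Fin 1 → ℝ) × (Fin r → ℝ), (nearOne σ (ρ * q.1 0) * (Y + 2 * q.1 0 ^ 2) +
          nearOne σ (ρ * q.1 0) * (2 * (a' ⬝ᵥ q.2) ^ 2)) ∂(gauss 1).prod (gauss r) := by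
        refine integral_mono (hm.integrable_comp_of_integrable hint)
          ((ja.comp_fst _).add (jb.mul_prod jc)) fun q => ?_
        have e1 : p ⬝ᵥ (U *ᵥ q.1 + perp U *ᵥ q.2) = ρ * q.1 0 := by
          rw [dot_eq_add_mulVec, hpp, zero_dotProduct, add_zero, hUd, hpe, dotProduct_smul, he]
          simp
        have e2 : a ⬝ᵥ (U *ᵥ q.1 + perp U *ᵥ q.2) = (a ⬝ᵥ e) * q.1 0 + a' ⬝ᵥ q.2 := by
          rw [dot_eq_add_mulVec, hUd, dotProduct_comm e]
        simp only [e1, e2, ← mul_add]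
        refine mul_le_mul_of_nonneg_left ?_ (nearOne_nonneg _ _)
        nlinarith [sq_nonneg ((a ⬝ᵥ e) * q.1 0 - a' ⬝ᵥ q.2), mul_le_mul_of_nonneg_right ga (sq_nonneg (q.1 0))]
    _ = ∫ t, nearOne σ (ρ * t) * (Y + 2 * t ^ 2) ∂gaussianReal 0 1 +
          (∫ t, nearOne σ (ρ * t) ∂gaussianReal 0 1) * (2 * (a' ⬝ᵥ a')) := by
        rw [integral_add (ja.comp_fst _) (jb.mul_prod jc), integral_prod_mul
          (fun z : Fin 1 → ℝ => nearOne σ (ρ * z 0)) (fun y => 2 * (a' ⬝ᵥ y) ^ 2),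
          integral_fun_fst (fun z : Fin 1 → ℝ => nearOne σ (ρ * z 0) * (Y + 2 * z 0 ^ 2)),
          integral_const_mul, integral_dot_sq]
        rw [← hev.map_eq, integral_map hev.measurable.aemeasurable
          (by rw [hev.map_eq]; exact (ia Y).aestronglyMeasurable),
          integral_map hev.measurable.aemeasurable
          (by rw [hev.map_eq]; exact ib.aestronglyMeasurable)]
        simp
    _ ≤ ∫ t, nearOne σ (ρ * t) * (Y + 2 * t ^ 2) ∂gaussianReal 0 1 +
          (∫ t, nearOne σ (ρ * t) ∂gaussianReal 0 1) * 2 := by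
        have : a' ⬝ᵥ a' ≤ 1 := (perp_dot_self_le hU a).trans ha
        gcongr
        · exact integral_nonneg fun t => nearOne_nonneg _ _
        · linarith
    _ = ∫ t, nearOne σ (ρ * t) * ((Y + 2) + 2 * t ^ 2) ∂gaussianReal 0 1 := by
        rw [← integral_mul_const, ← integral_add (ia Y) (ib.mul_const 2)]
        congr 1; ext t; ring
    _ ≤ _ := by
        have := integral_nearOne_gaussianReal_le hρ2 hσ (show 0 ≤ Y + 2 by linarith)
        linarith

/-- The Lipschitz constant of `integral_abs_slab_sub_le`. -/
noncomputable def slabLip : ℝ := 8 * (51 + 2 * fourthMoment)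

theorem slabLip_pos : 0 < slabLip := by
  have := fourthMoment_nonneg; unfold slabLip; positivity

/-- Writing `v ⬝ᵥ x = p ⬝ᵥ z + q ⬝ᵥ y` with `y` independent of `z`, the indicators differ, for fixed
`y`, only in a layer of width `|q ⬝ᵥ y|` around `|p ⬝ᵥ z| = 1`. The layer has mass `O(|q ⬝ᵥ y|)`,
and averaging over `y` yields a multiple of `len q`. The factor `1 + (a ⬝ᵥ x)²` is there to dominate
the quadratic forms to which the bound is applied. -/
theorem integral_abs_slab_sub_le {n r : ℕ} {U : Matrix (Fin n) (Fin r) ℝ} (hU : Uᵀ * U = 1)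
    {v a : Fin n → ℝ} (hv : 1 / 4 ≤ (Uᵀ *ᵥ v) ⬝ᵥ (Uᵀ *ᵥ v)) (ha : a ⬝ᵥ a ≤ 1) :
    ∫ x, |slab (v ⬝ᵥ x) - slab ((Uᵀ *ᵥ v) ⬝ᵥ (Uᵀ *ᵥ x))| * (1 + (a ⬝ᵥ x) ^ 2) ∂gauss n ≤
      slabLip * len (perp U *ᵥ v) := by
  set p := Uᵀ *ᵥ v with hp
  set q := perp U *ᵥ v with hq
  set a1 := Uᵀ *ᵥ a with ha1
  set a2 := perp U *ᵥ a with ha2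
  have ha1' : a1 ⬝ᵥ a1 ≤ 1 := (transpose_dot_self_le hU a).trans ha
  have ha2' : a2 ⬝ᵥ a2 ≤ 1 := (perp_dot_self_le hU a).trans ha
  have hm := measurePreserving_mulVec_add U (perp U) (mul_transpose_add_perp hU)
  have hmeas : Measurable fun x : Fin n → ℝ => |slab (v ⬝ᵥ x) - slab (p ⬝ᵥ (Uᵀ *ᵥ x))| :=
    ((measurable_slab.comp (measurable_dot v)).sub (measurable_slab.comp
      ((measurable_dot p).comp (measurable_mulVec_left Uᵀ)))).abs
  have hint : Integrable (fun x => |slab (v ⬝ᵥ x) - slab (p ⬝ᵥ (Uᵀ *ᵥ x))| * (1 + (a ⬝ᵥ x) ^ 2))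
      (gauss n) := integrable_slab_mul ((integrable_const _).add (integrable_dot_pow a 2)) hmeas
        (c := 1) fun x => by
      rw [abs_abs, abs_le]
      constructor <;> linarith [slab_nonneg (v ⬝ᵥ x), slab_le_one (v ⬝ᵥ x),
        slab_nonneg (p ⬝ᵥ (Uᵀ *ᵥ x)), slab_le_one (p ⬝ᵥ (Uᵀ *ᵥ x))]
  rw [← hm.map_eq, integral_map hm.measurable.aemeasurable (by
    rw [hm.map_eq]; exact hint.aestronglyMeasurable)]
  have hi1 : Integrable (fun w : (Fin r → ℝ) × (Fin n → ℝ) =>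
      1 + 2 * (a1 ⬝ᵥ w.1) ^ 2 + 2 * (a2 ⬝ᵥ w.2) ^ 2) ((gauss r).prod (gauss n)) :=
    ((integrable_const _).add (((integrable_dot_pow a1 2).const_mul 2).comp_fst _)).add
      (((integrable_dot_pow a2 2).const_mul 2).comp_snd _)
  have hi2 : Integrable (fun w : (Fin r → ℝ) × (Fin n → ℝ) => nearOne |q ⬝ᵥ w.2| (p ⬝ᵥ w.1) *
      (1 + 2 * (a1 ⬝ᵥ w.1) ^ 2 + 2 * (a2 ⬝ᵥ w.2) ^ 2)) ((gauss r).prod (gauss n)) :=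
    integrable_slab_mul hi1 (measurable_nearOne_comp
      ((measurable_dot q).comp measurable_snd).abs ((measurable_dot p).comp measurable_fst))
      fun w => abs_nearOne_le _ _
  have hX : ∀ y, (5 + (a2 ⬝ᵥ y) ^ 2) ^ 2 ≤ 50 + 2 * (a2 ⬝ᵥ y) ^ 4 := fun y => by
    nlinarith [sq_nonneg (5 - (a2 ⬝ᵥ y) ^ 2)]
  have hi3 : ∀ c : ℝ, Integrable (fun y => 8 * (c * (q ⬝ᵥ y) ^ 2 +
      len q * (50 + 2 * (a2 ⬝ᵥ y) ^ 4))) (gauss n) := fun c =>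
    (((integrable_dot_pow q 2).const_mul c).add (((integrable_const _).add
      ((integrable_dot_pow a2 4).const_mul 2)).const_mul _)).const_mul _
  have hq0 := len_nonneg q
  calc _ ≤ ∫ w : (Fin r → ℝ) × (Fin n → ℝ), nearOne |q ⬝ᵥ w.2| (p ⬝ᵥ w.1) *
          (1 + 2 * (a1 ⬝ᵥ w.1) ^ 2 + 2 * (a2 ⬝ᵥ w.2) ^ 2) ∂(gauss r).prod (gauss n) := by
        refine integral_mono (hm.integrable_comp_of_integrable hint) hi2 fun w => ?_
        simp only [transpose_mulVec_add hU, dot_eq_add_mulVec, ← hp, ← hq, ← ha1, ← ha2]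
        refine mul_le_mul (abs_slab_sub_le _ _) ?_ (by positivity) (nearOne_nonneg _ _)
        nlinarith [sq_nonneg (a1 ⬝ᵥ w.1 - a2 ⬝ᵥ w.2)]
    _ = ∫ y, ∫ z, nearOne |q ⬝ᵥ y| (p ⬝ᵥ z) *
          (1 + 2 * (a1 ⬝ᵥ z) ^ 2 + 2 * (a2 ⬝ᵥ y) ^ 2) ∂gauss r ∂gauss n := by
        rw [integral_prod_symm _ hi2]
    -- The inequality `2|s|X ≤ s²/len q + len q * X²` replaces the first absolute moment by even
    -- moments, and both terms have expectation proportional to `len q`. If `len q = 0`, then `q =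
    -- 0` and the convention `0⁻¹ = 0` keeps the bound valid.
    _ ≤ ∫ y, 8 * ((len q)⁻¹ * (q ⬝ᵥ y) ^ 2 + len q * (50 + 2 * (a2 ⬝ᵥ y) ^ 4)) ∂gauss n := by
        refine integral_mono hi2.integral_prod_right (hi3 _) fun y => ?_
        have h1 := integral_nearOne_le (σ := |q ⬝ᵥ y|) (Y := (1 + 2 * (a2 ⬝ᵥ y) ^ 2) / 2) hv ha1'
          (abs_nonneg _) (by positivity)
        have h2 : ∫ z, nearOne |q ⬝ᵥ y| (p ⬝ᵥ z) *
            (1 + 2 * (a1 ⬝ᵥ z) ^ 2 + 2 * (a2 ⬝ᵥ y) ^ 2) ∂gauss r =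
            2 * ∫ z, nearOne |q ⬝ᵥ y| (p ⬝ᵥ z) *
            ((1 + 2 * (a2 ⬝ᵥ y) ^ 2) / 2 + (a1 ⬝ᵥ z) ^ 2) ∂gauss r := by
          rw [← integral_const_mul]; congr 1; ext z; ring
        simp only [h2]
        set X := 5 + (a2 ⬝ᵥ y) ^ 2 with hXd
        have hX5 : 5 ≤ X := by rw [hXd]; linarith [sq_nonneg (a2 ⬝ᵥ y)]
        have h3 : 2 * |q ⬝ᵥ y| * X ≤ (len q)⁻¹ * (q ⬝ᵥ y) ^ 2 + len q * X ^ 2 := by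
          rcases hq0.eq_or_lt with h0 | h0
          · have : q = 0 := len_eq_zero.1 h0.symm
            rw [← h0, this]; simp
          · have e : (len q)⁻¹ * (q ⬝ᵥ y) ^ 2 + len q * X ^ 2 - 2 * |q ⬝ᵥ y| * X =
                (len q)⁻¹ * (|q ⬝ᵥ y| - len q * X) ^ 2 := by
              rw [← sq_abs (q ⬝ᵥ y)]; field_simp; ring
            have : 0 ≤ (len q)⁻¹ * (|q ⬝ᵥ y| - len q * X) ^ 2 := by positivity
            linarith
        have h4 := mul_le_mul_of_nonneg_left (hX y) hq0
        have h5 : (1 + 2 * (a2 ⬝ᵥ y) ^ 2) / 2 + 4 ≤ X := by rw [hXd]; linarith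
        have h6 := mul_le_mul_of_nonneg_left h5 (abs_nonneg (q ⬝ᵥ y))
        nlinarith
    _ ≤ _ := by
        have i1 : Integrable (fun y => (len q)⁻¹ * (q ⬝ᵥ y) ^ 2) (gauss n) :=
          (integrable_dot_pow q 2).const_mul _
        have i2 : Integrable (fun y => 2 * (a2 ⬝ᵥ y) ^ 4) (gauss n) :=
          (integrable_dot_pow a2 4).const_mul 2
        have i3 : Integrable (fun y => len q * (50 + 2 * (a2 ⬝ᵥ y) ^ 4)) (gauss n) :=
          ((integrable_const _).add i2).const_mul _
        rw [integral_const_mul, integral_add i1 i3, integral_const_mul, integral_const_mul,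
          integral_add (integrable_const _) i2, integral_const_mul, integral_dot_sq,
          integral_dot_pow_four, ← len_sq q]
        have h1 : (len q)⁻¹ * len q ^ 2 = len q := by
          rcases hq0.eq_or_lt with h0 | h0
          · rw [← h0]; simp
          · field_simp
        rw [h1]
        have h2 : (a2 ⬝ᵥ a2) ^ 2 * fourthMoment ≤ fourthMoment := by
          have := pow_le_one₀ (n := 2) (dot_self_nonneg a2) ha2'
          exact mul_le_of_le_one_left fourthMoment_nonneg this
        have h3 := mul_le_mul_of_nonneg_left h2 hq0
        simp only [integral_const, probReal_univ, one_smul, slabLip]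
        linarith

/-! ### Weighted second moments -/

/-- The matrix `E[w(x) (x xᵀ - Id)]`. -/
noncomputable def wMat {n : ℕ} (w : (Fin n → ℝ) → ℝ) : Matrix (Fin n) (Fin n) ℝ :=
  Matrix.of fun i j => ∫ x, w x * (x i * x j - if i = j then 1 else 0) ∂gauss n

/-- A measurable weight bounded by one. -/
structure IsWeight {n : ℕ} (w : (Fin n → ℝ) → ℝ) : Prop where
  measurable : Measurable w
  abs_le : ∀ x, |w x| ≤ 1

theorem dot_mul_dot_sub {n : ℕ} (a b x : Fin n → ℝ) :
    (a ⬝ᵥ x) * (b ⬝ᵥ x) - a ⬝ᵥ b =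
      ∑ i, ∑ j, a i * b j * (x i * x j - if i = j then 1 else 0) := by
  simp only [mul_sub, Finset.sum_sub_distrib, mul_ite, mul_one, mul_zero, Finset.sum_ite_eq,
    Finset.mem_univ, if_true]
  congr 1
  rw [dotProduct, dotProduct, Finset.sum_mul_sum]
  exact Finset.sum_congr rfl fun i _ => Finset.sum_congr rfl fun j _ => by ring

theorem dot_mulVec_eq_sum {n : ℕ} (A : Matrix (Fin n) (Fin n) ℝ) (a b : Fin n → ℝ) :
    a ⬝ᵥ A *ᵥ b = ∑ i, ∑ j, a i * b j * A i j := by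
  simp only [dotProduct, mulVec, Finset.mul_sum]
  exact Finset.sum_congr rfl fun i _ => Finset.sum_congr rfl fun j _ => by ring

section Weight
variable {n : ℕ} {w w' : (Fin n → ℝ) → ℝ}

theorem IsWeight.integrable (hw : IsWeight w) (a b : Fin n → ℝ) :
    Integrable (fun x => w x * ((a ⬝ᵥ x) * (b ⬝ᵥ x) - a ⬝ᵥ b)) (gauss n) :=
  integrable_slab_mul ((integrable_dot_mul_dot a b).sub (integrable_const _)) hw.measurable hw.abs_le

theorem dot_wMat_mulVec (hw : IsWeight w) (a b : Fin n → ℝ) :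
    a ⬝ᵥ wMat w *ᵥ b = ∫ x, w x * ((a ⬝ᵥ x) * (b ⬝ᵥ x) - a ⬝ᵥ b) ∂gauss n := by
  have hi : ∀ i j : Fin n, Integrable (fun x : Fin n → ℝ =>
      w x * (x i * x j - if i = j then 1 else 0)) (gauss n) := by
    intro i j
    have := hw.integrable (Pi.single i 1) (Pi.single j 1)
    simpa [Pi.single_apply, eq_comm] using this
  simp only [dot_mul_dot_sub, Finset.mul_sum]
  rw [dot_mulVec_eq_sum, integral_finsetSum]
  · refine Finset.sum_congr rfl fun i _ => ?_
    rw [integral_finsetSum]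
    · refine Finset.sum_congr rfl fun j _ => ?_
      rw [wMat, of_apply, ← integral_const_mul]
      congr 1; ext x; ring
    · intro j _
      exact ((hi i j).const_mul (a i * b j)).congr (ae_of_all _ fun x => by ring)
  · intro i _
    refine integrable_finsetSum _ fun j _ => ?_
    exact ((hi i j).const_mul (a i * b j)).congr (ae_of_all _ fun x => by ring)

theorem wMat_transpose (w : (Fin n → ℝ) → ℝ) : (wMat w)ᵀ = wMat w := by
  ext i j
  simp only [wMat, transpose_apply, of_apply, eq_comm (a := i) (b := j), mul_comm]

theorem abs_integral_weight_le (hw : IsWeight w) {a b : Fin n → ℝ} (ha : a ⬝ᵥ a = 1)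
    (hb : b ⬝ᵥ b = 1) :
    |∫ x, w x * ((a ⬝ᵥ x) * (b ⬝ᵥ x) - a ⬝ᵥ b) ∂gauss n| ≤ 2 := by
  have hab : |a ⬝ᵥ b| ≤ 1 := by
    have := abs_dot_le a b; rwa [len_eq_one ha, len_eq_one hb, mul_one] at this
  have i1 : Integrable (fun x => 1 / 2 * (a ⬝ᵥ x) ^ 2 + 1 / 2 * (b ⬝ᵥ x) ^ 2) (gauss n) :=
    ((integrable_dot_pow a 2).const_mul _).add ((integrable_dot_pow b 2).const_mul _)
  have h := norm_integral_le_of_norm_le (f := fun x => w x * ((a ⬝ᵥ x) * (b ⬝ᵥ x) - a ⬝ᵥ b))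
    (g := fun x => 1 / 2 * (a ⬝ᵥ x) ^ 2 + 1 / 2 * (b ⬝ᵥ x) ^ 2 + 1)
    (i1.add (integrable_const _)) (ae_of_all (gauss n) fun x => ?_)
  · rw [integral_add i1 (integrable_const _), integral_add ((integrable_dot_pow a 2).const_mul _)
      ((integrable_dot_pow b 2).const_mul _), integral_const_mul, integral_const_mul,
      integral_dot_sq, integral_dot_sq, ha, hb] at h
    simp only [integral_const, probReal_univ, one_smul, Real.norm_eq_abs] at h
    linarith
  · rw [Real.norm_eq_abs, abs_mul]
    calc _ ≤ 1 * |(a ⬝ᵥ x) * (b ⬝ᵥ x) - a ⬝ᵥ b| := by gcongr; exact hw.abs_le x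
      _ ≤ |(a ⬝ᵥ x) * (b ⬝ᵥ x)| + |a ⬝ᵥ b| := by rw [one_mul]; exact abs_sub _ _
      _ ≤ _ := by
        have : |(a ⬝ᵥ x) * (b ⬝ᵥ x)| ≤ 1 / 2 * (a ⬝ᵥ x) ^ 2 + 1 / 2 * (b ⬝ᵥ x) ^ 2 := by
          rw [abs_le]; constructor <;>
            nlinarith [sq_nonneg (a ⬝ᵥ x - b ⬝ᵥ x), sq_nonneg (a ⬝ᵥ x + b ⬝ᵥ x)]
        linarith

end Weight

/-- A bound on unit vectors of a scaling-invariant set extends by homogeneity. -/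
theorem abs_form_le_of_unit {n : ℕ} {A : Matrix (Fin n) (Fin n) ℝ} {K : ℝ}
    {S : Set (Fin n → ℝ)} (hS : ∀ (c : ℝ) a, a ∈ S → c • a ∈ S)
    (h : ∀ a ∈ S, ∀ b, a ⬝ᵥ a = 1 → b ⬝ᵥ b = 1 → |a ⬝ᵥ A *ᵥ b| ≤ K) {a b : Fin n → ℝ}
    (haS : a ∈ S) : |a ⬝ᵥ A *ᵥ b| ≤ K * (len a * len b) := by
  by_cases ha : a = 0
  · have : len (0 : Fin n → ℝ) = 0 := len_eq_zero.2 rfl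
    simp [ha, this]
  by_cases hb : b = 0
  · have : len (0 : Fin n → ℝ) = 0 := len_eq_zero.2 rfl
    simp [hb, this]
  obtain ⟨e, he, hae⟩ := exists_unit ha
  obtain ⟨f, hf, hbf⟩ := exists_unit hb
  have heS : e ∈ S := by
    have := hS (len a)⁻¹ a haS
    rw [hae] at this
    rwa [smul_smul, ← hae, inv_mul_cancel₀ (len_pos ha).ne', one_smul] at this
  have h1 : a ⬝ᵥ A *ᵥ b = len a * len b * (e ⬝ᵥ A *ᵥ f) := by
    conv_lhs => rw [hae, hbf]
    rw [mulVec_smul, smul_dotProduct, dotProduct_smul, smul_eq_mul, smul_eq_mul]; ring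
  rw [h1, abs_mul, abs_of_nonneg (mul_nonneg (len_nonneg a) (len_nonneg b)), mul_comm]
  exact mul_le_mul_of_nonneg_right (h e heS f he hf) (mul_nonneg (len_nonneg a) (len_nonneg b))

theorem abs_dot_wMat_le {n : ℕ} {w : (Fin n → ℝ) → ℝ} (hw : IsWeight w) (a b : Fin n → ℝ) :
    |a ⬝ᵥ wMat w *ᵥ b| ≤ 2 * (len a * len b) :=
  abs_form_le_of_unit (S := Set.univ) (fun _ _ _ => trivial) (fun a _ b ha hb => by
    rw [dot_wMat_mulVec hw]; exact abs_integral_weight_le hw ha hb) trivial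

/-! ### The trimming weight -/

/-- The indicator of `|y| > τ`. -/
noncomputable def thr (τ y : ℝ) : ℝ := if |y| ≤ τ then 0 else 1

theorem thr_nonneg (τ y : ℝ) : 0 ≤ thr τ y := by unfold thr; split_ifs <;> simp

theorem thr_le_one (τ y : ℝ) : thr τ y ≤ 1 := by unfold thr; split_ifs <;> simp

theorem measurable_thr (τ : ℝ) : Measurable (thr τ) :=
  Measurable.ite (measurableSet_le (by fun_prop) (by fun_prop)) (by fun_prop) (by fun_prop)

/-- The trimming weight for a label function `H` and vectors `V`. -/
noncomputable def trim {n ℓ : ℕ} (τ : ℝ) (V : Fin ℓ → Fin n → ℝ) (H : (Fin n → ℝ) → ℝ)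
    (x : Fin n → ℝ) : ℝ := thr τ (H x) * ∏ j, slab (V j ⬝ᵥ x)

theorem trim_nonneg {n ℓ : ℕ} (τ : ℝ) (V : Fin ℓ → Fin n → ℝ) (H : (Fin n → ℝ) → ℝ)
    (x : Fin n → ℝ) : 0 ≤ trim τ V H x :=
  mul_nonneg (thr_nonneg _ _) (Finset.prod_nonneg fun _ _ => slab_nonneg _)

theorem trim_le_one {n ℓ : ℕ} (τ : ℝ) (V : Fin ℓ → Fin n → ℝ) (H : (Fin n → ℝ) → ℝ)
    (x : Fin n → ℝ) : trim τ V H x ≤ 1 :=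
  mul_le_one₀ (thr_le_one _ _) (Finset.prod_nonneg fun _ _ => slab_nonneg _)
    (Finset.prod_le_one (fun _ _ => slab_nonneg _) fun _ _ => slab_le_one _)

theorem keep_val {n ℓ : ℕ} (τ : ℝ) (V : Fin ℓ → Fin n → ℝ) (x : Fin n → ℝ) (y : ℝ) :
    (keep τ V x y).val = thr τ y * ∏ j, slab (V j ⬝ᵥ x) := by
  by_cases h : |y| ≤ τ
  · simp [keep, bind, Timed.abs, Timed.ifLe, pure, thr, h]
  · simp only [keep, bind, Timed.abs, Timed.ifLe, thr, h, if_false, one_mul, Timed.prod, pure]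
    refine Finset.prod_congr rfl fun j _ => ?_
    simp only [slab, Timed.dot, Timed.sum, Timed.mul, dotProduct]
    split_ifs <;> rfl

theorem isWeight_trim {n ℓ : ℕ} (τ : ℝ) (V : Fin ℓ → Fin n → ℝ) {H : (Fin n → ℝ) → ℝ}
    (hH : Measurable H) : IsWeight (trim τ V H) where
  measurable := ((measurable_thr τ).comp hH).mul
    (Finset.measurable_fun_prod _ fun j _ => measurable_slab.comp (measurable_dot (V j)))
  abs_le x := by rw [abs_of_nonneg (trim_nonneg _ _ _ _)]; exact trim_le_one _ _ _ _

theorem isWeight_trim_comp {n r ℓ : ℕ} (τ : ℝ) (V : Fin ℓ → Fin n → ℝ) {H : (Fin r → ℝ) → ℝ}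
    (hH : Measurable H) (U : Matrix (Fin n) (Fin r) ℝ) :
    IsWeight (trim τ V fun x => H (Uᵀ *ᵥ x)) :=
  isWeight_trim τ V (hH.comp (measurable_mulVec_left _))

/-- Telescoping: the factors are exchanged one at a time, and all others are at most `1` in absolute
value. -/
theorem abs_prod_sub_prod_le {ι : Type*} (s : Finset ι) (f g : ι → ℝ) (hf : ∀ i, |f i| ≤ 1)
    (hg : ∀ i, |g i| ≤ 1) : |∏ i ∈ s, f i - ∏ i ∈ s, g i| ≤ ∑ i ∈ s, |f i - g i| := by
  classical
  induction s using Finset.induction_on with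
  | empty => simp
  | insert i s hi ih =>
    rw [Finset.prod_insert hi, Finset.prod_insert hi, Finset.sum_insert hi]
    have e : f i * ∏ i ∈ s, f i - g i * ∏ i ∈ s, g i =
      (f i - g i) * ∏ i ∈ s, f i + g i * (∏ i ∈ s, f i - ∏ i ∈ s, g i) := by ring
    rw [e]
    refine (abs_add_le _ _).trans (add_le_add ?_ ?_)
    · rw [abs_mul]
      refine mul_le_of_le_one_right (abs_nonneg _) ?_
      rw [Finset.abs_prod]
      exact Finset.prod_le_one (fun _ _ => abs_nonneg _) fun j _ => hf j
    · rw [abs_mul]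
      exact (mul_le_of_le_one_left (abs_nonneg _) (hg i)).trans ih

theorem abs_slab_le (s : ℝ) : |slab s| ≤ 1 := by
  rw [abs_of_nonneg (slab_nonneg _)]; exact slab_le_one _

section LowRank
variable {n r ℓ : ℕ} {U : Matrix (Fin n) (Fin r) ℝ} {V : Fin ℓ → Fin n → ℝ} {τ : ℝ}
  {H : (Fin r → ℝ) → ℝ}

/-- The trimming weight with the trimming directions projected to the column span of `U` depends
only on the coordinates along `U`; the second moment changes little. -/
theorem abs_integral_trim_sub_le (hU : Uᵀ * U = 1) (hH : Measurable H)
    (hV : ∀ j, 1 / 4 ≤ (Uᵀ *ᵥ V j) ⬝ᵥ (Uᵀ *ᵥ V j)) {a b : Fin n → ℝ} (ha : a ⬝ᵥ a = 1)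
    (hb : b ⬝ᵥ b = 1) :
    |∫ x, trim τ V (fun x => H (Uᵀ *ᵥ x)) x * ((a ⬝ᵥ x) * (b ⬝ᵥ x) - a ⬝ᵥ b) ∂gauss n -
      ∫ x, trim τ (fun j => Uᵀ *ᵥ V j) H (Uᵀ *ᵥ x) * ((a ⬝ᵥ x) * (b ⬝ᵥ x) - a ⬝ᵥ b) ∂gauss n| ≤
      slabLip * ∑ j, len (perp U *ᵥ V j) := by
  have hab : |a ⬝ᵥ b| ≤ 1 := by
    have := abs_dot_le a b; rwa [len_eq_one ha, len_eq_one hb, mul_one] at this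
  have hw1 : IsWeight (trim τ V (fun x => H (Uᵀ *ᵥ x))) :=
    isWeight_trim_comp τ V hH U
  have hw2 : IsWeight (fun x => trim τ (fun j => Uᵀ *ᵥ V j) H (Uᵀ *ᵥ x)) :=
    ⟨(isWeight_trim τ _ hH).measurable.comp (measurable_mulVec_left _),
      fun x => (isWeight_trim τ _ hH).abs_le _⟩
  rw [← integral_sub (hw1.integrable a b) (hw2.integrable a b)]
  let D : Fin ℓ → (Fin n → ℝ) → ℝ := fun j x =>
    |slab (V j ⬝ᵥ x) - slab ((Uᵀ *ᵥ V j) ⬝ᵥ (Uᵀ *ᵥ x))|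
  have hD : ∀ (j : Fin ℓ) (c : Fin n → ℝ),
      Integrable (fun x => D j x * (1 + (c ⬝ᵥ x) ^ 2)) (gauss n) := fun j c =>
    integrable_slab_mul ((integrable_const _).add (integrable_dot_pow c 2))
      ((measurable_slab.comp (measurable_dot (V j))).sub (measurable_slab.comp
        ((measurable_dot _).comp (measurable_mulVec_left Uᵀ)))).abs (c := 1) fun x => by
      rw [abs_abs, abs_le]
      constructor <;> linarith [slab_nonneg (V j ⬝ᵥ x), slab_le_one (V j ⬝ᵥ x),
        slab_nonneg ((Uᵀ *ᵥ V j) ⬝ᵥ (Uᵀ *ᵥ x)), slab_le_one ((Uᵀ *ᵥ V j) ⬝ᵥ (Uᵀ *ᵥ x))]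
  have hS : ∀ c, Integrable (fun x => ∑ j, D j x * (1 + (c ⬝ᵥ x) ^ 2)) (gauss n) := fun c =>
    integrable_finsetSum _ fun j _ => hD j c
  have hB : ∀ c : Fin n → ℝ, c ⬝ᵥ c = 1 → ∫ x, ∑ j, D j x * (1 + (c ⬝ᵥ x) ^ 2) ∂gauss n ≤
      slabLip * ∑ j, len (perp U *ᵥ V j) := fun c hc => by
    rw [integral_finsetSum _ fun j _ => hD j c, Finset.mul_sum]
    exact Finset.sum_le_sum fun j _ => integral_abs_slab_sub_le hU (hV j) hc.le
  have h := norm_integral_le_of_norm_le (μ := gauss n)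
    (f := fun x => trim τ V (fun x => H (Uᵀ *ᵥ x)) x * ((a ⬝ᵥ x) * (b ⬝ᵥ x) - a ⬝ᵥ b) -
      trim τ (fun j => Uᵀ *ᵥ V j) H (Uᵀ *ᵥ x) * ((a ⬝ᵥ x) * (b ⬝ᵥ x) - a ⬝ᵥ b))
    (((hS a).add (hS b)).const_mul (1 / 2)) (ae_of_all (gauss n) fun x => ?_)
  · rw [Real.norm_eq_abs] at h
    refine h.trans ?_
    rw [integral_const_mul]
    simp only [Pi.add_apply]
    rw [integral_add (hS a) (hS b)]
    linarith [hB a ha, hB b hb]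
  · rw [← sub_mul, Real.norm_eq_abs, abs_mul]
    have h1 : |trim τ V (fun x => H (Uᵀ *ᵥ x)) x - trim τ (fun j => Uᵀ *ᵥ V j) H (Uᵀ *ᵥ x)| ≤
        ∑ j, D j x := by
      rw [trim, trim, ← mul_sub, abs_mul, abs_of_nonneg (thr_nonneg _ _)]
      exact (mul_le_of_le_one_left (abs_nonneg _) (thr_le_one _ _)).trans
        (abs_prod_sub_prod_le _ _ _ (fun _ => abs_slab_le _) fun _ => abs_slab_le _)
    have h2 : |(a ⬝ᵥ x) * (b ⬝ᵥ x) - a ⬝ᵥ b| ≤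
        1 / 2 * ((1 + (a ⬝ᵥ x) ^ 2) + (1 + (b ⬝ᵥ x) ^ 2)) := by
      rw [abs_le] at hab ⊢
      constructor <;>
        nlinarith [sq_nonneg (a ⬝ᵥ x - b ⬝ᵥ x), sq_nonneg (a ⬝ᵥ x + b ⬝ᵥ x)]
    refine (mul_le_mul h1 h2 (abs_nonneg _) (Finset.sum_nonneg fun j _ => abs_nonneg _)).trans
      (le_of_eq ?_)
    simp only [Pi.add_apply, ← Finset.sum_mul]; ring

theorem isWeight_trim_transpose (τ : ℝ) (p : Fin ℓ → Fin r → ℝ) (hH : Measurable H)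
    (U : Matrix (Fin n) (Fin r) ℝ) : IsWeight (fun x => trim τ p H (Uᵀ *ᵥ x)) :=
  ⟨(isWeight_trim τ _ hH).measurable.comp (measurable_mulVec_left _),
      fun _ => (isWeight_trim τ _ hH).abs_le _⟩

/-- Given `z = Uᵀ x`, the weight is constant and `a ⬝ᵥ x = a ⬝ᵥ y` for an independent standard
Gaussian `y`. The cross term with `z` averages to zero, and the product of the two `y` terms
averages to exactly the subtracted `a ⬝ᵥ b`. -/
theorem integral_trim_eq_zero (hU : Uᵀ * U = 1) (hH : Measurable H) (p : Fin ℓ → Fin r → ℝ)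
    {a : Fin n → ℝ} (b : Fin n → ℝ) (ha : Uᵀ *ᵥ a = 0) :
    ∫ x, trim τ p H (Uᵀ *ᵥ x) * ((a ⬝ᵥ x) * (b ⬝ᵥ x) - a ⬝ᵥ b) ∂gauss n = 0 := by
  have hm := measurePreserving_mulVec_add U (perp U) (mul_transpose_add_perp hU)
  have hint := (isWeight_trim_transpose τ p hH U).integrable a b
  rw [← hm.map_eq, integral_map hm.measurable.aemeasurable (by
    rw [hm.map_eq]; exact hint.aestronglyMeasurable)]
  have hint' := hm.integrable_comp_of_integrable hint
  simp only [Function.comp_def] at hint'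
  rw [integral_prod _ hint']
  refine integral_eq_zero_of_ae (ae_of_all _ fun z => ?_)
  simp only [transpose_mulVec_add hU, dot_eq_add_mulVec, ha, zero_dotProduct, zero_add,
    perp_of_transpose_eq_zero ha]
  rw [integral_const_mul]
  have e : ∀ y, a ⬝ᵥ y * ((Uᵀ *ᵥ b) ⬝ᵥ z + (perp U *ᵥ b) ⬝ᵥ y) - a ⬝ᵥ b =
      (Uᵀ *ᵥ b) ⬝ᵥ z * (a ⬝ᵥ y) + ((a ⬝ᵥ y) * ((perp U *ᵥ b) ⬝ᵥ y) - a ⬝ᵥ b) := fun y => by ring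
  simp only [e]
  have i1 : Integrable (fun y => (a ⬝ᵥ y) * ((perp U *ᵥ b) ⬝ᵥ y) - a ⬝ᵥ b) (gauss n) :=
    (integrable_dot_mul_dot _ _).sub (integrable_const _)
  rw [integral_add ((integrable_dot a).const_mul _) i1, integral_const_mul, integral_dot,
    integral_sub (integrable_dot_mul_dot _ _) (integrable_const _), integral_dot_mul_dot,
    perp_dot, perp_of_transpose_eq_zero ha]
  simp

theorem measurePreserving_transpose (hU : Uᵀ * U = 1) :
    MeasurePreserving (fun x : Fin n → ℝ => Uᵀ *ᵥ x) (gauss n) (gauss r) :=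
  measurePreserving_mulVec Uᵀ (by rwa [transpose_transpose])

/-- The trimmed second moment almost vanishes off the column span of `U`. -/
theorem abs_dot_wMat_trim_le (hU : Uᵀ * U = 1) (hH : Measurable H)
    (hV : ∀ j, 1 / 4 ≤ (Uᵀ *ᵥ V j) ⬝ᵥ (Uᵀ *ᵥ V j)) {a : Fin n → ℝ} (b : Fin n → ℝ)
    (ha : Uᵀ *ᵥ a = 0) :
    |a ⬝ᵥ wMat (trim τ V (fun x => H (Uᵀ *ᵥ x))) *ᵥ b| ≤
      slabLip * (∑ j, len (perp U *ᵥ V j)) * (len a * len b) := by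
  refine abs_form_le_of_unit (S := {a | Uᵀ *ᵥ a = 0}) (fun c a h => ?_)
    (fun a h b ha hb => ?_) ha
  · simp only [Set.mem_ofPred_eq] at h ⊢
    rw [mulVec_smul, h, smul_zero]
  · rw [dot_wMat_mulVec (isWeight_trim_comp τ V hH U)]
    have := abs_integral_trim_sub_le (τ := τ) hU hH hV ha hb
    rwa [integral_trim_eq_zero hU hH _ b h, sub_zero] at this

/-- A direction in the column span of `U` that is correlated with the trimmed labels. -/
theorem le_dot_wMat_trim (hU : Uᵀ * U = 1) (hH : Measurable H)
    (hV : ∀ j, 1 / 4 ≤ (Uᵀ *ᵥ V j) ⬝ᵥ (Uᵀ *ᵥ V j)) {c : Fin r → ℝ} (hc : c ⬝ᵥ c = 1) :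
    ∫ z, trim τ (fun j => Uᵀ *ᵥ V j) H z * ((c ⬝ᵥ z) ^ 2 - 1) ∂gauss r -
      slabLip * (∑ j, len (perp U *ᵥ V j)) ≤
      (U *ᵥ c) ⬝ᵥ wMat (trim τ V (fun x => H (Uᵀ *ᵥ x))) *ᵥ (U *ᵥ c) := by
  have h1 : (U *ᵥ c) ⬝ᵥ (U *ᵥ c) = 1 := by
    rw [dot_mulVec_comm, mulVec_mulVec, hU, one_mulVec, hc]
  have h2 := abs_integral_trim_sub_le (τ := τ) hU hH hV h1 h1
  rw [dot_wMat_mulVec (isWeight_trim_comp τ V hH U)]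
  have hm := measurePreserving_transpose hU
  have hint := (isWeight_trim τ (fun j => Uᵀ *ᵥ V j) hH).integrable c c
  have h3 : ∫ z, trim τ (fun j => Uᵀ *ᵥ V j) H z * ((c ⬝ᵥ z) ^ 2 - 1) ∂gauss r =
      ∫ x, trim τ (fun j => Uᵀ *ᵥ V j) H (Uᵀ *ᵥ x) * (((U *ᵥ c) ⬝ᵥ x) * ((U *ᵥ c) ⬝ᵥ x) -
        (U *ᵥ c) ⬝ᵥ (U *ᵥ c)) ∂gauss n := by
    have e : ∀ z, (c ⬝ᵥ z) ^ 2 - 1 = (c ⬝ᵥ z) * (c ⬝ᵥ z) - c ⬝ᵥ c := fun z => by rw [hc]; ring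
    simp only [e]
    rw [← hm.map_eq, integral_map hm.measurable.aemeasurable (by
      rw [hm.map_eq]; exact hint.aestronglyMeasurable)]
    congr 1; ext x
    rw [dot_mulVec_comm, transpose_transpose, h1, hc]
  rw [h3]
  rw [abs_le] at h2
  linarith [h2.1]

end LowRank

/-! ### Normalized polynomials in a slab -/

section Poly
variable {r : ℕ}

/-- The directional derivative of a polynomial. -/
noncomputable def dirDeriv (w : Fin r → ℝ) (h : MvPolynomial (Fin r) ℝ) : MvPolynomial (Fin r) ℝ :=
  ∑ i, MvPolynomial.C (w i) * MvPolynomial.pderiv i h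

theorem integral_dirDeriv_sq (w : Fin r → ℝ) (h : MvPolynomial (Fin r) ℝ) :
    ∫ z, MvPolynomial.eval z (dirDeriv w h) ^ 2 ∂gauss r = w ⬝ᵥ gradCov h *ᵥ w := by
  have e : ∀ z, MvPolynomial.eval z (dirDeriv w h) ^ 2 = ∑ i, ∑ j, w i * w j *
      (MvPolynomial.eval z (MvPolynomial.pderiv i h) *
        MvPolynomial.eval z (MvPolynomial.pderiv j h)) := by
    intro z
    simp only [dirDeriv, map_sum, map_mul, MvPolynomial.eval_C, sq, Finset.sum_mul_sum]
    exact Finset.sum_congr rfl fun i _ => Finset.sum_congr rfl fun j _ => by ring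
  have hi : ∀ i j, Integrable (fun z => w i * w j *
      (MvPolynomial.eval z (MvPolynomial.pderiv i h) *
        MvPolynomial.eval z (MvPolynomial.pderiv j h))) (gauss r) := fun i j => by
    have := integrable_eval (MvPolynomial.pderiv i h * MvPolynomial.pderiv j h)
    simp only [map_mul] at this
    exact this.const_mul _
  simp only [e]
  rw [integral_finsetSum _ fun i _ => integrable_finsetSum _ fun j _ => hi i j, dot_mulVec_eq_sum]
  refine Finset.sum_congr rfl fun i _ => ?_
  rw [integral_finsetSum _ fun j _ => hi i j]
  refine Finset.sum_congr rfl fun j _ => ?_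
  rw [integral_const_mul, gradCov, of_apply]

/-- The restriction of a polynomial to the line `t + s w`. -/
noncomputable def restrictLine (t w : Fin r → ℝ) : MvPolynomial (Fin r) ℝ →ₐ[ℝ] Polynomial ℝ :=
  MvPolynomial.aeval fun i => Polynomial.C (t i) + Polynomial.C (w i) * Polynomial.X

theorem eval_restrictLine (t w : Fin r → ℝ) (h : MvPolynomial (Fin r) ℝ) (s : ℝ) :
    (restrictLine t w h).eval s = MvPolynomial.eval (t + s • w) h := by
  induction h using MvPolynomial.induction_on with
  | C a => simp [restrictLine]
  | add p q hp hq => simp [map_add, hp, hq]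
  | mul_X p i hp =>
    rw [map_mul, Polynomial.eval_mul, hp, map_mul, MvPolynomial.eval_X]
    simp only [restrictLine, MvPolynomial.aeval_X, Polynomial.eval_add, Polynomial.eval_mul,
      Polynomial.eval_C, Polynomial.eval_X, Pi.add_apply, Pi.smul_apply, smul_eq_mul]
    ring

theorem eval_derivative_restrictLine (t w : Fin r → ℝ) (h : MvPolynomial (Fin r) ℝ) (s : ℝ) :
    (restrictLine t w h).derivative.eval s = MvPolynomial.eval (t + s • w) (dirDeriv w h) := by
  induction h using MvPolynomial.induction_on with
  | C a => simp [restrictLine, dirDeriv]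
  | add p q hp hq =>
    rw [map_add, Polynomial.derivative_add, Polynomial.eval_add, hp, hq]
    simp [dirDeriv, mul_add, Finset.sum_add_distrib]
  | mul_X p i hp =>
    rw [map_mul, Polynomial.derivative_mul, Polynomial.eval_add, Polynomial.eval_mul,
      Polynomial.eval_mul, hp]
    have h1 : restrictLine t w (MvPolynomial.X i) =
        Polynomial.C (t i) + Polynomial.C (w i) * Polynomial.X := by simp [restrictLine]
    have h2 : dirDeriv w (p * MvPolynomial.X i) =
        dirDeriv w p * MvPolynomial.X i + p * MvPolynomial.C (w i) := by
      simp only [dirDeriv, MvPolynomial.pderiv_mul, MvPolynomial.pderiv_X, mul_add,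
        Finset.sum_add_distrib, Finset.sum_mul]
      congr 1
      · exact Finset.sum_congr rfl fun j _ => by ring
      · rw [Finset.sum_eq_single i]
        · simp; ring
        · intro j _ hj; simp [hj.symm]
        · simp
    rw [h1, h2]
    simp only [eval_restrictLine, Polynomial.derivative_C, Polynomial.derivative_C_mul,
      Polynomial.derivative_X, Polynomial.eval_add, Polynomial.eval_mul, Polynomial.eval_C,
      Polynomial.eval_X, Polynomial.eval_one, map_add, map_mul, MvPolynomial.eval_X,
      MvPolynomial.eval_C, Pi.add_apply, Pi.smul_apply, smul_eq_mul, Polynomial.eval_zero]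
    ring

/-- A polynomial that is bounded on a slab is constant along every direction of the slab. -/
theorem dirDeriv_eq_zero_of_bounded {ℓ : ℕ} (h : MvPolynomial (Fin r) ℝ) (p : Fin ℓ → Fin r → ℝ)
    {w : Fin r → ℝ} (hw : ∀ j, p j ⬝ᵥ w = 0) {τ : ℝ}
    (hb : ∀ z, (∀ j, |p j ⬝ᵥ z| < 1) → |MvPolynomial.eval z h| ≤ τ) : dirDeriv w h = 0 := by
  have hopen : IsOpen {z : Fin r → ℝ | ∀ j, |p j ⬝ᵥ z| < 1} := by
    simp only [Set.ofPred_forall]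
    exact isOpen_iInter_of_finite fun j => isOpen_lt
      ((continuous_const.dotProduct continuous_id).abs) continuous_const
  obtain ⟨η, hη, hball⟩ := Metric.isOpen_iff.1 hopen 0 (by simp)
  rw [ball_pi _ hη] at hball
  -- A polynomial that vanishes on a product of infinite sets is zero, so a small cube inside the
  -- slab suffices.
  refine MvPolynomial.funext_set (fun _ => Metric.ball (0 : ℝ) η) (fun _ => ?_) fun t ht => ?_
  · rw [Real.ball_eq_Ioo]; exact Set.Ioo_infinite (by linarith)
  · have ht' : ∀ j, |p j ⬝ᵥ t| < 1 := hball ht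
    -- The line `t + s w` never leaves the slab, so the restriction is a bounded real polynomial and
    -- hence constant.
    have hdeg : (restrictLine t w h).degree ≤ 0 := by
      rw [← Polynomial.isBoundedUnder_abs_atTop_iff]
      refine ⟨τ, Filter.eventually_map.2 (Filter.Eventually.of_forall fun s => ?_)⟩
      rw [eval_restrictLine]
      refine hb _ fun j => ?_
      rw [dotProduct_add, dotProduct_smul, hw, smul_zero, add_zero]
      exact ht' j
    have h1 := eval_derivative_restrictLine t w h 0
    rw [Polynomial.eq_C_of_degree_le_zero hdeg] at h1
    simpa using h1.symm

theorem exists_ne_zero_dot_eq_zero {ℓ : ℕ} (hℓ : ℓ < r) (p : Fin ℓ → Fin r → ℝ) :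
    ∃ w : Fin r → ℝ, w ≠ 0 ∧ ∀ j, p j ⬝ᵥ w = 0 := by
  have h := LinearMap.ker_ne_bot_of_finrank_lt (f := (Matrix.of p).mulVecLin) (by simpa using hℓ)
  obtain ⟨w, hw, hw0⟩ := Submodule.exists_mem_ne_zero_of_ne_bot h
  exact ⟨w, hw0, fun j => congrFun hw j⟩

/-- A polynomial whose gradient covariance is bounded below exceeds every threshold inside every
slab of codimension less than the dimension. -/
theorem exists_large_in_slab {ℓ : ℕ} (hℓ : ℓ < r) (p : Fin ℓ → Fin r → ℝ)
    {h : MvPolynomial (Fin r) ℝ} {α : ℝ} (hα : 0 < α)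
    (hG : ∀ w, α * (w ⬝ᵥ w) ≤ w ⬝ᵥ gradCov h *ᵥ w) (τ : ℝ) :
    ∃ z, τ < |MvPolynomial.eval z h| ∧ ∀ j, |p j ⬝ᵥ z| < 1 := by
  by_contra hcon
  push Not at hcon
  obtain ⟨w, hw0, hw⟩ := exists_ne_zero_dot_eq_zero hℓ p
  have h0 : dirDeriv w h = 0 := dirDeriv_eq_zero_of_bounded h p hw (τ := τ) fun z hz => by
    by_contra hlt
    obtain ⟨j, hj⟩ := hcon z (not_le.1 hlt)
    exact absurd (hz j) (not_lt.2 hj)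
  have h1 := integral_dirDeriv_sq w h
  rw [h0] at h1
  simp only [map_zero, ne_eq, OfNat.ofNat_ne_zero, not_false_eq_true, zero_pow,
    integral_zero] at h1
  have h2 := hG w
  rw [← h1, ← len_sq] at h2
  have := len_pos hw0
  nlinarith [mul_pos hα (pow_pos this 2)]

/-- A partial derivative with zero second moment vanishes almost everywhere, hence everywhere since
the Gaussian charges open sets. So `h` is a constant, equal to its mean. This is the definiteness
behind the coefficient bound. -/
theorem eq_zero_of_moments_eq_zero {h : MvPolynomial (Fin r) ℝ}
    (h0 : ∫ z, MvPolynomial.eval z h ∂gauss r = 0)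
    (h1 : ∀ i, gradCov h i i = 0) : h = 0 := by
  have hp : ∀ i, MvPolynomial.pderiv i h = 0 := by
    intro i
    have h2 := h1 i
    simp only [gradCov, of_apply] at h2
    have hi := integrable_eval (MvPolynomial.pderiv i h * MvPolynomial.pderiv i h)
    simp only [map_mul] at hi
    rw [integral_eq_zero_iff_of_nonneg (fun z => mul_self_nonneg _) hi] at h2
    have h3 := (Continuous.ae_eq_iff_eq (gauss r)
      ((MvPolynomial.continuous_eval _).mul (MvPolynomial.continuous_eval _))
        continuous_zero).1 h2
    refine MvPolynomial.funext fun z => ?_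
    have := congrFun h3 z
    simpa using this
  have hC : h = MvPolynomial.C (MvPolynomial.coeff 0 h) := by
    ext m
    rw [MvPolynomial.coeff_C]
    split_ifs with hm
    · rw [← hm]
    · obtain ⟨i, hi⟩ : ∃ i, m i ≠ 0 := by
        by_contra hcon
        push Not at hcon
        exact hm (Finsupp.ext fun i => (hcon i).symm)
      -- For `m i ≠ 0`, the coefficient of `m` in `h` appears, with the nonzero factor `m i`, as the
      -- coefficient of `m - eᵢ` in `∂ᵢ h = 0`.
      have h2 := MvPolynomial.coeff_pderiv (i := i) h (m - Finsupp.single i 1)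
      rw [hp i, MvPolynomial.coeff_zero, tsub_add_cancel_of_le (by
        rw [Finsupp.single_le_iff]; omega)] at h2
      rcases mul_eq_zero.1 h2.symm with h3 | h3
      · exact h3
      · exact absurd h3 (by positivity)
  rw [hC] at h0
  simp only [MvPolynomial.eval_C, integral_const, probReal_univ, one_smul] at h0
  rw [hC, h0, map_zero]

/-! ### Compactness -/

variable {ι : Type} [Fintype ι]

/-- The polynomial with coefficients `c` in the family `b`. -/
noncomputable def combo (b : ι → MvPolynomial (Fin r) ℝ) (c : ι → ℝ) : MvPolynomial (Fin r) ℝ :=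
  ∑ k, c k • b k

theorem eval_combo (b : ι → MvPolynomial (Fin r) ℝ) (c : ι → ℝ) (z : Fin r → ℝ) :
    MvPolynomial.eval z (combo b c) = ∑ k, c k * MvPolynomial.eval z (b k) := by
  simp [combo, MvPolynomial.smul_eval]

theorem continuous_eval_combo (b : ι → MvPolynomial (Fin r) ℝ) :
    Continuous fun q : (ι → ℝ) × (Fin r → ℝ) => MvPolynomial.eval q.2 (combo b q.1) := by
  simp only [eval_combo]
  exact continuous_finsetSum _ fun k _ => ((continuous_apply k).comp continuous_fst).mul
    ((MvPolynomial.continuous_eval (b k)).comp continuous_snd)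

theorem pderiv_combo (b : ι → MvPolynomial (Fin r) ℝ) (c : ι → ℝ) (i : Fin r) :
    MvPolynomial.pderiv i (combo b c) = combo (fun k => MvPolynomial.pderiv i (b k)) c := by
  simp [combo, map_sum]

theorem continuous_gradCov_combo (b : ι → MvPolynomial (Fin r) ℝ) (i j : Fin r) :
    Continuous fun c : ι → ℝ => gradCov (combo b c) i j := by
  have e : ∀ c : ι → ℝ, gradCov (combo b c) i j = ∑ k, ∑ l, c k * c l *
      ∫ z, MvPolynomial.eval z (MvPolynomial.pderiv i (b k)) *
        MvPolynomial.eval z (MvPolynomial.pderiv j (b l)) ∂gauss r := by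
    intro c
    have hi : ∀ k l, Integrable (fun z => c k * c l *
        (MvPolynomial.eval z (MvPolynomial.pderiv i (b k)) *
          MvPolynomial.eval z (MvPolynomial.pderiv j (b l)))) (gauss r) := fun k l => by
      have := integrable_eval (MvPolynomial.pderiv i (b k) * MvPolynomial.pderiv j (b l))
      simp only [map_mul] at this
      exact this.const_mul _
    simp only [gradCov, of_apply, pderiv_combo, eval_combo, Finset.sum_mul_sum]
    have e2 : ∀ z : Fin r → ℝ, (∑ k, ∑ l, c k * MvPolynomial.eval z (MvPolynomial.pderiv i (b k)) *
        (c l * MvPolynomial.eval z (MvPolynomial.pderiv j (b l)))) = ∑ k, ∑ l, c k * c l *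
        (MvPolynomial.eval z (MvPolynomial.pderiv i (b k)) *
          MvPolynomial.eval z (MvPolynomial.pderiv j (b l))) := fun z =>
      Finset.sum_congr rfl fun k _ => Finset.sum_congr rfl fun l _ => by ring
    simp only [e2]
    rw [integral_finsetSum _ fun k _ => integrable_finsetSum _ fun l _ => hi k l]
    refine Finset.sum_congr rfl fun k _ => ?_
    rw [integral_finsetSum _ fun l _ => hi k l]
    exact Finset.sum_congr rfl fun l _ => integral_const_mul _ _
  simp only [e]
  fun_prop

theorem integral_combo (b : ι → MvPolynomial (Fin r) ℝ) (c : ι → ℝ) :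
    ∫ z, MvPolynomial.eval z (combo b c) ∂gauss r =
      ∑ k, c k * ∫ z, MvPolynomial.eval z (b k) ∂gauss r := by
  simp only [eval_combo]
  rw [integral_finsetSum _ fun k _ => (integrable_eval (b k)).const_mul _]
  exact Finset.sum_congr rfl fun k _ => integral_const_mul _ _

theorem gradCov_smul (t : ℝ) (h : MvPolynomial (Fin r) ℝ) (i j : Fin r) :
    gradCov (t • h) i j = t ^ 2 * gradCov h i j := by
  simp only [gradCov, of_apply, Derivation.map_smul, MvPolynomial.smul_eval,
    ← integral_const_mul]
  congr 1; ext z; ring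

theorem combo_smul (b : ι → MvPolynomial (Fin r) ℝ) (t : ℝ) (c : ι → ℝ) :
    combo b (t • c) = t • combo b c := by
  simp [combo, Finset.smul_sum, smul_smul]

/-- Normalized polynomials have bounded coefficients. -/
theorem exists_coeff_bound {b : ι → MvPolynomial (Fin r) ℝ} (hb : LinearIndependent ℝ b) :
    ∃ B : ℝ, ∀ c : ι → ℝ, ∫ z, MvPolynomial.eval z (combo b c) ∂gauss r = 0 →
      (∀ i, gradCov (combo b c) i i ≤ 1) → ‖c‖ ≤ B := by
  -- `q` is a positive definite quadratic form in the coefficients, at most `r` on normalized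
  -- polynomials. Its minimum `κ` on the unit sphere and homogeneity give `κ ‖c‖² ≤ r`.
  let q : (ι → ℝ) → ℝ := fun c =>
    (∫ z, MvPolynomial.eval z (combo b c) ∂gauss r) ^ 2 + ∑ i, gradCov (combo b c) i i
  have hnn : ∀ c i, 0 ≤ gradCov (combo b c) i i := fun c i => by
    simp only [gradCov, of_apply]; exact integral_nonneg fun z => mul_self_nonneg _
  have hq : Continuous q := by
    refine Continuous.add ?_ (continuous_finsetSum _ fun i _ => continuous_gradCov_combo b i i)
    simp only [integral_combo]; fun_prop
  have hpos : ∀ c ∈ Metric.sphere (0 : ι → ℝ) 1, 0 < q c := by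
    intro c hc
    have h0 : 0 ≤ q c := add_nonneg (sq_nonneg _) (Finset.sum_nonneg fun i _ => hnn c i)
    refine h0.lt_of_ne fun h1 => ?_
    have h2 := (add_eq_zero_iff_of_nonneg (sq_nonneg _)
      (Finset.sum_nonneg fun i _ => hnn c i)).1 h1.symm
    have h3 := eq_zero_of_moments_eq_zero (pow_eq_zero_iff two_ne_zero |>.1 h2.1) fun i =>
      (Finset.sum_eq_zero_iff_of_nonneg fun i _ => hnn c i).1 h2.2 i (Finset.mem_univ i)
    have h4 : c = 0 := funext fun k => Fintype.linearIndependent_iff.1 hb c h3 k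
    rw [h4] at hc; simp at hc
  obtain ⟨κ, hκ, hκq⟩ : ∃ κ : ℝ, 0 < κ ∧ ∀ c ∈ Metric.sphere (0 : ι → ℝ) 1, κ ≤ q c := by
    rcases (Metric.sphere (0 : ι → ℝ) 1).eq_empty_or_nonempty with h | h
    · exact ⟨1, one_pos, by simp [h]⟩
    · obtain ⟨c, hc, hmin⟩ := (isCompact_sphere (0 : ι → ℝ) 1).exists_isMinOn h hq.continuousOn
      exact ⟨q c, hpos c hc, fun c' hc' => hmin hc'⟩
  refine ⟨√(r / κ), fun c h0 h1 => Real.le_sqrt_of_sq_le ?_⟩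
  by_cases hc : c = 0
  · subst hc
    have : (0 : ℝ) ≤ r / κ := by positivity
    simpa using this
  have hn : 0 < ‖c‖ := norm_pos_iff.2 hc
  have h2 : q c = ‖c‖ ^ 2 * q (‖c‖⁻¹ • c) := by
    have h3 : c = ‖c‖ • (‖c‖⁻¹ • c) := by rw [smul_smul, mul_inv_cancel₀ hn.ne', one_smul]
    have h4 : ∀ (t : ℝ) c, q (t • c) = t ^ 2 * q c := by
      intro t c
      simp only [q, combo_smul, gradCov_smul, MvPolynomial.smul_eval, integral_const_mul]
      rw [mul_pow, mul_add, Finset.mul_sum]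
    conv_lhs => rw [h3]
    rw [h4]
  have h5 := hκq (‖c‖⁻¹ • c) (by simp [norm_smul, hn.ne'])
  have h6 : q c ≤ r := by
    simp only [q, h0]
    have := Finset.sum_le_sum fun i (_ : i ∈ Finset.univ) => h1 i
    simpa using this
  rw [le_div_iff₀ hκ]
  calc ‖c‖ ^ 2 * κ ≤ ‖c‖ ^ 2 * q (‖c‖⁻¹ • c) := by gcongr
    _ ≤ (r : ℝ) := by rw [← h2]; exact h6

/-- Open conditions that are satisfiable for all parameters in a compact set have probability
bounded below. -/
theorem exists_measure_lower_bound {Θ : Type*} [TopologicalSpace Θ] {K : Set Θ} (hK : IsCompact K)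
    {O : Set (Θ × (Fin r → ℝ))} (hO : IsOpen O) (hne : ∀ θ ∈ K, ∃ z, (θ, z) ∈ O) :
    ∃ lam : ℝ, 0 < lam ∧ ∀ θ ∈ K, lam ≤ (gauss r).real {z | (θ, z) ∈ O} := by
  refine hK.induction_on (p := fun S => ∃ lam : ℝ, 0 < lam ∧
    ∀ θ ∈ S, lam ≤ (gauss r).real {z | (θ, z) ∈ O}) ⟨1, one_pos, by simp⟩ ?_ ?_ ?_
  · rintro s t hst ⟨l, hl, h⟩
    exact ⟨l, hl, fun θ hθ => h θ (hst hθ)⟩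
  · rintro s t ⟨l, hl, h⟩ ⟨l', hl', h'⟩
    refine ⟨min l l', lt_min hl hl', ?_⟩
    rintro θ (hθ | hθ)
    · exact (min_le_left _ _).trans (h θ hθ)
    · exact (min_le_right _ _).trans (h' θ hθ)
  · intro θ hθ
    obtain ⟨z, hz⟩ := hne θ hθ
    -- Locally a box `u ×ˢ v` fits into `O`, so the positive measure of the single set `v` serves
    -- all parameters in `u`.
    obtain ⟨u, hu, v, hv, huv⟩ := mem_nhds_prod_iff.1 (hO.mem_nhds hz)
    refine ⟨u, mem_nhdsWithin_of_mem_nhds hu, (gauss r).real v, ?_, fun θ' hθ' => ?_⟩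
    · exact ENNReal.toReal_pos (Measure.measure_pos_of_mem_nhds _ hv).ne' (measure_ne_top _ _)
    · exact measureReal_mono fun y hy => huv (Set.mk_mem_prod hθ' hy)

end Poly

/-! ### A correlated direction -/

section Gap
variable {r ℓ : ℕ}

/-- For nearly orthonormal `p`, the part of `z` in the span of `p` is controlled by the inner
products with `p`. -/
theorem combination_dot_le (hℓ : ℓ ≤ r) {p : Fin ℓ → Fin r → ℝ}
    (hp : ∀ i j, |p i ⬝ᵥ p j - if i = j then 1 else 0| ≤ 1 / (2 * r)) {z : Fin r → ℝ}
    (hz : ∀ j, |p j ⬝ᵥ z| ≤ 1) {a : Fin ℓ → ℝ}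
    (ha : (∑ i, a i • p i) ⬝ᵥ z = (∑ i, a i • p i) ⬝ᵥ (∑ i, a i • p i)) :
    (∑ i, a i • p i) ⬝ᵥ z ≤ 2 * r := by
  rcases Nat.eq_zero_or_pos r with rfl | hr
  · have : z = 0 := Subsingleton.elim _ _
    simp [this]
  have hr' : (0 : ℝ) < r := by exact_mod_cast hr
  -- The inner product with `z` is at most `S` by the slab condition. It is also the squared length
  -- of the combination, at least `∑ aᵢ² - S²/(2r)` by near-orthonormality and hence at least
  -- `S²/(2r)` by Cauchy–Schwarz. Together these force `S ≤ 2r`.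
  set S := ∑ i, |a i| with hS
  have hS0 : 0 ≤ S := Finset.sum_nonneg fun i _ => abs_nonneg _
  have h1 : (∑ i, a i • p i) ⬝ᵥ z ≤ S := by
    rw [sum_dotProduct]
    refine Finset.sum_le_sum fun i _ => ?_
    rw [smul_dotProduct, smul_eq_mul]
    calc a i * (p i ⬝ᵥ z) ≤ |a i| * |p i ⬝ᵥ z| := by rw [← abs_mul]; exact le_abs_self _
      _ ≤ |a i| * 1 := by gcongr; exact hz i
      _ = |a i| := mul_one _
  have h2 : S ^ 2 ≤ r * ∑ i, a i ^ 2 := by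
    have := sq_sum_le_card_mul_sum_sq (s := Finset.univ) (f := fun i => |a i|)
    simp only [sq_abs, Finset.card_univ, Fintype.card_fin] at this
    refine this.trans ?_
    gcongr
  have h3 : ∑ i, a i ^ 2 - 1 / (2 * r) * S ^ 2 ≤ (∑ i, a i • p i) ⬝ᵥ (∑ i, a i • p i) := by
    have e : (∑ i, a i • p i) ⬝ᵥ (∑ i, a i • p i) - ∑ i, a i ^ 2 =
        ∑ i, ∑ j, a i * a j * (p i ⬝ᵥ p j - if i = j then 1 else 0) := by
      simp only [sum_dotProduct, dotProduct_sum, smul_dotProduct, dotProduct_smul, smul_eq_mul,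
        mul_sub, Finset.sum_sub_distrib, mul_ite, mul_one, mul_zero, Finset.sum_ite_eq,
        Finset.mem_univ, if_true]
      congr 1
      · refine Finset.sum_congr rfl fun i _ => ?_
        rw [Finset.mul_sum]
        exact Finset.sum_congr rfl fun j _ => by rw [dotProduct_comm (p j)]; ring
      · exact Finset.sum_congr rfl fun i _ => by ring
    have h4 : -(1 / (2 * r) * S ^ 2) ≤
        ∑ i, ∑ j, a i * a j * (p i ⬝ᵥ p j - if i = j then 1 else 0) := by
      rw [hS, sq, Finset.sum_mul_sum, Finset.mul_sum, ← Finset.sum_neg_distrib]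
      refine Finset.sum_le_sum fun i _ => ?_
      rw [Finset.mul_sum, ← Finset.sum_neg_distrib]
      refine Finset.sum_le_sum fun j _ => neg_le_of_neg_le ?_
      calc _ ≤ |a i * a j * (p i ⬝ᵥ p j - if i = j then 1 else 0)| := neg_le_abs _
        _ = |a i| * |a j| * |p i ⬝ᵥ p j - if i = j then 1 else 0| := by rw [abs_mul, abs_mul]
        _ ≤ |a i| * |a j| * (1 / (2 * r)) := by gcongr; exact hp i j
        _ = _ := by ring
    linarith
  have h5 : S ^ 2 / (2 * r) ≤ (∑ i, a i • p i) ⬝ᵥ z := by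
    rw [ha]
    refine le_trans ?_ h3
    have : S ^ 2 / r ≤ ∑ i, a i ^ 2 := by
      rw [div_le_iff₀ hr']; linarith
    have e : S ^ 2 / (2 * r) + 1 / (2 * r) * S ^ 2 = S ^ 2 / r := by field_simp; ring
    linarith
  have h6 : S ≤ 2 * r := by
    rcases hS0.eq_or_lt with h0 | h0
    · rw [← h0]; positivity
    · have := h5.trans h1
      rw [div_le_iff₀ (by positivity)] at this
      nlinarith
  exact h1.trans h6

/-- There is an orthonormal basis of the complement of the span of `p`, and it captures all of `z`
but a bounded part whenever `z` lies in the slab. -/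
theorem exists_complement_basis (hℓ : ℓ < r) {p : Fin ℓ → Fin r → ℝ}
    (hp : ∀ i j, |p i ⬝ᵥ p j - if i = j then 1 else 0| ≤ 1 / (2 * r)) :
    ∃ k : ℕ, 0 < k ∧ k ≤ r ∧ ∃ c : Fin k → Fin r → ℝ, (∀ i, c i ⬝ᵥ c i = 1) ∧
      (∀ i j, p j ⬝ᵥ c i = 0) ∧
      ∀ z, (∀ j, |p j ⬝ᵥ z| ≤ 1) → z ⬝ᵥ z - 2 * r ≤ ∑ i, (c i ⬝ᵥ z) ^ 2 := by
  let P : Fin ℓ → EuclideanSpace ℝ (Fin r) := fun j => WithLp.toLp 2 (p j)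
  let K : Submodule ℝ (EuclideanSpace ℝ (Fin r)) := Submodule.span ℝ (Set.range P)
  have hin : ∀ a b : Fin r → ℝ, inner ℝ (WithLp.toLp 2 a) (WithLp.toLp 2 b) = a ⬝ᵥ b := by
    intro a b; simp [EuclideanSpace.inner_toLp_toLp, dotProduct_comm]
  have hfr := Submodule.finrank_add_finrank_orthogonal K
  rw [finrank_euclideanSpace_fin] at hfr
  have hfr2 : Module.finrank ℝ K ≤ ℓ := by
    have := finrank_range_le_card (R := ℝ) P
    simpa [Set.finrank] using this
  let b := stdOrthonormalBasis ℝ Kᗮ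
  refine ⟨Module.finrank ℝ Kᗮ, by omega, by omega,
    fun i => WithLp.ofLp (b i : EuclideanSpace ℝ (Fin r)), fun i => ?_, fun i j => ?_,
    fun z hz => ?_⟩
  · rw [← hin]
    simp only [WithLp.toLp_ofLp]
    have h1 : ‖(b i : EuclideanSpace ℝ (Fin r))‖ = 1 := b.norm_eq_one i
    rw [real_inner_self_eq_norm_sq, h1, one_pow]
  · rw [← hin]
    simp only [WithLp.toLp_ofLp]
    exact (Submodule.mem_orthogonal K _).1 (b i).2 _ (Submodule.subset_span ⟨j, rfl⟩)
  · set Z : EuclideanSpace ℝ (Fin r) := WithLp.toLp 2 z with hZ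
    have h1 : ∑ i, (WithLp.ofLp (b i : EuclideanSpace ℝ (Fin r)) ⬝ᵥ z) ^ 2 =
        ‖Kᗮ.orthogonalProjectionOnto Z‖ ^ 2 := by
      rw [← b.sum_sq_norm_inner_right]
      refine Finset.sum_congr rfl fun i _ => ?_
      rw [Submodule.inner_orthogonalProjectionOnto_eq_of_mem_left, ← hin]
      simp only [WithLp.toLp_ofLp, Real.norm_eq_abs, sq_abs, hZ]
    have h2 := Submodule.norm_sq_eq_add_norm_sq_projection Z K
    have h3 : ‖Z‖ ^ 2 = z ⬝ᵥ z := by rw [← real_inner_self_eq_norm_sq, hin]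
    -- By Pythagoras only the squared length of the projection of `z` onto the span of `p` is lost.
    -- Writing the projection as a combination of the `p i` makes `combination_dot_le` applicable.
    obtain ⟨a, ha⟩ := (Submodule.mem_span_range_iff_exists_fun ℝ).1
      (K.orthogonalProjectionOnto Z).2
    have h4 : (K.orthogonalProjectionOnto Z : EuclideanSpace ℝ (Fin r)) =
        WithLp.toLp 2 (∑ i, a i • p i) := by
      rw [← ha]; ext t; simp [P]
    have h5 : ‖K.orthogonalProjectionOnto Z‖ ^ 2 = (∑ i, a i • p i) ⬝ᵥ (∑ i, a i • p i) := by
      rw [← hin, ← h4, Submodule.coe_norm, real_inner_self_eq_norm_sq]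
    have h6 : (∑ i, a i • p i) ⬝ᵥ z = (∑ i, a i • p i) ⬝ᵥ (∑ i, a i • p i) := by
      rw [← h5, ← hin, ← h4, ← Submodule.inner_orthogonalProjectionOnto_eq_of_mem_left,
        real_inner_self_eq_norm_sq]
    have h7 := combination_dot_le hℓ.le hp hz h6
    rw [h1]
    linarith

/-- A point with nonzero weight has `|z|² > 3r + 1` and at most `2r` of this in the span of `p`. The
`k ≤ r` complementary directions together carry more than `r + 1`, so the sum of `(c i ⬝ᵥ z)² - 1`
is at least `1` there, and elsewhere the weight is zero. Averaging over the directions selects one.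
-/
theorem exists_direction (hℓ : ℓ < r) {p : Fin ℓ → Fin r → ℝ}
    (hp : ∀ i j, |p i ⬝ᵥ p j - if i = j then 1 else 0| ≤ 1 / (2 * r)) {τ lam : ℝ}
    {H : (Fin r → ℝ) → ℝ} (hH : Measurable H)
    (hτ : ∀ z, z ⬝ᵥ z ≤ 3 * (r : ℝ) + 1 → |H z| ≤ τ) (hlam0 : 0 ≤ lam)
    (hlam : lam ≤ (gauss r).real {z | τ < |H z| ∧ ∀ j, |p j ⬝ᵥ z| < 1}) :
    ∃ c : Fin r → ℝ, c ⬝ᵥ c = 1 ∧ (∀ j, p j ⬝ᵥ c = 0) ∧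
      lam / r ≤ ∫ z, trim τ p H z * ((c ⬝ᵥ z) ^ 2 - 1) ∂gauss r := by
  obtain ⟨k, hk, hkr, c, hc, hpc, hz⟩ := exists_complement_basis hℓ hp
  have hw := isWeight_trim τ p hH
  have hi : ∀ i, Integrable (fun z => trim τ p H z * ((c i ⬝ᵥ z) ^ 2 - 1)) (gauss r) := fun i => by
    have := hw.integrable (c i) (c i)
    simpa [hc i, sq] using this
  have hms : MeasurableSet {z | τ < |H z| ∧ ∀ j, |p j ⬝ᵥ z| < 1} := by
    have e : {z | τ < |H z| ∧ ∀ j, |p j ⬝ᵥ z| < 1} = {z | τ < |H z|} ∩ ⋂ j, {z | |p j ⬝ᵥ z| < 1} := by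
      ext z; simp
    rw [e]
    refine (measurableSet_lt measurable_const hH.abs).inter ?_
    exact MeasurableSet.iInter fun j => measurableSet_lt (measurable_dot (p j)).abs measurable_const
  have hsum : lam ≤ ∑ i, ∫ z, trim τ p H z * ((c i ⬝ᵥ z) ^ 2 - 1) ∂gauss r := by
    rw [← integral_finsetSum _ fun i _ => hi i]
    refine hlam.trans ?_
    rw [← integral_indicator_one hms]
    refine integral_mono ((integrable_const (1 : ℝ)).indicator hms)
      (integrable_finsetSum _ fun i _ => hi i) fun z => ?_
    simp only [← Finset.mul_sum, Finset.sum_sub_distrib]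
    have hk' : (k : ℝ) ≤ r := by exact_mod_cast hkr
    by_cases ht : trim τ p H z = 0
    · rw [ht, zero_mul, Set.indicator_of_notMem]
      rintro ⟨h1, h2⟩
      have : trim τ p H z = 1 := by
        rw [trim, thr, if_neg (not_le.2 h1), one_mul]
        exact Finset.prod_eq_one fun j _ => by rw [slab, if_pos (h2 j).le]
      rw [ht] at this; exact zero_ne_one this
    · have h1 : τ < |H z| := by
        by_contra h
        exact ht (by rw [trim, thr, if_pos (not_lt.1 h), zero_mul])
      have h2 : ∀ j, |p j ⬝ᵥ z| ≤ 1 := by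
        intro j
        by_contra h
        refine ht ?_
        rw [trim, Finset.prod_eq_zero (Finset.mem_univ j) (by rw [slab, if_neg h]), mul_zero]
      have h3 : trim τ p H z = 1 := by
        rw [trim, thr, if_neg (not_le.2 h1), one_mul]
        exact Finset.prod_eq_one fun j _ => by rw [slab, if_pos (h2 j)]
      have h4 : 3 * r + 1 < z ⬝ᵥ z := by
        by_contra h
        exact absurd (hτ z (not_lt.1 h)) (not_le.2 h1)
      have h5 := hz z h2
      rw [h3, one_mul]
      calc _ ≤ (1 : ℝ) := Set.indicator_le_self' (fun _ _ => zero_le_one) z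
        _ ≤ _ := by simp only [Finset.sum_const, Finset.card_univ, Fintype.card_fin, nsmul_eq_mul,
                      mul_one]; linarith
  have hk0 : (0 : ℝ) < k := by exact_mod_cast hk
  obtain ⟨i, hi'⟩ : ∃ i, lam / k ≤ ∫ z, trim τ p H z * ((c i ⬝ᵥ z) ^ 2 - 1) ∂gauss r := by
    by_contra hcon
    push Not at hcon
    have : Nonempty (Fin k) := ⟨⟨0, hk⟩⟩
    have := Finset.sum_lt_sum_of_nonempty Finset.univ_nonempty fun i _ => hcon i
    simp only [Finset.sum_const, Finset.card_univ, Fintype.card_fin, nsmul_eq_mul] at this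
    rw [mul_div_cancel₀ _ hk0.ne'] at this
    linarith
  refine ⟨c i, hc i, hpc i, le_trans ?_ hi'⟩
  gcongr

end Gap

theorem le_dot_gradCov {r : ℕ} {α : ℝ} {h : MvPolynomial (Fin r) ℝ} (hn : IsNormalized α h)
    (w : Fin r → ℝ) : α * (w ⬝ᵥ w) ≤ w ⬝ᵥ gradCov h *ᵥ w := by
  have := hn.2.1.dotProduct_mulVec_nonneg w
  simp only [star_trivial, sub_mulVec, dotProduct_sub, smul_mulVec, one_mulVec, dotProduct_smul,
    smul_eq_mul] at this
  linarith

/-- A threshold and a spectral gap that work for all normalized polynomials. -/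
theorem exists_threshold_gap (r d : ℕ) {α : ℝ} (hr : 1 ≤ r) (hα : 0 < α) :
    ∃ τ : ℝ, 0 < τ ∧ ∃ lam : ℝ, 0 < lam ∧ ∀ h : MvPolynomial (Fin r) ℝ, h.totalDegree ≤ d →
      IsNormalized α h → ∀ ℓ < r, ∀ p : Fin ℓ → Fin r → ℝ,
      (∀ i j, |p i ⬝ᵥ p j - if i = j then 1 else 0| ≤ 1 / (2 * r)) → (∀ j, p j ⬝ᵥ p j ≤ 1) →
      ∃ c : Fin r → ℝ, c ⬝ᵥ c = 1 ∧ (∀ j, p j ⬝ᵥ c = 0) ∧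
        lam ≤ ∫ z, trim τ p (fun z => MvPolynomial.eval z h) z * ((c ⬝ᵥ z) ^ 2 - 1) ∂gauss r := by
  let W := MvPolynomial.restrictTotalDegree (Fin r) ℝ d
  let bW := Module.finBasis ℝ W
  let b : Fin (Module.finrank ℝ W) → MvPolynomial (Fin r) ℝ := fun k => (bW k : MvPolynomial _ ℝ)
  have hb : LinearIndependent ℝ b := bW.linearIndependent.map' W.subtype W.ker_subtype
  have hrep : ∀ h : MvPolynomial (Fin r) ℝ, h.totalDegree ≤ d → ∃ c, combo b c = h := by
    intro h hd
    let h' : W := ⟨h, (MvPolynomial.mem_restrictTotalDegree _ _ _).2 hd⟩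
    refine ⟨bW.repr h', ?_⟩
    calc combo b (bW.repr h') = W.subtype (∑ k, bW.repr h' k • bW k) := by
          simp only [map_sum, map_smul]; rfl
      _ = h := by rw [bW.sum_repr]; rfl
  obtain ⟨B, hB⟩ := exists_coeff_bound hb
  have hK1 : IsCompact (Metric.closedBall (0 : Fin (Module.finrank ℝ W) → ℝ) B) :=
    isCompact_closedBall _ _
  -- The closed ball is in the sup norm; with radius `3r + 1 ≥ 1` it contains all `z` with `z ⬝ᵥ z ≤
  -- 3r + 1`, so `T` bounds every admissible polynomial where `exists_direction` needs it.
  obtain ⟨T, hT⟩ := (hK1.prod (isCompact_closedBall (0 : Fin r → ℝ) (3 * r + 1))).exists_bound_of_continuousOn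
    (continuous_eval_combo b).continuousOn
  have hball : ∀ (v : Fin r → ℝ) {ρ : ℝ}, 1 ≤ ρ → v ⬝ᵥ v ≤ ρ → v ∈ Metric.closedBall (0 : Fin r → ℝ) ρ := by
    intro v ρ hρ hv
    rw [mem_closedBall_zero_iff, pi_norm_le_iff_of_nonneg (by linarith)]
    intro i
    have h1 : v i * v i ≤ v ⬝ᵥ v := Finset.single_le_sum (f := fun i => v i * v i)
      (fun i _ => mul_self_nonneg _) (Finset.mem_univ i)
    rw [Real.norm_eq_abs]
    refine abs_le_of_sq_le_sq ?_ (by linarith)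
    nlinarith
  refine ⟨max T 1, lt_max_of_lt_right one_pos, ?_⟩
  set τ := max T 1
  -- The lower bound on the gradient covariance is a closed condition on the coefficients, so
  -- imposing it keeps the parameter set compact while guaranteeing that the event is nonempty for
  -- every parameter.
  let K := Metric.closedBall (0 : Fin (Module.finrank ℝ W) → ℝ) B ∩
    {c | ∀ w, α * (w ⬝ᵥ w) ≤ w ⬝ᵥ gradCov (combo b c) *ᵥ w}
  have hK : IsCompact K := by
    refine hK1.inter_right ?_
    simp only [Set.ofPred_forall]
    refine isClosed_iInter fun w => isClosed_le continuous_const ?_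
    simp only [dot_mulVec_eq_sum]
    exact continuous_finsetSum _ fun i _ => continuous_finsetSum _ fun j _ =>
      continuous_const.mul (continuous_gradCov_combo b i j)
  have hex : ∀ ℓ : Fin r, ∃ lam : ℝ, 0 < lam ∧
      ∀ θ ∈ K ×ˢ Metric.closedBall (0 : Fin ℓ → Fin r → ℝ) 1, lam ≤ (gauss r).real
        {z | τ < |MvPolynomial.eval z (combo b θ.1)| ∧ ∀ j, |θ.2 j ⬝ᵥ z| < 1} := by
    intro ℓ
    let O : Set (((Fin (Module.finrank ℝ W) → ℝ) × (Fin ℓ → Fin r → ℝ)) × (Fin r → ℝ)) :=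
      {q | τ < |MvPolynomial.eval q.2 (combo b q.1.1)| ∧ ∀ j, |q.1.2 j ⬝ᵥ q.2| < 1}
    have hO : IsOpen O := by
      have hOe : O = {q | τ < |MvPolynomial.eval q.2 (combo b q.1.1)|} ∩
          ⋂ j, {q | |q.1.2 j ⬝ᵥ q.2| < 1} := by ext q; simp [O]
      rw [hOe]
      refine (isOpen_lt continuous_const ((continuous_eval_combo b).comp
        (continuous_fst.fst.prodMk continuous_snd)).abs).inter ?_
      exact isOpen_iInter_of_finite fun j => isOpen_lt (Continuous.abs
        (((continuous_apply j).comp continuous_fst.snd).dotProduct continuous_snd)) continuous_const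
    exact exists_measure_lower_bound (hK.prod (isCompact_closedBall _ _)) hO fun θ hθ =>
      exists_large_in_slab ℓ.2 θ.2 hα hθ.1.2 τ
  choose lam hlam0 hlam using hex
  have : Nonempty (Fin r) := ⟨⟨0, hr⟩⟩
  have hr0 : (0 : ℝ) < r := by exact_mod_cast hr
  let lam0 := Finset.univ.inf' Finset.univ_nonempty lam
  have hlam00 : 0 < lam0 := (Finset.lt_inf'_iff _).2 fun ℓ _ => hlam0 ℓ
  refine ⟨lam0 / r, div_pos hlam00 hr0, ?_⟩
  intro h hd hn ℓ hℓ p hp hp1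
  obtain ⟨c, rfl⟩ := hrep h hd
  have hcB : c ∈ Metric.closedBall (0 : Fin (Module.finrank ℝ W) → ℝ) B := by
    rw [mem_closedBall_zero_iff]
    refine hB c hn.1 fun i => ?_
    have := hn.2.2.diag_nonneg (i := i)
    simp only [Matrix.sub_apply, one_apply_eq] at this
    linarith
  refine exists_direction hℓ hp (measurable_eval _) (fun z hz => ?_) hlam00.le ?_
  · exact (hT (c, z) ⟨hcB, hball z (by linarith) hz⟩).trans (le_max_left _ _)
  · refine (Finset.inf'_le lam (Finset.mem_univ ⟨ℓ, hℓ⟩)).trans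
      (hlam ⟨ℓ, hℓ⟩ (c, p) ⟨⟨hcB, le_dot_gradCov hn⟩, ?_⟩)
    rw [mem_closedBall_zero_iff, pi_norm_le_iff_of_nonneg zero_le_one]
    exact fun j => mem_closedBall_zero_iff.1 (hball (p j) le_rfl (hp1 j))

/-! ### Concentration of a quadratic form -/

/-- A Taylor bound without restriction on `y`: for a centred variable the linear term averages out,
and the moment generating function is left with a quadratic error. -/
theorem exp_le_one_add_add_sq_mul (y : ℝ) : Real.exp y ≤ 1 + y + y ^ 2 * Real.exp |y| := by
  rcases le_or_gt |y| 1 with h | h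
  · have h1 := (abs_le.1 (Real.abs_exp_sub_one_sub_id_le h)).2
    have h2 : 1 ≤ Real.exp |y| := Real.one_le_exp (abs_nonneg _)
    nlinarith [sq_nonneg y]
  · rcases lt_abs.1 h with h0 | h0
    · rw [abs_of_pos (by linarith)]
      have := Real.exp_pos y
      nlinarith [mul_nonneg (show 0 ≤ y ^ 2 - 1 by nlinarith) this.le]
    · have h1 : Real.exp y ≤ 1 := Real.exp_le_one_iff.2 (by linarith)
      have h2 : 1 ≤ Real.exp |y| := Real.one_le_exp (abs_nonneg _)
      nlinarith [sq_nonneg y]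

theorem sq_mul_exp_le {x : ℝ} (hx : 0 ≤ x) : x ^ 2 * Real.exp (x / 8) ≤ 128 * Real.exp (x / 4) := by
  have h1 := Real.quadratic_le_exp_of_nonneg (show 0 ≤ x / 8 by positivity)
  have h2 : Real.exp (x / 4) = Real.exp (x / 8) * Real.exp (x / 8) := by
    rw [← Real.exp_add]; congr 1; ring
  rw [h2, ← mul_assoc]
  refine mul_le_mul_of_nonneg_right ?_ (Real.exp_pos _).le
  nlinarith

theorem integrable_exp_sq_gaussianReal :
    Integrable (fun t : ℝ => Real.exp ((3 + t ^ 2) / 4)) (gaussianReal 0 1) := by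
  rw [gaussianReal_of_var_ne_zero 0 one_ne_zero, integrable_withDensity_iff_integrable_smul'
    (measurable_gaussianPDF 0 1) (ae_of_all _ fun _ => gaussianPDF_lt_top)]
  have h := (integrable_exp_neg_mul_sq (show (0 : ℝ) < 1 / 4 by norm_num)).const_mul
    ((√(2 * Real.pi * (1 : NNReal)))⁻¹ * Real.exp (3 / 4))
  refine h.congr (ae_of_all _ fun t => ?_)
  simp only [toReal_gaussianPDF, gaussianPDFReal, smul_eq_mul]
  generalize (√(2 * Real.pi * ((1 : NNReal) : ℝ)))⁻¹ = c
  rw [mul_assoc, mul_assoc, ← Real.exp_add, ← Real.exp_add]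
  congr 2
  push_cast
  ring

/-- The variance proxy of a trimmed quadratic form. -/
noncomputable def bernsteinConst : ℝ :=
  128 * ∫ t : ℝ, Real.exp ((3 + t ^ 2) / 4) ∂gaussianReal 0 1

theorem one_le_integral_exp_sq : 1 ≤ ∫ t : ℝ, Real.exp ((3 + t ^ 2) / 4) ∂gaussianReal 0 1 := by
  have h : ∫ _ : ℝ, (1 : ℝ) ∂gaussianReal 0 1 ≤
      ∫ t : ℝ, Real.exp ((3 + t ^ 2) / 4) ∂gaussianReal 0 1 :=
    integral_mono (integrable_const _) integrable_exp_sq_gaussianReal fun t =>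
      Real.one_le_exp (by positivity)
  simpa using h

theorem le_bernsteinConst : 128 ≤ bernsteinConst := by
  have := one_le_integral_exp_sq; unfold bernsteinConst; linarith

/-- The centred weighted square of a linear form. -/
noncomputable def centredSq {n : ℕ} (w : (Fin n → ℝ) → ℝ) (u x : Fin n → ℝ) : ℝ :=
  w x * ((u ⬝ᵥ x) * (u ⬝ᵥ x) - u ⬝ᵥ u) - ∫ x, w x * ((u ⬝ᵥ x) * (u ⬝ᵥ x) - u ⬝ᵥ u) ∂gauss n

section Bernstein
variable {n : ℕ} {w : (Fin n → ℝ) → ℝ} {u : Fin n → ℝ}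

theorem measurable_centredSq (hw : IsWeight w) : Measurable (centredSq w u) :=
  (hw.measurable.mul (((measurable_dot u).mul (measurable_dot u)).sub_const _)).sub_const _

theorem abs_centredSq_le (hw : IsWeight w) (hu : u ⬝ᵥ u = 1) (x : Fin n → ℝ) :
    |centredSq w u x| ≤ 3 + (u ⬝ᵥ x) ^ 2 := by
  have h1 := abs_integral_weight_le hw hu hu
  have h2 : |w x * ((u ⬝ᵥ x) * (u ⬝ᵥ x) - u ⬝ᵥ u)| ≤ 1 + (u ⬝ᵥ x) ^ 2 := by
    rw [abs_mul, hu]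
    calc _ ≤ 1 * |(u ⬝ᵥ x) * (u ⬝ᵥ x) - 1| := by gcongr; exact hw.abs_le x
      _ ≤ 1 + (u ⬝ᵥ x) ^ 2 := by
        rw [one_mul, abs_le]; constructor <;> nlinarith [sq_nonneg (u ⬝ᵥ x)]
  have := abs_sub (w x * ((u ⬝ᵥ x) * (u ⬝ᵥ x) - u ⬝ᵥ u))
    (∫ x, w x * ((u ⬝ᵥ x) * (u ⬝ᵥ x) - u ⬝ᵥ u) ∂gauss n)
  unfold centredSq
  linarith

/-- The linear Taylor term has mean zero. For `θ ≤ 1/8` the remainder is at most `θ²` times `128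
exp((3 + t²)/4)` with `t = u ⬝ᵥ x`, which is Gaussian-integrable because `1/4 < 1/2`. -/
theorem mgf_centredSq_le (hw : IsWeight w) (hu : u ⬝ᵥ u = 1) {θ : ℝ} (h0 : 0 ≤ θ)
    (h8 : θ ≤ 1 / 8) :
    Integrable (fun x => Real.exp (θ * centredSq w u x)) (gauss n) ∧
      mgf (centredSq w u) (gauss n) θ ≤ Real.exp (bernsteinConst * θ ^ 2) := by
  have hm := measurePreserving_dotProduct u hu
  have iE : Integrable (fun x => Real.exp ((3 + (u ⬝ᵥ x) ^ 2) / 4)) (gauss n) :=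
    hm.integrable_comp_of_integrable integrable_exp_sq_gaussianReal
  have iY : Integrable (centredSq w u) (gauss n) := (hw.integrable u u).sub (integrable_const _)
  have hY0 : ∫ x, centredSq w u x ∂gauss n = 0 := by
    unfold centredSq
    rw [integral_sub (hw.integrable u u) (integrable_const _)]; simp
  have hb : ∀ x, |θ * centredSq w u x| ≤ (3 + (u ⬝ᵥ x) ^ 2) / 8 := fun x => by
    rw [abs_mul, abs_of_nonneg h0]
    nlinarith [abs_centredSq_le hw hu x, sq_nonneg (u ⬝ᵥ x), abs_nonneg (centredSq w u x)]
  have hpt : ∀ x, Real.exp (θ * centredSq w u x) ≤ 1 + θ * centredSq w u x +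
      θ ^ 2 * (128 * Real.exp ((3 + (u ⬝ᵥ x) ^ 2) / 4)) := fun x => by
    refine (exp_le_one_add_add_sq_mul _).trans (add_le_add le_rfl ?_)
    rw [mul_pow, mul_assoc]
    refine mul_le_mul_of_nonneg_left ?_ (sq_nonneg θ)
    refine le_trans ?_ (sq_mul_exp_le (show 0 ≤ 3 + (u ⬝ᵥ x) ^ 2 by positivity))
    refine mul_le_mul ?_ (Real.exp_le_exp.2 (hb x)) (Real.exp_pos _).le (sq_nonneg _)
    rw [← sq_abs]
    exact pow_le_pow_left₀ (abs_nonneg _) (abs_centredSq_le hw hu x) 2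
  have i1 : Integrable (fun x => 1 + θ * centredSq w u x) (gauss n) :=
    (integrable_const _).add (iY.const_mul θ)
  have i2 : Integrable (fun x => θ ^ 2 * (128 * Real.exp ((3 + (u ⬝ᵥ x) ^ 2) / 4))) (gauss n) :=
    (iE.const_mul 128).const_mul _
  have i3 : Integrable (fun x => Real.exp (θ * centredSq w u x)) (gauss n) := by
    refine (i1.add i2).mono' (Real.measurable_exp.comp
      ((measurable_centredSq hw).const_mul θ)).aestronglyMeasurable (ae_of_all _ fun x => ?_)
    rw [Real.norm_eq_abs, abs_of_pos (Real.exp_pos _)]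
    exact hpt x
  refine ⟨i3, ?_⟩
  have h1 := integral_mono i3 (i1.add i2) hpt
  simp only [Pi.add_apply] at h1
  rw [integral_add i1 i2, integral_add (integrable_const _) (iY.const_mul θ), integral_const_mul,
    hY0, integral_const_mul, integral_const_mul] at h1
  have h2 : ∫ x, Real.exp ((3 + (u ⬝ᵥ x) ^ 2) / 4) ∂gauss n =
      ∫ t : ℝ, Real.exp ((3 + t ^ 2) / 4) ∂gaussianReal 0 1 := by
    rw [← hm.map_eq, integral_map hm.measurable.aemeasurable
      (by rw [hm.map_eq]; exact integrable_exp_sq_gaussianReal.aestronglyMeasurable)]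
  rw [h2] at h1
  have h3 := Real.add_one_le_exp (bernsteinConst * θ ^ 2)
  simp only [integral_const, probReal_univ, one_smul] at h1
  rw [mgf]
  unfold bernsteinConst at h3 ⊢
  linarith

theorem measure_sum_centredSq_ge_le (hw : IsWeight w) (hu : u ⬝ᵥ u = 1) (m : ℕ) {t : ℝ}
    (h0 : 0 ≤ t) (h1 : t ≤ 1) :
    (Measure.pi fun _ : Fin m => gauss n).real {x | m * t ≤ ∑ a, centredSq w u (x a)} ≤
      Real.exp (-(m * t ^ 2 / (4 * bernsteinConst))) := by
  set K := bernsteinConst with hK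
  have hK1 : 128 ≤ K := le_bernsteinConst
  -- The minimizer of `K θ² - θ t`. It stays below `1/8` because `t ≤ 1` and `K ≥ 128`.
  set θ := t / (2 * K) with hθ
  have hθ0 : 0 ≤ θ := by positivity
  have hθ8 : θ ≤ 1 / 8 := by
    rw [hθ, div_le_iff₀ (by linarith)]; linarith
  have hind := iIndepFun_pi (μ := fun _ : Fin m => gauss n)
    (X := fun _ : Fin m => centredSq w u) fun _ => (measurable_centredSq hw).aemeasurable
  have hmeas : ∀ a : Fin m, Measurable fun x : Fin m → Fin n → ℝ => centredSq w u (x a) :=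
    fun a => (measurable_centredSq hw).comp (measurable_pi_apply a)
  obtain ⟨hi, hmgf⟩ := mgf_centredSq_le hw hu hθ0 hθ8
  have hev : ∀ a : Fin m, MeasurePreserving (fun x : Fin m → Fin n → ℝ => x a)
      (Measure.pi fun _ : Fin m => gauss n) (gauss n) := fun a =>
    measurePreserving_eval (fun _ : Fin m => gauss n) a
  have hint := hind.integrable_exp_mul_sum (t := θ) hmeas (s := Finset.univ) fun a _ =>
    (hev a).integrable_comp_of_integrable hi
  have h2 := measure_ge_le_exp_mul_mgf (μ := Measure.pi fun _ : Fin m => gauss n) (m * t) hθ0 hint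
  rw [hind.mgf_sum hmeas] at h2
  have h3 : ∀ a : Fin m, mgf (fun x : Fin m → Fin n → ℝ => centredSq w u (x a))
      (Measure.pi fun _ : Fin m => gauss n) θ = mgf (centredSq w u) (gauss n) θ := fun a => by
    rw [mgf, mgf]
    conv_rhs => rw [← (hev a).map_eq]
    rw [integral_map (hev a).measurable.aemeasurable (by
      rw [(hev a).map_eq]; exact hi.aestronglyMeasurable)]
  simp only [h3, Finset.prod_const, Finset.card_univ, Fintype.card_fin] at h2
  simp only [Finset.sum_apply] at h2
  refine h2.trans ?_
  calc _ ≤ Real.exp (-θ * (m * t)) * Real.exp (K * θ ^ 2) ^ m := by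
        gcongr
        exact mgf_nonneg
    _ = Real.exp (-(m * t ^ 2 / (4 * K))) := by
        rw [← Real.exp_nat_mul, ← Real.exp_add]
        congr 1
        rw [hθ]
        have : K ≠ 0 := by linarith
        field_simp
        ring

end Bernstein

/-! ### Nets -/

/-- A finite set of unit vectors that is `1/2`-dense in the sphere. -/
theorem exists_net (n : ℕ) : ∃ N : Finset (Fin n → ℝ), N.card ≤ 5 ^ n ∧ (∀ u ∈ N, u ⬝ᵥ u = 1) ∧
    ∀ v : Fin n → ℝ, v ⬝ᵥ v = 1 → ∃ u ∈ N, len (v - u) ≤ 1 / 2 := by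
  classical
  let P : Finset (Fin n → ℝ) → Prop := fun N => (∀ u ∈ N, u ⬝ᵥ u = 1) ∧
    ∀ u ∈ N, ∀ v ∈ N, u ≠ v → 1 / 2 ≤ len (u - v)
  have hcard : ∀ N, P N → N.card ≤ 5 ^ n := by
    intro N hN
    -- Doubling turns `1/2`-separated unit vectors into `1`-separated vectors of length `2`, the
    -- setting of `Besicovitch.card_le_of_separated`.
    let f : (Fin n → ℝ) → EuclideanSpace ℝ (Fin n) := fun u => WithLp.toLp 2 ((2 : ℝ) • u)
    have hf : Function.Injective f := fun u v huv => by
      have h1 := WithLp.toLp_injective 2 huv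
      exact smul_right_injective _ two_ne_zero h1
    have hn : ∀ u : Fin n → ℝ, ‖WithLp.toLp 2 ((2 : ℝ) • u)‖ = 2 * len u := fun u => by
      rw [← len_eq_norm, len_smul]; norm_num
    have h := Besicovitch.card_le_of_separated (N.image f) ?_ ?_
    · rwa [Finset.card_image_of_injective _ hf, finrank_euclideanSpace_fin] at h
    · intro c hc
      obtain ⟨u, hu, rfl⟩ := Finset.mem_image.1 hc
      rw [hn, len_eq_one (hN.1 u hu)]; norm_num
    · intro c hc d hd hcd
      obtain ⟨u, hu, rfl⟩ := Finset.mem_image.1 hc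
      obtain ⟨v, hv, rfl⟩ := Finset.mem_image.1 hd
      have h1 := hN.2 u hu v hv fun h => hcd (by rw [h])
      have h2 : f u - f v = WithLp.toLp 2 ((2 : ℝ) • (u - v)) := by
        simp only [f, ← WithLp.toLp_sub, smul_sub]
      rw [h2, hn]; linarith
  -- If no separated set were a net, each could be enlarged by a far point, eventually exceeding the
  -- cardinality bound.
  by_contra hcon
  push Not at hcon
  have hstep : ∀ k : ℕ, ∃ N, P N ∧ N.card = k := by
    intro k
    induction k with
    | zero => exact ⟨∅, ⟨by simp, by simp⟩, rfl⟩
    | succ k ih =>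
      obtain ⟨N, hN, hk⟩ := ih
      obtain ⟨v, hv, hfar⟩ := hcon N (hcard N hN) hN.1
      have hvN : v ∉ N := fun h => by
        have := hfar v h
        rw [sub_self, len_eq_zero.2 rfl] at this
        norm_num at this
      have hsymm : ∀ a b : Fin n → ℝ, len (a - b) = len (b - a) := fun a b => by
        rw [← neg_sub, ← neg_one_smul ℝ, len_smul]; simp
      refine ⟨insert v N, ⟨fun u hu => ?_, fun u hu u' hu' hne => ?_⟩, ?_⟩
      · rcases Finset.mem_insert.1 hu with rfl | hu
        · exact hv
        · exact hN.1 u hu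
      · rw [Finset.mem_insert] at hu hu'
        rcases hu with rfl | hu <;> rcases hu' with rfl | hu'
        · exact absurd rfl hne
        · exact (hfar u' hu').le
        · rw [hsymm]; exact (hfar u hu).le
        · exact hN.2 u hu u' hu' hne
      · rw [Finset.card_insert_of_notMem hvN, hk]
  obtain ⟨N, hN, hk⟩ := hstep (5 ^ n + 1)
  have := hcard N hN
  omega

theorem dot_mulVec_symm {n : ℕ} {A : Matrix (Fin n) (Fin n) ℝ} (hA : Aᵀ = A) (a b : Fin n → ℝ) :
    a ⬝ᵥ A *ᵥ b = b ⬝ᵥ A *ᵥ a := by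
  rw [dot_mulVec_comm, hA, dotProduct_comm]

/-- A bound on a symmetric quadratic form on a net bounds the bilinear form. -/
theorem abs_form_le_of_net {n : ℕ} {A : Matrix (Fin n) (Fin n) ℝ} (hA : Aᵀ = A)
    {N : Finset (Fin n → ℝ)} (hN : ∀ u ∈ N, u ⬝ᵥ u = 1)
    (hnet : ∀ v : Fin n → ℝ, v ⬝ᵥ v = 1 → ∃ u ∈ N, len (v - u) ≤ 1 / 2) {t : ℝ}
    (ht : ∀ u ∈ N, |u ⬝ᵥ A *ᵥ u| ≤ t) (a b : Fin n → ℝ) :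
    |a ⬝ᵥ A *ᵥ b| ≤ 32 * t * (len a * len b) := by
  rcases Nat.eq_zero_or_pos n with rfl | hn
  · have h0 : a = 0 := Subsingleton.elim _ _
    rw [h0, zero_dotProduct, abs_zero, len_eq_zero.2 rfl, zero_mul, mul_zero]
  have hcont : Continuous fun v : Fin n → ℝ => |v ⬝ᵥ A *ᵥ v| :=
    (continuous_id.dotProduct (Continuous.matrix_mulVec continuous_const continuous_id)).abs
  have hcomp : IsCompact {v : Fin n → ℝ | v ⬝ᵥ v = 1} := by
    refine Metric.isCompact_of_isClosed_isBounded
      (isClosed_eq (continuous_id.dotProduct continuous_id) continuous_const) ?_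
    refine (Metric.isBounded_closedBall (x := (0 : Fin n → ℝ)) (r := 1)).subset fun v hv => ?_
    rw [mem_closedBall_zero_iff, pi_norm_le_iff_of_nonneg zero_le_one]
    intro i
    have hv' : v ⬝ᵥ v = 1 := hv
    have h1 : v i * v i ≤ v ⬝ᵥ v := Finset.single_le_sum (f := fun i => v i * v i)
      (fun i _ => mul_self_nonneg _) (Finset.mem_univ i)
    rw [Real.norm_eq_abs]
    exact abs_le_of_sq_le_sq (by nlinarith) zero_le_one
  obtain ⟨v, hv, hmax⟩ := hcomp.exists_isMaxOn
    ⟨Pi.single ⟨0, hn⟩ 1, by simp⟩ hcont.continuousOn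
  have hv1 : v ⬝ᵥ v = 1 := hv
  set D := |v ⬝ᵥ A *ᵥ v| with hD
  have hquad : ∀ c : Fin n → ℝ, |c ⬝ᵥ A *ᵥ c| ≤ D * (c ⬝ᵥ c) := by
    intro c
    by_cases hc : c = 0
    · simp [hc]
    obtain ⟨e, he, hce⟩ := exists_unit hc
    have h1 : |e ⬝ᵥ A *ᵥ e| ≤ D := hmax he
    have h2 : c ⬝ᵥ A *ᵥ c = len c ^ 2 * (e ⬝ᵥ A *ᵥ e) := by
      conv_lhs => rw [hce]
      rw [mulVec_smul, smul_dotProduct, dotProduct_smul, smul_eq_mul, smul_eq_mul]; ring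
    rw [h2, abs_mul, abs_of_nonneg (sq_nonneg _), ← len_sq, mul_comm]
    exact mul_le_mul_of_nonneg_right h1 (sq_nonneg _)
  have hform : ∀ a b : Fin n → ℝ, |a ⬝ᵥ A *ᵥ b| ≤ D * (len a * len b) := by
    intro a b
    refine abs_form_le_of_unit (S := Set.univ) (fun _ _ _ => trivial) (fun a _ b ha hb => ?_)
      (Set.mem_univ a)
    have e : a ⬝ᵥ A *ᵥ b = 1 / 4 * ((a + b) ⬝ᵥ A *ᵥ (a + b) - (a - b) ⬝ᵥ A *ᵥ (a - b)) := by
      simp only [mulVec_add, mulVec_sub, add_dotProduct, sub_dotProduct, dotProduct_add,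
        dotProduct_sub, dot_mulVec_symm hA b a]
      ring
    have h1 := hquad (a + b)
    have h2 := hquad (a - b)
    simp only [add_dotProduct, sub_dotProduct, dotProduct_add, dotProduct_sub, ha, hb,
      dotProduct_comm b a] at h1 h2
    rw [e]
    simp only [add_dotProduct, sub_dotProduct]
    rw [abs_le] at h1 h2 ⊢
    constructor <;> linarith [h1.1, h1.2, h2.1, h2.2]
  -- With `s = len (v - u) ≤ 1/2` one has `len (v + u)² = 4 - s²`, so the product of the two lengths
  -- is at most `√(15/16) ≤ 31/32`. Passing from the maximizer `v` to the net point `u` gives `D ≤ t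
  -- + (31/32) D`.
  have hDt : D ≤ 32 * t := by
    obtain ⟨u, hu, hvu⟩ := hnet v hv1
    have e : v ⬝ᵥ A *ᵥ v - u ⬝ᵥ A *ᵥ u = (v - u) ⬝ᵥ A *ᵥ (v + u) := by
      simp only [mulVec_add, sub_dotProduct, dotProduct_add, dot_mulVec_symm hA u v]
      ring
    have h1 := hform (v - u) (v + u)
    have h2 : len (v - u) * len (v + u) ≤ 31 / 32 := by
      refine abs_le_of_sq_le_sq' ?_ (by norm_num) |>.2
      have h3 : len (v + u) ^ 2 = 4 - len (v - u) ^ 2 := by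
        rw [len_sq, len_sq]
        simp only [add_dotProduct, sub_dotProduct, dotProduct_add, dotProduct_sub, hv1, hN u hu]
        ring
      rw [mul_pow, h3]
      nlinarith [len_nonneg (v - u), mul_nonneg (len_nonneg (v - u)) (sub_nonneg.2 hvu)]
    have h3 : D ≤ |u ⬝ᵥ A *ᵥ u| + |(v - u) ⬝ᵥ A *ᵥ (v + u)| := by
      rw [hD, show v ⬝ᵥ A *ᵥ v = u ⬝ᵥ A *ᵥ u + (v - u) ⬝ᵥ A *ᵥ (v + u) by rw [← e]; ring]
      exact abs_add_le _ _
    have h4 := mul_le_mul_of_nonneg_left h2 (abs_nonneg (v ⬝ᵥ A *ᵥ v))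
    linarith [ht u hu]
  refine (hform a b).trans ?_
  exact mul_le_mul_of_nonneg_right hDt (mul_nonneg (len_nonneg a) (len_nonneg b))

/-! ### The empirical matrix -/

/-- The empirical matrix `(1/m) ∑ w(x_a) (x_a x_aᵀ - Id)`. -/
noncomputable def empMat {n m : ℕ} (w : (Fin n → ℝ) → ℝ) (x : Fin m → Fin n → ℝ) :
    Matrix (Fin n) (Fin n) ℝ :=
  Matrix.of fun i j => (∑ a, w (x a) * (x a i * x a j - if i = j then 1 else 0)) / m

theorem empMat_transpose {n m : ℕ} (w : (Fin n → ℝ) → ℝ) (x : Fin m → Fin n → ℝ) :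
    (empMat w x)ᵀ = empMat w x := by
  ext i j
  simp only [empMat, transpose_apply, of_apply, eq_comm (a := i) (b := j)]
  congr 1
  exact Finset.sum_congr rfl fun a _ => by rw [mul_comm (x a j)]

theorem dot_empMat_mulVec {n m : ℕ} (w : (Fin n → ℝ) → ℝ) (x : Fin m → Fin n → ℝ)
    (a b : Fin n → ℝ) : a ⬝ᵥ empMat w x *ᵥ b =
      (∑ k, w (x k) * ((a ⬝ᵥ x k) * (b ⬝ᵥ x k) - a ⬝ᵥ b)) / m := by
  simp only [dot_mul_dot_sub, dot_mulVec_eq_sum, empMat, of_apply, ← mul_div_assoc,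
    ← Finset.sum_div, Finset.mul_sum]
  congr 1
  rw [Finset.sum_congr rfl fun i _ => Finset.sum_comm, Finset.sum_comm]
  exact Finset.sum_congr rfl fun k _ => Finset.sum_congr rfl fun i _ =>
    Finset.sum_congr rfl fun j _ => by ring

/-- `IsWeight` permits negative values, so the lower tail is the upper tail for the weight `-w`. -/
theorem measure_quadForm_deviation_le {n m : ℕ} (hm : 0 < m) {w : (Fin n → ℝ) → ℝ} (hw : IsWeight w)
    {u : Fin n → ℝ} (hu : u ⬝ᵥ u = 1) {t : ℝ} (h0 : 0 ≤ t) (h1 : t ≤ 1) :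
    (Measure.pi fun _ : Fin m => gauss n).real {x | t ≤ |u ⬝ᵥ (empMat w x - wMat w) *ᵥ u|} ≤
      2 * Real.exp (-(m * t ^ 2 / (4 * bernsteinConst))) := by
  have hm0 : (0 : ℝ) < m := by exact_mod_cast hm
  have hw' : IsWeight fun x => -w x := ⟨hw.measurable.neg, fun x => by rw [abs_neg]; exact hw.abs_le x⟩
  have e1 : ∀ x : Fin m → Fin n → ℝ, ∑ a, centredSq w u (x a) =
      m * (u ⬝ᵥ (empMat w x - wMat w) *ᵥ u) := by
    intro x
    rw [sub_mulVec, dotProduct_sub, dot_empMat_mulVec, dot_wMat_mulVec hw]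
    simp only [centredSq, Finset.sum_sub_distrib, Finset.sum_const, Finset.card_univ,
      Fintype.card_fin, nsmul_eq_mul]
    field_simp
  have e2 : ∀ x : Fin m → Fin n → ℝ, ∑ a, centredSq (fun x => -w x) u (x a) =
      -∑ a, centredSq w u (x a) := by
    intro x
    rw [← Finset.sum_neg_distrib]
    refine Finset.sum_congr rfl fun a _ => ?_
    simp only [centredSq, neg_mul, integral_neg]; ring
  have hsub : {x : Fin m → Fin n → ℝ | t ≤ |u ⬝ᵥ (empMat w x - wMat w) *ᵥ u|} ⊆
      {x | m * t ≤ ∑ a, centredSq w u (x a)} ∪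
        {x | m * t ≤ ∑ a, centredSq (fun x => -w x) u (x a)} := by
    intro x hx
    have hx' : t ≤ |u ⬝ᵥ (empMat w x - wMat w) *ᵥ u| := hx
    rcases le_abs.1 hx' with h | h
    · left
      change m * t ≤ _
      rw [e1]
      exact mul_le_mul_of_nonneg_left h hm0.le
    · right
      change m * t ≤ _
      rw [e2, e1, ← mul_neg]
      exact mul_le_mul_of_nonneg_left h hm0.le
  have h2 := measure_sum_centredSq_ge_le hw hu m h0 h1
  have h3 := measure_sum_centredSq_ge_le hw' hu m h0 h1
  have h4 := (measureReal_mono (μ := Measure.pi fun _ : Fin m => gauss n) hsub).trans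
    (measureReal_union_le _ _)
  linarith

/-- The empirical matrix is uniformly close to its mean with high probability. -/
theorem measure_empMat_deviation_le {n m : ℕ} (hm : 0 < m) {w : (Fin n → ℝ) → ℝ} (hw : IsWeight w)
    {η : ℝ} (h0 : 0 < η) (h1 : η ≤ 1) :
    ∃ G : Set (Fin m → Fin n → ℝ), (Measure.pi fun _ : Fin m => gauss n).real Gᶜ ≤
      5 ^ n * (2 * Real.exp (-(m * (η / 32) ^ 2 / (4 * bernsteinConst)))) ∧
      ∀ x ∈ G, ∀ a b, |a ⬝ᵥ (empMat w x - wMat w) *ᵥ b| ≤ η * (len a * len b) := by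
  obtain ⟨N, hNc, hN, hnet⟩ := exists_net n
  refine ⟨(⋃ u ∈ N, {x | η / 32 ≤ |u ⬝ᵥ (empMat w x - wMat w) *ᵥ u|})ᶜ, ?_, fun x hx a b => ?_⟩
  · rw [compl_compl]
    refine (measureReal_biUnion_finset_le _ _).trans ?_
    refine (Finset.sum_le_sum fun u hu => measure_quadForm_deviation_le hm hw (hN u hu)
      (by positivity) (by linarith)).trans ?_
    rw [Finset.sum_const, nsmul_eq_mul]
    gcongr
    exact_mod_cast hNc
  · have h := abs_form_le_of_net (A := empMat w x - wMat w)
      (by rw [transpose_sub, empMat_transpose, wMat_transpose]) hN hnet (t := η / 32)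
      (fun u hu => by
        by_contra hcon
        exact hx (Set.mem_biUnion hu (not_le.1 hcon).le)) a b
    rwa [mul_div_cancel₀ η (by norm_num : (32 : ℝ) ≠ 0)] at h

/-! ### Projection off the vectors found -/

/-- The matrix `Id - ∑ v_k v_kᵀ`. -/
def projMat {n ℓ : ℕ} (V : Fin ℓ → Fin n → ℝ) : Matrix (Fin n) (Fin n) ℝ :=
  Matrix.of fun i j => (if i = j then 1 else 0) - ∑ k, V k i * V k j

/-- The vectors `V` are orthonormal. -/
def IsOrtho {n ℓ : ℕ} (V : Fin ℓ → Fin n → ℝ) : Prop :=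
  ∀ i j, V i ⬝ᵥ V j = if i = j then 1 else 0

section Proj
variable {n ℓ : ℕ} {V : Fin ℓ → Fin n → ℝ}

theorem projMat_transpose (V : Fin ℓ → Fin n → ℝ) : (projMat V)ᵀ = projMat V := by
  ext i j
  simp only [projMat, transpose_apply, of_apply, eq_comm (a := i) (b := j), mul_comm]

theorem projMat_mulVec (V : Fin ℓ → Fin n → ℝ) (x : Fin n → ℝ) :
    projMat V *ᵥ x = x - ∑ k, (V k ⬝ᵥ x) • V k := by
  ext i
  simp only [mulVec, dotProduct, projMat, of_apply, sub_mul, Finset.sum_sub_distrib, ite_mul,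
    one_mul, zero_mul, Finset.sum_ite_eq, Finset.mem_univ, if_true, Pi.sub_apply,
    Finset.sum_apply, Pi.smul_apply, smul_eq_mul, Finset.sum_mul]
  rw [Finset.sum_comm]
  congr 1
  exact Finset.sum_congr rfl fun k _ => Finset.sum_congr rfl fun j _ => by ring

theorem dot_projMat_mulVec (hV : IsOrtho V) (j : Fin ℓ) (x : Fin n → ℝ) :
    V j ⬝ᵥ projMat V *ᵥ x = 0 := by
  rw [projMat_mulVec, dotProduct_sub, dotProduct_sum]
  simp only [dotProduct_smul, hV j, smul_eq_mul, mul_ite, mul_one, mul_zero, Finset.sum_ite_eq,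
    Finset.mem_univ, if_true, sub_self]

theorem projMat_mulVec_of_ortho {x : Fin n → ℝ} (hx : ∀ j, V j ⬝ᵥ x = 0) :
    projMat V *ᵥ x = x := by
  rw [projMat_mulVec]; simp [hx]

theorem len_projMat_le (hV : IsOrtho V) (x : Fin n → ℝ) : len (projMat V *ᵥ x) ≤ len x := by
  have h1 : projMat V *ᵥ (projMat V *ᵥ x) = projMat V *ᵥ x :=
    projMat_mulVec_of_ortho fun j => dot_projMat_mulVec hV j x
  have h2 : len (projMat V *ᵥ x) ^ 2 = (projMat V *ᵥ x) ⬝ᵥ x := by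
    rw [len_sq, dot_mulVec_comm, projMat_transpose, h1]
  have h3 := dot_le (projMat V *ᵥ x) x
  rcases (len_nonneg (projMat V *ᵥ x)).eq_or_lt with h | h
  · rw [← h]; exact len_nonneg x
  · nlinarith

end Proj

section Step
variable {n r ℓ : ℕ} {U : Matrix (Fin n) (Fin r) ℝ} {V : Fin ℓ → Fin n → ℝ}
  {S : Matrix (Fin n) (Fin n) ℝ}

/-- The projected matrix `Π S Π`. -/
def projected (V : Fin ℓ → Fin n → ℝ) (S : Matrix (Fin n) (Fin n) ℝ) : Matrix (Fin n) (Fin n) ℝ :=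
  projMat V * S * projMat V

theorem projected_transpose (hS : Sᵀ = S) : (projected V S)ᵀ = projected V S := by
  simp only [projected, transpose_mul, hS, projMat_transpose, Matrix.mul_assoc]

theorem dot_projected (a b : Fin n → ℝ) :
    a ⬝ᵥ projected V S *ᵥ b = (projMat V *ᵥ a) ⬝ᵥ S *ᵥ (projMat V *ᵥ b) := by
  rw [projected, ← mulVec_mulVec, ← mulVec_mulVec, dot_mulVec_comm, projMat_transpose]

theorem dot_projected_eq_zero (hV : IsOrtho V) (j : Fin ℓ) (b : Fin n → ℝ) :
    V j ⬝ᵥ projected V S *ᵥ b = 0 := by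
  rw [projected, ← mulVec_mulVec, ← mulVec_mulVec, dot_projMat_mulVec hV]

/-- The range of the projected matrix is close to the column span of `U`. -/
theorem len_perp_projected_le (hU : Uᵀ * U = 1) (hV : IsOrtho V) {κ e : ℝ} (he : 0 ≤ e)
    (h1 : ∀ a b, Uᵀ *ᵥ a = 0 → |a ⬝ᵥ S *ᵥ b| ≤ κ * (len a * len b))
    (h3 : ∀ a b, |a ⬝ᵥ S *ᵥ b| ≤ 3 * (len a * len b)) (hκ : 0 ≤ κ)
    (hVe : ∀ j, len (perp U *ᵥ V j) ≤ e) (v : Fin n → ℝ) :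
    len (perp U *ᵥ (projected V S *ᵥ v)) ≤ (κ + 3 * (ℓ * e)) * len v := by
  set b := perp U *ᵥ (projected V S *ᵥ v) with hb
  have hUb : Uᵀ *ᵥ b = 0 := transpose_mulVec_perp hU _
  have hpb : perp U *ᵥ b = b := perp_of_transpose_eq_zero hUb
  set y := projMat V *ᵥ v with hy
  have hyv : len y ≤ len v := len_projMat_le hV v
  -- The projection is expanded on the side of `b`. The first term is small because `S` nearly
  -- annihilates vectors orthogonal to `U`; the correction is small because each `V k` is nearly in
  -- the span of `U`, hence nearly orthogonal to `b`.
  have e1 : len b ^ 2 = b ⬝ᵥ S *ᵥ y - ∑ k, (V k ⬝ᵥ b) * (V k ⬝ᵥ S *ᵥ y) := by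
    rw [len_sq]
    calc b ⬝ᵥ b = b ⬝ᵥ projected V S *ᵥ v := by rw [hb, perp_dot_perp hU]
      _ = _ := by
        rw [dot_projected, projMat_mulVec, sub_dotProduct, sum_dotProduct]
        simp only [smul_dotProduct, smul_eq_mul]
        rfl
  have hterm : ∀ k, |(V k ⬝ᵥ b) * (V k ⬝ᵥ S *ᵥ y)| ≤ 3 * e * (len b * len v) := by
    intro k
    have hk1 : |V k ⬝ᵥ b| ≤ e * len b := by
      rw [← hpb, perp_dot, hpb]
      exact (abs_dot_le _ _).trans (mul_le_mul_of_nonneg_right (hVe k) (len_nonneg b))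
    have hk2 : |V k ⬝ᵥ S *ᵥ y| ≤ 3 * len v := by
      refine (h3 _ _).trans ?_
      rw [len_eq_one (by rw [hV]; simp), one_mul]
      linarith
    rw [abs_mul]
    calc _ ≤ e * len b * (3 * len v) :=
          mul_le_mul hk1 hk2 (abs_nonneg _) (mul_nonneg he (len_nonneg b))
      _ = _ := by ring
  have hsum : |∑ k, (V k ⬝ᵥ b) * (V k ⬝ᵥ S *ᵥ y)| ≤ ℓ * (3 * e * (len b * len v)) := by
    refine (Finset.abs_sum_le_sum_abs _ _).trans ?_
    refine (Finset.sum_le_sum fun k _ => hterm k).trans ?_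
    simp
  have hfirst : |b ⬝ᵥ S *ᵥ y| ≤ κ * (len b * len v) :=
    (h1 b y hUb).trans (mul_le_mul_of_nonneg_left
      (mul_le_mul_of_nonneg_left hyv (len_nonneg b)) hκ)
  have key : len b ^ 2 ≤ len b * ((κ + 3 * (ℓ * e)) * len v) := by
    rw [e1]
    have := (abs_le.1 hsum).1
    have := (abs_le.1 hfirst).2
    nlinarith
  rcases (len_nonneg b).eq_or_lt with h | h
  · rw [← h]
    exact mul_nonneg (by positivity) (len_nonneg v)
  · rw [sq] at key
    exact le_of_mul_le_mul_left key h

end Step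

/-! ### Top eigenvectors, exact and by power iteration. -/

/-- Were all eigenvalues of `c • 1 - B` positive, that matrix would be positive definite,
contradicting the value of its form at `w`. -/
theorem exists_eigenvector_ge {n : ℕ} {B : Matrix (Fin n) (Fin n) ℝ} (hB : Bᵀ = B)
    {w : Fin n → ℝ} (hw : w ⬝ᵥ w = 1) {c : ℝ} (hc : c ≤ w ⬝ᵥ B *ᵥ w) :
    ∃ (q : Fin n → ℝ) (μ : ℝ), q ⬝ᵥ q = 1 ∧ B *ᵥ q = μ • q ∧ c ≤ μ := by
  have hA : (c • (1 : Matrix (Fin n) (Fin n) ℝ) - B).IsHermitian := by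
    rw [IsHermitian, conjTranspose_eq_transpose_of_trivial, transpose_sub, hB, transpose_smul,
      transpose_one]
  by_cases hpos : ∀ i, 0 < hA.eigenvalues i
  · have h1 := (hA.posDef_iff_eigenvalues_pos.2 hpos).dotProduct_mulVec_pos (x := w) (by
      rintro rfl; simp at hw)
    simp only [star_trivial, sub_mulVec, dotProduct_sub, smul_mulVec, one_mulVec, dotProduct_smul,
      smul_eq_mul, hw] at h1
    linarith
  · push Not at hpos
    obtain ⟨i, hi⟩ := hpos
    refine ⟨(hA.eigenvectorBasis i).ofLp, c - hA.eigenvalues i, ?_, ?_, by linarith⟩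
    · have h1 := hA.eigenvectorBasis.norm_eq_one i
      have h2 := len_eq_norm (hA.eigenvectorBasis i).ofLp
      rw [WithLp.toLp_ofLp, h1] at h2
      rw [← len_sq, h2, one_pow]
    · have h1 := hA.mulVec_eigenvectorBasis i
      rw [sub_mulVec, smul_mulVec, one_mulVec] at h1
      rw [sub_smul, ← h1]; abel

/-- An exact top eigenvector of `B` is close to the column span of `U` if the range of `B` is. -/
theorem top_eigenvector_close {n r : ℕ} {U : Matrix (Fin n) (Fin r) ℝ}
    {B : Matrix (Fin n) (Fin n) ℝ} (hB : Bᵀ = B) {w : Fin n → ℝ} (hw : w ⬝ᵥ w = 1) {c : ℝ}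
    (hc0 : 0 < c) (hc : c ≤ w ⬝ᵥ B *ᵥ w) {K : ℝ}
    (hK : ∀ v, len (perp U *ᵥ (B *ᵥ v)) ≤ K * len v) {v : Fin n → ℝ}
    (hv : IsTopEigenvector B v) :
    ∃ μ : ℝ, 0 < μ ∧ B *ᵥ v = μ • v ∧ len (perp U *ᵥ v) ≤ K / c := by
  obtain ⟨hv1, μ, hμ, hmax⟩ := hv
  obtain ⟨q, ν, hq, hqν, hν⟩ := exists_eigenvector_ge hB hw hc
  have hcμ : c ≤ μ := hν.trans (hmax ν q (by rintro rfl; simp at hq) hqν)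
  refine ⟨μ, hc0.trans_le hcμ, hμ, ?_⟩
  -- Since `v` is `B v / μ`, it inherits the closeness of the range of `B`, at the price of the
  -- factor `1/μ ≤ 1/c`.
  have h := hK v
  rw [hμ, mulVec_smul, len_smul, len_eq_one hv1, mul_one, abs_of_pos (hc0.trans_le hcμ)] at h
  rw [le_div_iff₀ hc0]
  nlinarith [len_nonneg (perp U *ᵥ v)]

/-- Power iteration approaches the range of a symmetric matrix with a positive eigenvalue. -/
theorem power_iteration_close {n r : ℕ} {U : Matrix (Fin n) (Fin r) ℝ} (hU : Uᵀ * U = 1)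
    {B : Matrix (Fin n) (Fin n) ℝ} (hB : Bᵀ = B) {q : Fin n → ℝ} (hq : q ⬝ᵥ q = 1) {μ c K : ℝ}
    (hqμ : B *ᵥ q = μ • q) (hc0 : 0 < c) (hcμ : c ≤ μ)
    (hK : ∀ v, len (perp U *ᵥ (B *ᵥ v)) ≤ K * len v)
    {W : ℕ → Fin n → ℝ} (hW : ∀ k, W (k + 1) = B *ᵥ W k + (2 : ℝ) • W k)
    (hqW : q ⬝ᵥ W 0 ≠ 0) {R : ℝ} (hR : len (W 0) ≤ R * |q ⬝ᵥ W 0|) {m₀ : ℕ}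
    (hm₀ : R * (2 + c / 2) ^ m₀ < (2 + c) ^ m₀) (i : ℕ) :
    0 < len (W (m₀ + i)) ∧
      len (perp U *ᵥ W (m₀ + i)) ≤ ((2 / (2 + c / 2)) ^ i + 2 * K / c) * len (W (m₀ + i)) := by
  set g := 2 + c / 2 with hg
  have hg0 : 0 < g := by positivity
  have hβ : 0 < |q ⬝ᵥ W 0| := abs_pos.2 hqW
  have hμ0 : 0 < μ := hc0.trans_le hcμ
  have hqk : ∀ k, q ⬝ᵥ W k = (2 + μ) ^ k * (q ⬝ᵥ W 0) := by
    intro k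
    induction k with
    | zero => simp
    | succ k ih =>
      rw [hW, dotProduct_add, dot_mulVec_comm, hB, hqμ, smul_dotProduct, dotProduct_smul, ih,
        smul_eq_mul, smul_eq_mul]
      ring
  have hlow : ∀ k, (2 + c) ^ k * |q ⬝ᵥ W 0| ≤ len (W k) := by
    intro k
    have h1 := abs_dot_le q (W k)
    rw [hqk, len_eq_one hq, one_mul, abs_mul, abs_of_nonneg (by positivity)] at h1
    refine le_trans ?_ h1
    gcongr
  have hpos : ∀ k, 0 < len (W k) := fun k => lt_of_lt_of_le (by positivity) (hlow k)
  -- Log-convexity of the norms, by Cauchy–Schwarz and the symmetry of the iterated matrix: the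
  -- growth factors from step to step never decrease.
  have hconv : ∀ k, len (W (k + 1)) ^ 2 ≤ len (W k) * len (W (k + 2)) := by
    intro k
    have h1 : W (k + 1) ⬝ᵥ W (k + 1) = W k ⬝ᵥ W (k + 2) := by
      have h2 : ∀ y, (B *ᵥ W k + (2 : ℝ) • W k) ⬝ᵥ y = W k ⬝ᵥ (B *ᵥ y + (2 : ℝ) • y) := by
        intro y
        rw [add_dotProduct, dotProduct_add, dot_mulVec_comm, hB, smul_dotProduct, dotProduct_smul]
      rw [hW (k + 1), ← h2, ← hW k]
    rw [len_sq, h1]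
    exact dot_le _ _
  -- If the growth factor were below `g` at step `k`, it would have been below `g` at all earlier
  -- steps, so `len (W k) ≤ g ^ k * len (W 0)`. For `k ≥ m₀` this contradicts the lower bound `(2 +
  -- c) ^ k * |q ⬝ᵥ W 0|` coming from the eigenvector `q`.
  have hgrow : ∀ k, m₀ ≤ k → g * len (W k) ≤ len (W (k + 1)) := by
    intro k hk
    by_contra hcon
    push Not at hcon
    have hdown : ∀ t ≤ k, len (W (k - t + 1)) < g * len (W (k - t)) := by
      intro t
      induction t with
      | zero => intro _; exact hcon
      | succ t ih =>
        intro ht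
        have h1 := ih (by omega)
        obtain ⟨s, hs⟩ : ∃ s, k - t = s + 1 := ⟨k - t - 1, by omega⟩
        have hs' : k - (t + 1) = s := by omega
        rw [hs] at h1
        rw [hs']
        have h2 := hconv s
        have h3 := hpos (s + 1)
        have h4 := hpos s
        have h5 : len (W s) * len (W (s + 2)) < len (W s) * (g * len (W (s + 1))) :=
          mul_lt_mul_of_pos_left h1 h4
        have h6 : len (W (s + 1)) * len (W (s + 1)) < (g * len (W s)) * len (W (s + 1)) := by
          nlinarith
        exact lt_of_mul_lt_mul_right h6 h3.le
    have hup : ∀ j ≤ k, len (W j) ≤ g ^ j * len (W 0) := by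
      intro j
      induction j with
      | zero => intro _; simp
      | succ j ih =>
        intro hj
        have h1 := hdown (k - j) (by omega)
        have e : k - (k - j) = j := by omega
        rw [e] at h1
        have h2 := ih (by omega)
        rw [pow_succ]
        nlinarith
    have h1 := hup k le_rfl
    have h2 := hlow k
    obtain ⟨s, rfl⟩ := Nat.exists_eq_add_of_le hk
    have h3 : R * g ^ (m₀ + s) < (2 + c) ^ (m₀ + s) := by
      rw [pow_add, pow_add, ← mul_assoc]
      refine mul_lt_mul hm₀ ?_ (by positivity) (by positivity)
      exact pow_le_pow_left₀ hg0.le (by rw [hg]; linarith) s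
    have h4 : g ^ (m₀ + s) * len (W 0) ≤ g ^ (m₀ + s) * (R * |q ⬝ᵥ W 0|) := by gcongr
    have h5 : R * g ^ (m₀ + s) * |q ⬝ᵥ W 0| < (2 + c) ^ (m₀ + s) * |q ⬝ᵥ W 0| :=
      mul_lt_mul_of_pos_right h3 hβ
    linarith
  refine ⟨hpos _, ?_⟩
  have hK0 : 0 ≤ K := by
    have := (len_nonneg _).trans (hK (W 0))
    exact nonneg_of_mul_nonneg_left this (hpos 0)
  induction i with
  | zero =>
    have h1 := len_perp_le hU (W m₀)
    have h2 : 0 ≤ 2 * K / c := by positivity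
    rw [add_zero, pow_zero]
    nlinarith [hpos m₀]
  | succ i ih =>
    -- The relative distance obeys `y ↦ (2 y + K) / g`: the shift keeps twice the old part, the
    -- range of `B` adds `K`, and the norm grows by `g`. The fixed point is `K / (g - 2) = 2K / c`,
    -- approached at rate `2 / g`.
    set y := (2 / g) ^ i + 2 * K / c with hy
    have h1 : len (perp U *ᵥ W (m₀ + (i + 1))) ≤ (2 * y + K) * len (W (m₀ + i)) := by
      rw [← add_assoc, hW, mulVec_add, mulVec_smul]
      refine (len_add_le _ _).trans ?_
      rw [len_smul, abs_two]
      linarith [hK (W (m₀ + i))]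
    have h2 := hgrow (m₀ + i) (by omega)
    have h3 : (2 / g) ^ (i + 1) + 2 * K / c = (2 * y + K) / g := by
      have hgc : 2 * K / c * g = 2 * (2 * K / c) + K := by rw [hg]; field_simp
      rw [hy, eq_div_iff hg0.ne', add_mul, hgc, pow_succ, mul_assoc, div_mul_cancel₀ _ hg0.ne']
      ring
    have hy0 : 0 ≤ 2 * y + K := by positivity
    rw [h3, div_mul_eq_mul_div, le_div_iff₀ hg0]
    calc _ ≤ (2 * y + K) * len (W (m₀ + i)) * g := by gcongr
      _ = (2 * y + K) * (g * len (W (m₀ + i))) := by ring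
      _ ≤ _ := by gcongr; exact h2

/-! ### Procrustes distance -/

theorem frob_sq {n r : ℕ} (A : Matrix (Fin n) (Fin r) ℝ) : ∑ i, ∑ j, A i j ^ 2 = (Aᵀ * A).trace := by
  rw [Finset.sum_comm]
  simp only [trace, diag_apply, Matrix.mul_apply, transpose_apply, sq]

theorem gram_transpose_mul {n r k : ℕ} {U : Matrix (Fin n) (Fin r) ℝ} (hU : Uᵀ * U = 1)
    {X : Matrix (Fin n) (Fin k) ℝ} (hXX : Xᵀ * X = 1) :
    (Uᵀ * X)ᵀ * (Uᵀ * X) = 1 - (perp U * X)ᵀ * (perp U * X) := by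
  have e1 : (perp U * X)ᵀ * (perp U * X) = Xᵀ * perp U * X := by
    rw [transpose_mul, perp_transpose, Matrix.mul_assoc, ← Matrix.mul_assoc (perp U),
      perp_mul_self hU, ← Matrix.mul_assoc]
  rw [e1, perp, Matrix.mul_sub, Matrix.mul_one, Matrix.sub_mul, hXX, transpose_mul,
    transpose_transpose, sub_sub_cancel]
  simp only [Matrix.mul_assoc]

/-- The orthogonal polar factor of a contraction `p` of full rank. -/
theorem exists_orthogonal_trace_le {r : ℕ} (p : Matrix (Fin r) (Fin r) ℝ)
    (hp : ∀ a, a ⬝ᵥ a = 1 → 0 < a ⬝ᵥ (pᵀ * p) *ᵥ a ∧ a ⬝ᵥ (pᵀ * p) *ᵥ a ≤ 1) :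
    ∃ O : Matrix (Fin r) (Fin r) ℝ, Oᵀ * O = 1 ∧ (pᵀ * p).trace ≤ (pᵀ * O).trace := by
  have hGh : (pᵀ * p).IsHermitian := by
    rw [IsHermitian, conjTranspose_eq_transpose_of_trivial, transpose_mul, transpose_transpose]
  obtain ⟨D, Y, hDb, hY1, hY2, hGY⟩ : ∃ (D : Fin r → ℝ) (Y : Matrix (Fin r) (Fin r) ℝ),
      (∀ i, 0 < D i ∧ D i ≤ 1) ∧ Yᵀ * Y = 1 ∧ Y * Yᵀ = 1 ∧ pᵀ * p = Y * diagonal D * Yᵀ := by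
    have h1 := hGh.spectral_theorem
    have h2 := Unitary.mem_iff.1 hGh.eigenvectorUnitary.2
    refine ⟨hGh.eigenvalues, hGh.eigenvectorUnitary, ?_, ?_, ?_, ?_⟩
    · intro i
      have h1 := hGh.mulVec_eigenvectorBasis i
      have ha1 : (hGh.eigenvectorBasis i).ofLp ⬝ᵥ (hGh.eigenvectorBasis i).ofLp = 1 := by
        have h1 := hGh.eigenvectorBasis.norm_eq_one i
        have h2 := len_eq_norm (hGh.eigenvectorBasis i).ofLp
        rw [WithLp.toLp_ofLp, h1] at h2
        rw [← len_sq, h2, one_pow]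
      have h3 := hp _ ha1
      rwa [h1, dotProduct_smul, ha1, smul_eq_mul, mul_one] at h3
    · simpa [star_eq_conjTranspose] using h2.1
    · simpa [star_eq_conjTranspose] using h2.2
    · simpa [Unitary.conjStarAlgAut_apply, star_eq_conjTranspose] using h1
  have hDsq : ∀ i, √(D i) * √(D i) = D i := fun i => Real.mul_self_sqrt (hDb i).1.le
  have hDs0 : ∀ i, √(D i) ≠ 0 := fun i => (Real.sqrt_pos.2 (hDb i).1).ne'
  have hcollapse : ∀ f g : Fin r → ℝ, (Y * diagonal f * Yᵀ) * (Y * diagonal g * Yᵀ) =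
      Y * diagonal (fun i => f i * g i) * Yᵀ := by
    intro f g
    calc _ = Y * diagonal f * (Yᵀ * Y) * diagonal g * Yᵀ := by simp only [Matrix.mul_assoc]
      _ = _ := by rw [hY1, Matrix.mul_one, Matrix.mul_assoc Y, diagonal_mul_diagonal]
  have htrY : ∀ f : Fin r → ℝ, (Y * diagonal f * Yᵀ).trace = ∑ i, f i := by
    intro f
    rw [trace_mul_comm, ← Matrix.mul_assoc, hY1, Matrix.one_mul, trace_diagonal]
  have hpO : pᵀ * (p * (Y * diagonal (fun i => (√(D i))⁻¹) * Yᵀ)) =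
      Y * diagonal (fun i => √(D i)) * Yᵀ := by
    rw [← Matrix.mul_assoc, hGY, hcollapse]
    have : (fun i => D i * (√(D i))⁻¹) = fun i => √(D i) := by
      ext i
      rw [mul_inv_eq_iff_eq_mul₀ (hDs0 i), hDsq]
    rw [this]
  -- This is `p (pᵀ p)^(-1/2)`. Then `pᵀ O = (pᵀ p)^(1/2)`, whose trace `∑ √Dᵢ` dominates `∑ Dᵢ`
  -- because all `Dᵢ ≤ 1`.
  refine ⟨p * (Y * diagonal (fun i => (√(D i))⁻¹) * Yᵀ), ?_, ?_⟩
  · have h1 : (p * (Y * diagonal (fun i => (√(D i))⁻¹) * Yᵀ))ᵀ =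
        (Y * diagonal (fun i => (√(D i))⁻¹) * Yᵀ) * pᵀ := by
      simp only [transpose_mul, transpose_transpose, diagonal_transpose, Matrix.mul_assoc]
    rw [h1, Matrix.mul_assoc, hpO, hcollapse]
    have : (fun i => (√(D i))⁻¹ * √(D i)) = fun _ => 1 := by
      ext i; exact inv_mul_cancel₀ (hDs0 i)
    rw [this, diagonal_one, Matrix.mul_one, hY2]
  · rw [hpO, hGY, htrY, htrY]
    refine Finset.sum_le_sum fun i _ => ?_
    have h1 : √(D i) ≤ 1 := Real.sqrt_le_one.2 (hDb i).2
    nlinarith [hDsq i, Real.sqrt_nonneg (D i)]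

theorem dot_perp_mul_le {n r : ℕ} {U : Matrix (Fin n) (Fin r) ℝ} {V : Fin r → Fin n → ℝ} {c : ℝ}
    (hsum : ∑ j, len (perp U *ᵥ V j) ^ 2 ≤ c) {a : Fin r → ℝ} (ha : a ⬝ᵥ a = 1) :
    ((perp U * (Matrix.of V)ᵀ) *ᵥ a) ⬝ᵥ ((perp U * (Matrix.of V)ᵀ) *ᵥ a) ≤ c := by
  have hpX : (perp U * (Matrix.of V)ᵀ) *ᵥ a = ∑ j, a j • (perp U *ᵥ V j) := by
    have : (Matrix.of V)ᵀ *ᵥ a = ∑ j, a j • V j := by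
      ext i; simp [mulVec, dotProduct, mul_comm]
    rw [← mulVec_mulVec, this, mulVec_sum]
    simp only [mulVec_smul]
  rw [← len_sq]
  have h1 : len ((perp U * (Matrix.of V)ᵀ) *ᵥ a) ≤ ∑ j, |a j| * len (perp U *ᵥ V j) := by
    rw [hpX, len_eq_norm, WithLp.toLp_sum]
    refine (norm_sum_le _ _).trans (le_of_eq ?_)
    exact Finset.sum_congr rfl fun j _ => by rw [← len_eq_norm, len_smul]
  have h2 := Finset.sum_mul_sq_le_sq_mul_sq Finset.univ (fun j => |a j|)
    fun j => len (perp U *ᵥ V j)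
  have h3 : ∑ j, |a j| ^ 2 = 1 := by
    simp only [sq_abs]; rw [← ha, dotProduct]
    exact Finset.sum_congr rfl fun j _ => sq _
  rw [h3, one_mul] at h2
  exact (pow_le_pow_left₀ (len_nonneg _) h1 2).trans (h2.trans hsum)

theorem procrustes_le_frob_coe {n r : ℕ} (X U : Matrix (Fin n) (Fin r) ℝ)
    (O : Matrix.orthogonalGroup (Fin r) ℝ) :
    procrustes X U ≤ frob (X - U * (O : Matrix (Fin r) (Fin r) ℝ)) := by
  have hbdd : BddBelow (Set.range fun O : Matrix.orthogonalGroup (Fin r) ℝ =>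
      frob (X - U * (O : Matrix (Fin r) (Fin r) ℝ))) := by
    refine ⟨0, ?_⟩
    rintro _ ⟨O, rfl⟩
    exact Real.sqrt_nonneg _
  exact ciInf_le hbdd O

theorem procrustes_le_frob {n r : ℕ} (X U : Matrix (Fin n) (Fin r) ℝ)
    {O : Matrix (Fin r) (Fin r) ℝ} (hOO : Oᵀ * O = 1) : procrustes X U ≤ frob (X - U * O) := by
  have hOmem : O ∈ Matrix.orthogonalGroup (Fin r) ℝ := by
    rw [mem_orthogonalGroup_iff']
    exact hOO
  exact procrustes_le_frob_coe X U ⟨O, hOmem⟩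

/-- Let `O` be the polar factor of `Uᵀ X`. Then `‖X - U O‖² = 2r - 2 tr((Uᵀ X)ᵀ O) ≤ 2r - 2 ‖Uᵀ X‖²
= 2 ∑ⱼ ‖perp U Vⱼ‖²`, at most `ε²`. The polar factor exists because `(Uᵀ X)ᵀ (Uᵀ X)` differs from
the identity by at most `ε²/2 < 1`. -/
theorem procrustes_le {n r : ℕ} {U : Matrix (Fin n) (Fin r) ℝ} (hU : Uᵀ * U = 1)
    {V : Fin r → Fin n → ℝ} (hV : IsOrtho V) {ε : ℝ} (hε : ε ≤ 1) (hε0 : 0 ≤ ε)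
    (h : ∀ j, len (perp U *ᵥ V j) ^ 2 ≤ ε ^ 2 / (2 * r)) :
    procrustes (Matrix.of V)ᵀ U ≤ ε := by
  have hsum : ∑ j, len (perp U *ᵥ V j) ^ 2 ≤ ε ^ 2 / 2 := by
    refine (Finset.sum_le_sum fun j _ => h j).trans ?_
    simp only [Finset.sum_const, Finset.card_univ, Fintype.card_fin, nsmul_eq_mul]
    rcases Nat.eq_zero_or_pos r with rfl | hr
    · simp; positivity
    · have : (r : ℝ) ≠ 0 := by exact_mod_cast hr.ne'
      apply le_of_eq; field_simp
  have hlenX := fun a => dot_perp_mul_le (a := a) hsum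
  have hcol : ∀ i j, (perp U * (Matrix.of V)ᵀ) i j = (perp U *ᵥ V j) i := by
    intro i j
    simp [Matrix.mul_apply, mulVec, dotProduct]
  have hXX : (Matrix.of V)ᵀᵀ * (Matrix.of V)ᵀ = 1 := by
    ext i j
    rw [Matrix.mul_apply, one_apply, ← hV i j]
    simp [dotProduct]
  generalize (Matrix.of V)ᵀ = X at hlenX hXX hcol ⊢
  have hGX := gram_transpose_mul hU hXX
  obtain ⟨O, hOO, htrO⟩ := exists_orthogonal_trace_le (Uᵀ * X) (by
    intro a ha
    have h2 : a ⬝ᵥ ((Uᵀ * X)ᵀ * (Uᵀ * X)) *ᵥ a =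
        1 - ((perp U * X) *ᵥ a) ⬝ᵥ ((perp U * X) *ᵥ a) := by
      rw [hGX, sub_mulVec, one_mulVec, dotProduct_sub, ha, ← mulVec_mulVec, dot_mulVec_comm,
        transpose_transpose]
    rw [h2]
    have h3 := hlenX a ha
    have h4 := dot_self_nonneg ((perp U * X) *ᵥ a)
    constructor <;> nlinarith)
  refine (procrustes_le_frob X U hOO).trans ?_
  rw [frob, frob_sq]
  apply Real.sqrt_le_iff.2 ⟨hε0, ?_⟩
  have hexp : (X - U * O)ᵀ * (X - U * O) = 1 + 1 - ((Uᵀ * X)ᵀ * O + ((Uᵀ * X)ᵀ * O)ᵀ) := by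
    have e1 : Xᵀ * (U * O) = (Uᵀ * X)ᵀ * O := by
      rw [transpose_mul, transpose_transpose, Matrix.mul_assoc]
    have e2 : (U * O)ᵀ * X = ((Uᵀ * X)ᵀ * O)ᵀ := by
      rw [← e1, transpose_mul Xᵀ, transpose_transpose]
    have e3 : (U * O)ᵀ * (U * O) = 1 := by
      rw [transpose_mul, Matrix.mul_assoc, ← Matrix.mul_assoc Uᵀ, hU, Matrix.one_mul, hOO]
    rw [transpose_sub, Matrix.sub_mul, Matrix.mul_sub, Matrix.mul_sub, hXX, e1, e2, e3]
    abel
  have htr : ((Uᵀ * X)ᵀ * (Uᵀ * X)).trace =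
      (1 : Matrix (Fin r) (Fin r) ℝ).trace - ∑ j, len (perp U *ᵥ V j) ^ 2 := by
    rw [hGX, trace_sub]
    congr 1
    rw [trace]
    refine Finset.sum_congr rfl fun j _ => ?_
    rw [len_sq, diag_apply, Matrix.mul_apply, dotProduct]
    exact Finset.sum_congr rfl fun i _ => by rw [transpose_apply, hcol]
  rw [hexp, trace_sub, trace_add, trace_add, trace_transpose]
  linarith

/-! ### One round on a good batch -/

/-- For all near-orthonormal trimming directions there is a new direction in which the trimmed
second moment of `H` exceeds the one of the Gaussian by `lam`. -/
def HasGap {r : ℕ} (τ lam : ℝ) (H : (Fin r → ℝ) → ℝ) : Prop :=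
  ∀ ℓ < r, ∀ p : Fin ℓ → Fin r → ℝ,
    (∀ i j, |p i ⬝ᵥ p j - if i = j then 1 else 0| ≤ 1 / (2 * r)) → (∀ j, p j ⬝ᵥ p j ≤ 1) →
    ∃ c : Fin r → ℝ, c ⬝ᵥ c = 1 ∧ (∀ j, p j ⬝ᵥ c = 0) ∧
      lam ≤ ∫ z, trim τ p H z * ((c ⬝ᵥ z) ^ 2 - 1) ∂gauss r

/-- The factor by which the range of the projected matrix may leave the hidden subspace. -/
noncomputable def leakConst (r : ℕ) : ℝ := 1 + slabLip * r + 3 * r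

theorem one_le_leakConst (r : ℕ) : 1 ≤ leakConst r := by
  have := slabLip_pos; unfold leakConst; nlinarith [Nat.cast_nonneg (α := ℝ) r]

/-- The factor by which the error grows in one round. -/
noncomputable def growth (r : ℕ) (lam : ℝ) : ℝ := 1 + 4 * leakConst r / lam

/-- `v` is a unit vector orthogonal to all `V j`, at distance at most `b` from the column span
of `U`. -/
def Extends {n r ℓ : ℕ} (U : Matrix (Fin n) (Fin r) ℝ) (V : Fin ℓ → Fin n → ℝ) (b : ℝ)
    (v : Fin n → ℝ) : Prop :=
  v ⬝ᵥ v = 1 ∧ (∀ j, V j ⬝ᵥ v = 0) ∧ len (perp U *ᵥ v) ≤ b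

/-- The vectors `V` are orthonormal and at distance at most `b` from the column span of `U`. -/
def IsClose {n r ℓ : ℕ} (U : Matrix (Fin n) (Fin r) ℝ) (b : ℝ) (V : Fin ℓ → Fin n → ℝ) : Prop :=
  IsOrtho V ∧ ∀ j, len (perp U *ᵥ V j) ≤ b

theorem IsClose.snoc {n r ℓ : ℕ} {U : Matrix (Fin n) (Fin r) ℝ} {V : Fin ℓ → Fin n → ℝ} {b b' : ℝ}
    (hV : IsClose U b V) (hb : b ≤ b') {v : Fin n → ℝ} (hv : Extends U V b' v) :
    IsClose U b' (Fin.snoc V v : Fin (ℓ + 1) → Fin n → ℝ) := by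
  refine ⟨fun i j => ?_, fun j => ?_⟩
  · refine Fin.lastCases ?_ (fun i => ?_) i <;> refine Fin.lastCases ?_ (fun j => ?_) j
    · simp [hv.1]
    · simp only [Fin.snoc_last, Fin.snoc_castSucc]
      rw [dotProduct_comm, hv.2.1, if_neg (Fin.castSucc_lt_last j).ne']
    · simp only [Fin.snoc_last, Fin.snoc_castSucc]
      rw [hv.2.1, if_neg (Fin.castSucc_lt_last i).ne]
    · simp only [Fin.snoc_castSucc, hV.1 i j, Fin.castSucc_inj]
  · refine Fin.lastCases ?_ (fun j => ?_) j
    · simpa using hv.2.2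
    · simpa using (hV.2 j).trans hb

section
variable {n r ℓ : ℕ} {U : Matrix (Fin n) (Fin r) ℝ} {V : Fin ℓ → Fin n → ℝ} {τ lam η e : ℝ}
  {H : (Fin r → ℝ) → ℝ} {S : Matrix (Fin n) (Fin n) ℝ}

/-- The summand `3 * r` of `leakConst` alone gives this. It guarantees that the projected trimming
directions stay nearly orthonormal and do not become short. -/
theorem three_mul_le_of_leak (hr : 1 ≤ r) (he : 0 ≤ e) (hlam1 : lam ≤ 1)
    (hsmall : leakConst r * e ≤ lam / 2) : 6 * (r * e) ≤ 1 ∧ 6 * e ≤ 1 := by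
  have hr1 : (1 : ℝ) ≤ r := by exact_mod_cast hr
  have h1 : 0 ≤ slabLip * r * e := mul_nonneg (mul_nonneg slabLip_pos.le (by linarith)) he
  unfold leakConst at hsmall
  constructor <;> nlinarith

/-- By Pythagoras the Gram defect of the projections is the inner product of the parts off `U`,
hence of second order in `e`. -/
theorem gram_transpose (hU : Uᵀ * U = 1) (hV : IsClose U e V) (i j : Fin ℓ) :
    |(Uᵀ *ᵥ V i) ⬝ᵥ (Uᵀ *ᵥ V j) - if i = j then 1 else 0| ≤ e * e := by
  have he : 0 ≤ e := (len_nonneg _).trans (hV.2 i)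
  rw [← hV.1 i j, dot_eq_add_perp hU (V i) (V j), sub_add_cancel_left, abs_neg]
  exact (abs_dot_le _ _).trans (mul_le_mul (hV.2 i) (hV.2 j) (len_nonneg _) he)

theorem quarter_le_transpose (hU : Uᵀ * U = 1) (hV : IsClose U e V) (he1 : 6 * e ≤ 1) (j : Fin ℓ) :
    1 / 4 ≤ (Uᵀ *ᵥ V j) ⬝ᵥ (Uᵀ *ᵥ V j) := by
  have he : 0 ≤ e := (len_nonneg _).trans (hV.2 j)
  have h := (abs_le.1 (gram_transpose hU hV j j)).1
  rw [if_pos rfl] at h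
  nlinarith

theorem sum_len_perp_le (hV : IsClose U e V) (hℓ : ℓ ≤ r) (he : 0 ≤ e) :
    ∑ j, len (perp U *ᵥ V j) ≤ r * e := by
  refine (Finset.sum_le_sum fun j _ => hV.2 j).trans ?_
  simp only [Finset.sum_const, Finset.card_univ, Fintype.card_fin, nsmul_eq_mul]
  gcongr

/-- `leakConst` collects three sources: the sampling deviation `η ≤ e`, the slab perturbation from
at most `r` trimming directions, and `3 r e` from projecting off vectors not exactly in the
subspace. There `3` bounds the form of `S`: `2` for its mean and `1` for the deviation. -/
theorem leak_of_deviation (hU : Uᵀ * U = 1) (hH : Measurable H) (hℓ : ℓ < r)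
    (hV : IsClose U e V) (he : 0 ≤ e) (hη : η ≤ e) (hlam1 : lam ≤ 1)
    (hsmall : leakConst r * e ≤ lam / 2)
    (hS : ∀ a b, |a ⬝ᵥ (S - wMat (trim τ V fun x => H (Uᵀ *ᵥ x))) *ᵥ b| ≤ η * (len a * len b))
    (v : Fin n → ℝ) :
    len (perp U *ᵥ (projected V S *ᵥ v)) ≤ leakConst r * e * len v := by
  have hr : 1 ≤ r := (Nat.zero_le ℓ).trans_lt hℓ
  have hℓr : (ℓ : ℝ) ≤ r := by exact_mod_cast hℓ.le
  have hLp := slabLip_pos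
  obtain ⟨-, he1⟩ := three_mul_le_of_leak hr he hlam1 hsmall
  have hq := quarter_le_transpose hU hV he1
  have hs := sum_len_perp_le hV hℓ.le he
  have hsplit : ∀ a b, |a ⬝ᵥ S *ᵥ b| ≤
      |a ⬝ᵥ wMat (trim τ V fun x => H (Uᵀ *ᵥ x)) *ᵥ b| + η * (len a * len b) := by
    intro a b
    have h1 := hS a b
    rw [sub_mulVec, dotProduct_sub] at h1
    have h2 := abs_sub_abs_le_abs_sub (a ⬝ᵥ S *ᵥ b)
      (a ⬝ᵥ wMat (trim τ V fun x => H (Uᵀ *ᵥ x)) *ᵥ b)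
    linarith
  have h1 : ∀ a b, Uᵀ *ᵥ a = 0 → |a ⬝ᵥ S *ᵥ b| ≤ (e + slabLip * (r * e)) * (len a * len b) := by
    intro a b ha
    have h0 : 0 ≤ len a * len b := mul_nonneg (len_nonneg a) (len_nonneg b)
    refine (hsplit a b).trans ?_
    have h2 := abs_dot_wMat_trim_le (τ := τ) hU hH hq b ha
    have h3 : slabLip * (∑ j, len (perp U *ᵥ V j)) * (len a * len b) ≤
      slabLip * (r * e) * (len a * len b) := by gcongr
    have h4 : η * (len a * len b) ≤ e * (len a * len b) := by gcongr
    linarith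
  have h3 : ∀ a b, |a ⬝ᵥ S *ᵥ b| ≤ 3 * (len a * len b) := by
    intro a b
    have h0 : 0 ≤ len a * len b := mul_nonneg (len_nonneg a) (len_nonneg b)
    refine (hsplit a b).trans ?_
    have h2 := abs_dot_wMat_le (isWeight_trim_comp τ V hH U) a b
    have h4 : η * (len a * len b) ≤ 1 * (len a * len b) := by gcongr; linarith
    linarith
  refine (len_perp_projected_le hU hV.1 he h1 h3 (by positivity) hV.2 v).trans ?_
  refine mul_le_mul_of_nonneg_right ?_ (len_nonneg v)
  have : (ℓ : ℝ) * e ≤ r * e := by gcongr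
  unfold leakConst
  linarith

/-- The direction `U *ᵥ c` supplied by the gap is exactly orthogonal to all `V j`, so the projection
leaves it alone. Slab perturbation and sampling deviation then cost at most half of `lam`. -/
theorem exists_form_ge_of_deviation (hU : Uᵀ * U = 1) (hH : Measurable H) (hgap : HasGap τ lam H)
    (hℓ : ℓ < r) (hV : IsClose U e V) (he : 0 ≤ e) (hη : η ≤ e) (hlam1 : lam ≤ 1)
    (hsmall : leakConst r * e ≤ lam / 2)
    (hS : ∀ a b, |a ⬝ᵥ (S - wMat (trim τ V fun x => H (Uᵀ *ᵥ x))) *ᵥ b| ≤ η * (len a * len b)) :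
    ∃ w, w ⬝ᵥ w = 1 ∧ lam / 2 ≤ w ⬝ᵥ projected V S *ᵥ w := by
  have hr : 1 ≤ r := (Nat.zero_le ℓ).trans_lt hℓ
  have hr1 : (1 : ℝ) ≤ r := by exact_mod_cast hr
  have hLp := slabLip_pos
  obtain ⟨hre, he1⟩ := three_mul_le_of_leak hr he hlam1 hsmall
  have hq := quarter_le_transpose hU hV he1
  have hs := sum_len_perp_le hV hℓ.le he
  obtain ⟨c, hc, hcV, hlam⟩ := hgap ℓ hℓ (fun j => Uᵀ *ᵥ V j) (by
    intro i j
    refine (gram_transpose hU hV i j).trans ?_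
    rw [le_div_iff₀ (by positivity)]
    nlinarith) (by
    intro j
    refine (transpose_dot_self_le hU _).trans ?_
    rw [hV.1, if_pos rfl])
  have hVc : ∀ j, V j ⬝ᵥ U *ᵥ c = 0 := fun j => by rw [dot_mulVec_comm, hcV]
  have hc1 : (U *ᵥ c) ⬝ᵥ (U *ᵥ c) = 1 := by
    rw [dot_mulVec_comm, mulVec_mulVec, hU, one_mulVec, hc]
  refine ⟨U *ᵥ c, hc1, ?_⟩
  rw [dot_projected, projMat_mulVec_of_ortho hVc]
  have h1 := le_dot_wMat_trim (τ := τ) hU hH hq hc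
  have h2 := (abs_le.1 (hS (U *ᵥ c) (U *ᵥ c))).1
  rw [sub_mulVec, dotProduct_sub, len_eq_one hc1] at h2
  have h3 : slabLip * ∑ j, len (perp U *ᵥ V j) ≤ slabLip * (r * e) := by gcongr
  have h4 : 0 ≤ r * e := by positivity
  unfold leakConst at hsmall
  linarith

/-- One round with an exact eigenvector. -/
theorem extends_of_isTopEigenvector (hU : Uᵀ * U = 1) (hH : Measurable H) (hgap : HasGap τ lam H)
    (hℓ : ℓ < r) (hV : IsClose U e V) (he : 0 ≤ e) (hη : η ≤ e) (hlam0 : 0 < lam)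
    (hlam1 : lam ≤ 1) (hsmall : leakConst r * e ≤ lam / 2) (hSt : Sᵀ = S)
    (hS : ∀ a b, |a ⬝ᵥ (S - wMat (trim τ V fun x => H (Uᵀ *ᵥ x))) *ᵥ b| ≤ η * (len a * len b))
    {v : Fin n → ℝ} (hv : IsTopEigenvector (projected V S) v) :
    Extends U V (growth r lam * e) v := by
  have hleak := leak_of_deviation hU hH hℓ hV he hη hlam1 hsmall hS
  obtain ⟨w, hw1, hw⟩ := exists_form_ge_of_deviation hU hH hgap hℓ hV he hη hlam1 hsmall hS
  obtain ⟨μ, hμ, hμv, hlen⟩ := top_eigenvector_close (projected_transpose hSt) hw1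
    (half_pos hlam0) hw hleak hv
  refine ⟨hv.1, fun j => ?_, hlen.trans ?_⟩
  · have h := dot_projected_eq_zero (S := S) hV.1 j v
    rw [hμv, dotProduct_smul, smul_eq_mul] at h
    exact (mul_eq_zero.1 h).resolve_left hμ.ne'
  · have h1 := one_le_leakConst r
    have h2 : leakConst r * e / (lam / 2) = 2 * leakConst r / lam * e := by field_simp
    have h3 : 0 ≤ 2 * leakConst r / lam * e := by positivity
    have h4 : 4 * leakConst r / lam * e = 2 * (2 * leakConst r / lam * e) := by ring
    rw [h2, growth, add_mul, h4]
    linarith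

/-- One round with power iteration, for a start vector that is not nearly orthogonal to the top
eigenvector. -/
theorem extends_of_powerIteration (hU : Uᵀ * U = 1) (hH : Measurable H) (hgap : HasGap τ lam H)
    (hℓ : ℓ < r) (hV : IsClose U e V) (he : 0 ≤ e) (hη : η ≤ e) (hlam0 : 0 < lam)
    (hlam1 : lam ≤ 1) (hsmall : leakConst r * e ≤ lam / 2) (hSt : Sᵀ = S)
    (hS : ∀ a b, |a ⬝ᵥ (S - wMat (trim τ V fun x => H (Uᵀ *ᵥ x))) *ᵥ b| ≤ η * (len a * len b))
    {s L : ℝ} (hs : 0 < s) {m₀ i : ℕ}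
    (hm₀ : L / s * (2 + lam / 4) ^ m₀ < (2 + lam / 2) ^ m₀) (hi : (2 / (2 + lam / 4)) ^ i ≤ e) :
    ∃ q : Fin n → ℝ, q ⬝ᵥ q = 1 ∧ ∀ (g : Fin n → ℝ) (W : ℕ → Fin n → ℝ), s ≤ |q ⬝ᵥ g| → len g ≤ L → W 0 = projMat V *ᵥ g →
      (∀ k, W (k + 1) = projected V S *ᵥ W k + (2 : ℝ) • W k) →
      Extends U V (growth r lam * e) ((len (W (m₀ + i)))⁻¹ • W (m₀ + i)) := by
  have hleak := leak_of_deviation hU hH hℓ hV he hη hlam1 hsmall hS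
  obtain ⟨w, hw1, hw⟩ := exists_form_ge_of_deviation hU hH hgap hℓ hV he hη hlam1 hsmall hS
  have hB := projected_transpose (V := V) hSt
  -- `q` depends on the matrix only and is fixed before the start vector, so that `q ⬝ᵥ g` is a
  -- standard Gaussian when `g` is drawn independently.
  obtain ⟨q, μ, hq, hqμ, hμ⟩ := exists_eigenvector_ge hB hw1 hw
  have hμ0 : 0 < μ := (half_pos hlam0).trans_le hμ
  have hVq : ∀ j, V j ⬝ᵥ q = 0 := by
    intro j
    have h := dot_projected_eq_zero (S := S) hV.1 j q
    rw [hqμ, dotProduct_smul, smul_eq_mul] at h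
    exact (mul_eq_zero.1 h).resolve_left hμ0.ne'
  refine ⟨q, hq, fun g W hg hL hW0 hW => ?_⟩
  have hqW : q ⬝ᵥ W 0 = q ⬝ᵥ g := by
    rw [hW0, dot_mulVec_comm, projMat_transpose, projMat_mulVec_of_ortho hVq]
  have hqg : 0 < |q ⬝ᵥ g| := hs.trans_le hg
  have hL0 : 0 ≤ L := (len_nonneg g).trans hL
  have hR : len (W 0) ≤ L / s * |q ⬝ᵥ W 0| := by
    rw [hqW, hW0]
    refine (len_projMat_le hV.1 g).trans (hL.trans ?_)
    rw [div_mul_eq_mul_div, le_div_iff₀ hs]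
    gcongr
  have h4 : lam / 2 / 2 = lam / 4 := by ring
  obtain ⟨hpos, hclose⟩ := power_iteration_close hU hB hq hqμ (half_pos hlam0) hμ hleak hW
    (by rw [hqW]; exact abs_pos.1 hqg) hR (m₀ := m₀) (by rw [h4]; exact hm₀) i
  rw [h4] at hclose
  have hVW : ∀ k j, V j ⬝ᵥ W k = 0 := by
    intro k j
    cases k with
    | zero => rw [hW0, dot_projMat_mulVec hV.1]
    | succ k =>
      induction k with
      | zero => rw [hW, dotProduct_add, dot_projected_eq_zero hV.1, dotProduct_smul, hW0,
          dot_projMat_mulVec hV.1, smul_zero, add_zero]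
      | succ k ih => rw [hW, dotProduct_add, dot_projected_eq_zero hV.1, dotProduct_smul, ih,
          smul_zero, add_zero]
  refine ⟨?_, fun j => by rw [dotProduct_smul, hVW, smul_zero], ?_⟩
  · rw [smul_dotProduct, dotProduct_smul, ← len_sq, smul_eq_mul, smul_eq_mul]
    field_simp
  · rw [mulVec_smul, len_smul, abs_of_pos (inv_pos.2 hpos), inv_mul_le_iff₀ hpos]
    refine hclose.trans ?_
    rw [mul_comm]
    refine mul_le_mul_of_nonneg_left ?_ hpos.le
    -- The limit `2K/c` with `K = leakConst r * e` and `c = lam / 2` is the second summand of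
    -- `growth`; the first summand `1` pays for the decaying term.
    have h2 : 2 * (leakConst r * e) / (lam / 2) = 4 * leakConst r / lam * e := by
      field_simp; ring
    rw [h2, growth, add_mul, one_mul]
    gcongr

end

/-! ### Values computed by the algorithm -/

theorem secondMoment_val {n m ℓ : ℕ} (τ : ℝ) (V : Fin ℓ → Fin n → ℝ) (F : (Fin n → ℝ) → ℝ)
    (x : Fin m → Fin n → ℝ) :
    (secondMoment τ V x fun a => F (x a)).val = empMat (trim τ V F) x := by
  ext i j
  change (∑ a, (keep τ V (x a) (F (x a))).val * (x a i * x a j - if i = j then 1 else 0)) / m = _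
  simp only [keep_val, empMat, of_apply, trim]

theorem oneRound_val {n m ℓ : ℕ} (τ : ℝ)
    (eig : (Fin n → ℝ) → Matrix (Fin n) (Fin n) ℝ → Timed (Fin n → ℝ))
    (V : Fin ℓ → Fin n → ℝ) (F : (Fin n → ℝ) → ℝ) (x : Fin m → Fin n → ℝ) (g : Fin n → ℝ) :
    (oneRound τ eig V x (fun a => F (x a)) g).val =
      (eig (projMat V *ᵥ g) (projected V (empMat (trim τ V F) x))).val := by
  rw [← secondMoment_val]
  rfl

/-- The iterates of the power method for `M + 2 Id`. -/
def powSeq {n : ℕ} (M : Matrix (Fin n) (Fin n) ℝ) (g : Fin n → ℝ) : ℕ → Fin n → ℝ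
  | 0 => g
  | k + 1 => M *ᵥ powSeq M g k + (2 : ℝ) • powSeq M g k

theorem powerIteration_val {n : ℕ} (k : ℕ) (g : Fin n → ℝ) (M : Matrix (Fin n) (Fin n) ℝ) :
    (powerIteration k g M).val = (len (powSeq M g k))⁻¹ • powSeq M g k := by
  have h : ∀ k, (Timed.iterate (Timed.matVec
      (Matrix.of fun i j => M i j + if i = j then 2 else 0)) k g).val = powSeq M g k := by
    intro k
    induction k with
    | zero => rfl
    | succ k ih =>
      change (Timed.matVec _ (Timed.iterate _ k g).val).val = _
      rw [ih]
      ext i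
      change ∑ j, (M i j + if i = j then 2 else 0) * powSeq M g k j = _
      simp [powSeq, add_mul, Finset.sum_add_distrib, mulVec, dotProduct]
  ext i
  change (Timed.iterate _ k g).val i /
    √(∑ j, (Timed.iterate _ k g).val j * (Timed.iterate _ k g).val j) = _
  rw [Pi.smul_apply, smul_eq_mul, div_eq_inv_mul, len, dotProduct]
  simp only [← h k]
  rfl

/-- The vectors found in the first `ℓ` rounds, as a function of the batches. -/
noncomputable def found {n r m : ℕ} (τ : ℝ) (eig : (Fin n → ℝ) → Matrix (Fin n) (Fin n) ℝ → Timed (Fin n → ℝ))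
    (F : (Fin n → ℝ) → ℝ) (z : Fin r → (Fin m → Fin n → ℝ) × (Fin n → ℝ)) (ℓ : ℕ) (h : ℓ ≤ r) :
    Fin ℓ → Fin n → ℝ :=
  (rounds τ eig (fun k => (z k).1) (fun k a => F ((z k).1 a)) (fun k => (z k).2) ℓ h).val

/-- The vector found in a round, as a function of the vectors found before and of the batch. -/
noncomputable def next {n m ℓ : ℕ} (τ : ℝ) (eig : (Fin n → ℝ) → Matrix (Fin n) (Fin n) ℝ → Timed (Fin n → ℝ))
    (F : (Fin n → ℝ) → ℝ) (V : Fin ℓ → Fin n → ℝ) (b : (Fin m → Fin n → ℝ) × (Fin n → ℝ)) :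
    Fin n → ℝ :=
  (eig (projMat V *ᵥ b.2) (projected V (empMat (trim τ V F) b.1))).val

section
variable {n r m : ℕ} {τ : ℝ}
  {eig : (Fin n → ℝ) → Matrix (Fin n) (Fin n) ℝ → Timed (Fin n → ℝ)} {F : (Fin n → ℝ) → ℝ}

theorem found_succ (z : Fin r → (Fin m → Fin n → ℝ) × (Fin n → ℝ)) (ℓ : ℕ) (h : ℓ + 1 ≤ r) :
    found τ eig F z (ℓ + 1) h = Fin.snoc (found τ eig F z ℓ (Nat.le_of_succ_le h))
      (next τ eig F (found τ eig F z ℓ (Nat.le_of_succ_le h)) (z ⟨ℓ, h⟩)) := by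
  unfold next
  rw [← oneRound_val]
  rfl

/-- The first `ℓ` rounds read only the first `ℓ` batches; hence the vectors found so far are
independent of the next batch. -/
theorem found_congr {z z' : Fin r → (Fin m → Fin n → ℝ) × (Fin n → ℝ)} (ℓ : ℕ) (h : ℓ ≤ r)
    (hz : ∀ k : Fin r, (k : ℕ) < ℓ → z k = z' k) : found τ eig F z ℓ h = found τ eig F z' ℓ h := by
  induction ℓ with
  | zero => rfl
  | succ ℓ ih =>
    rw [found_succ, found_succ, ih _ fun k hk => hz k (by omega), hz ⟨ℓ, h⟩ (by simp)]

/-! ### Measurability -/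

theorem measurable_trim_joint {ℓ : ℕ} (hF : Measurable F) :
    Measurable fun p : (Fin ℓ → Fin n → ℝ) × (Fin n → ℝ) => trim τ p.1 F p.2 := by
  unfold trim
  refine ((measurable_thr τ).comp (hF.comp measurable_snd)).mul
    (Finset.measurable_fun_prod _ fun j _ => measurable_slab.comp ?_)
  unfold dotProduct
  fun_prop

section Entries
variable {Z : Type*} [MeasurableSpace Z] {A B : Z → Matrix (Fin n) (Fin n) ℝ} {v : Z → Fin n → ℝ}

theorem measurable_mul_apply (hA : ∀ i j, Measurable fun z => A z i j)
    (hB : ∀ i j, Measurable fun z => B z i j) (i j : Fin n) :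
    Measurable fun z => (A z * B z) i j := by
  simp only [Matrix.mul_apply]
  exact Finset.measurable_fun_sum _ fun k _ => (hA i k).mul (hB k j)

theorem measurable_mulVec_apply (hA : ∀ i j, Measurable fun z => A z i j)
    (hv : Measurable v) : Measurable fun z => A z *ᵥ v z := by
  refine measurable_pi_iff.2 fun i => ?_
  simp only [mulVec, dotProduct]
  exact Finset.measurable_fun_sum _ fun k _ => (hA i k).mul (measurable_pi_iff.1 hv k)

theorem measurable_len (hv : Measurable v) : Measurable fun z => len (v z) := by
  unfold len dotProduct
  have := measurable_pi_iff.1 hv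
  fun_prop

theorem measurable_powSeq (hA : ∀ i j, Measurable fun z => A z i j) (hv : Measurable v) (k : ℕ) :
    Measurable fun z => powSeq (A z) (v z) k := by
  induction k with
  | zero => exact hv
  | succ k ih =>
    exact (measurable_mulVec_apply hA ih).add
      (measurable_pi_iff.2 fun i => (measurable_pi_iff.1 ih i).const_mul 2)

end Entries

/-- The subroutine depends measurably on its input. -/
def IsMeasurableEig (eig : (Fin n → ℝ) → Matrix (Fin n) (Fin n) ℝ → Timed (Fin n → ℝ)) : Prop :=
  Measurable fun p : (Fin n → ℝ) × (Fin n → Fin n → ℝ) => (eig p.1 (Matrix.of p.2)).val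

theorem isMeasurableEig_powerIteration (k : ℕ) : IsMeasurableEig (powerIteration (n := n) k) := by
  unfold IsMeasurableEig
  simp only [powerIteration_val]
  have h : Measurable fun p : (Fin n → ℝ) × (Fin n → Fin n → ℝ) =>
      powSeq (Matrix.of p.2) p.1 k :=
    measurable_powSeq (fun i j => by simp only [of_apply]; fun_prop) measurable_fst k
  exact (measurable_len h).inv.smul h

theorem measurable_next {ℓ : ℕ} (hF : Measurable F) (he : IsMeasurableEig eig) :
    Measurable fun p : (Fin ℓ → Fin n → ℝ) × ((Fin m → Fin n → ℝ) × (Fin n → ℝ)) =>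
      next τ eig F p.1 p.2 := by
  have hproj : ∀ i j, Measurable
      fun p : (Fin ℓ → Fin n → ℝ) × ((Fin m → Fin n → ℝ) × (Fin n → ℝ)) => projMat p.1 i j := by
    intro i j
    simp only [projMat, of_apply]
    fun_prop
  have hemp : ∀ i j, Measurable
      fun p : (Fin ℓ → Fin n → ℝ) × ((Fin m → Fin n → ℝ) × (Fin n → ℝ)) =>
        empMat (trim τ p.1 F) p.2.1 i j := by
    intro i j
    simp only [empMat, of_apply]
    refine (Finset.measurable_fun_sum _ fun a _ => ?_).div_const _
    refine Measurable.mul ?_ (by fun_prop)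
    exact (measurable_trim_joint hF).comp (measurable_fst.prodMk (by fun_prop))
  have hM : Measurable fun p : (Fin ℓ → Fin n → ℝ) × ((Fin m → Fin n → ℝ) × (Fin n → ℝ)) =>
      (fun i j => projected p.1 (empMat (trim τ p.1 F) p.2.1) i j : Fin n → Fin n → ℝ) :=
    measurable_pi_iff.2 fun i => measurable_pi_iff.2 fun j =>
      measurable_mul_apply (measurable_mul_apply hproj hemp) hproj i j
  have he' : Measurable fun p : (Fin n → ℝ) × (Fin n → Fin n → ℝ) =>
      (eig p.1 (Matrix.of p.2)).val := he
  have hg : Measurable fun p : (Fin ℓ → Fin n → ℝ) × ((Fin m → Fin n → ℝ) × (Fin n → ℝ)) =>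
      p.2.2 := measurable_snd.comp measurable_snd
  exact he'.comp ((measurable_mulVec_apply hproj hg).prodMk hM)

theorem measurable_found (hF : Measurable F) (he : IsMeasurableEig eig) (ℓ : ℕ) (h : ℓ ≤ r) :
    Measurable fun z : Fin r → (Fin m → Fin n → ℝ) × (Fin n → ℝ) => found τ eig F z ℓ h := by
  induction ℓ with
  | zero => exact measurable_pi_iff.2 fun i => i.elim0
  | succ ℓ ih =>
    have h1 := ih (Nat.le_of_succ_le h)
    have h2 : Measurable fun z : Fin r → (Fin m → Fin n → ℝ) × (Fin n → ℝ) =>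
        next τ eig F (found τ eig F z ℓ (Nat.le_of_succ_le h)) (z ⟨ℓ, h⟩) :=
      Measurable.comp (g := fun p : (Fin ℓ → Fin n → ℝ) × ((Fin m → Fin n → ℝ) × (Fin n → ℝ)) =>
        next τ eig F p.1 p.2)
        (f := fun z : Fin r → (Fin m → Fin n → ℝ) × (Fin n → ℝ) =>
          (found τ eig F z ℓ (Nat.le_of_succ_le h), z ⟨ℓ, h⟩))
        (measurable_next hF he) (Measurable.prodMk h1 (measurable_pi_apply _))
    refine measurable_pi_iff.2 fun i => ?_
    refine Fin.lastCases ?_ (fun i => ?_) i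
    · simp only [found_succ, Fin.snoc_last]
      exact h2
    · simp only [found_succ, Fin.snoc_castSucc]
      exact measurable_pi_iff.1 h1 i

end

section
variable {n r ℓ : ℕ} {U : Matrix (Fin n) (Fin r) ℝ}

theorem measurable_dotProduct {Z : Type*} [MeasurableSpace Z] {f g : Z → Fin n → ℝ}
    (hf : Measurable f) (hg : Measurable g) : Measurable fun z => f z ⬝ᵥ g z := by
  have := measurable_pi_iff.1 hf
  have := measurable_pi_iff.1 hg
  unfold dotProduct
  fun_prop

theorem measurable_len_perp : Measurable fun v : Fin n → ℝ => len (perp U *ᵥ v) :=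
  measurable_len (measurable_mulVec_left (perp U))

theorem measurableSet_isClose (b : ℝ) :
    MeasurableSet {V : Fin ℓ → Fin n → ℝ | IsClose U b V} := by
  have h1 : ∀ i j : Fin ℓ, Measurable fun V : Fin ℓ → Fin n → ℝ => V i ⬝ᵥ V j := fun i j =>
    measurable_dotProduct (measurable_pi_apply i) (measurable_pi_apply j)
  have h2 : ∀ j : Fin ℓ, Measurable fun V : Fin ℓ → Fin n → ℝ => len (perp U *ᵥ V j) := fun j =>
    measurable_len_perp.comp (measurable_pi_apply j)
  simp only [IsClose, IsOrtho, Set.ofPred_and, Set.ofPred_forall]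
  exact (MeasurableSet.iInter fun i => MeasurableSet.iInter fun j =>
    measurableSet_eq_fun (h1 i j) measurable_const).inter
    (MeasurableSet.iInter fun j => measurableSet_le (h2 j) measurable_const)

theorem measurableSet_extends (b : ℝ) :
    MeasurableSet {p : (Fin ℓ → Fin n → ℝ) × (Fin n → ℝ) | Extends U p.1 b p.2} := by
  have h1 : ∀ j : Fin ℓ, Measurable fun p : (Fin ℓ → Fin n → ℝ) × (Fin n → ℝ) => p.1 j ⬝ᵥ p.2 :=
    fun j => measurable_dotProduct ((measurable_pi_apply j).comp measurable_fst) measurable_snd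
  simp only [Extends, Set.ofPred_and, Set.ofPred_forall]
  exact (measurableSet_eq_fun
    (measurable_dotProduct measurable_snd measurable_snd) measurable_const).inter
    ((MeasurableSet.iInter fun j => measurableSet_eq_fun (h1 j) measurable_const).inter
    (measurableSet_le (measurable_len_perp.comp measurable_snd) measurable_const))

end

/-! ### Independence of the batches -/

section Indep
variable {r : ℕ} {Z : Type*} [MeasurableSpace Z] (ν : Measure Z) [IsProbabilityMeasure ν]

/-- Resampling one coordinate independently does not change a product law; this is the form in which
independence of the batches is used. -/
theorem measurePreserving_update (k : Fin r) :
    MeasurePreserving (fun p : Z × (Fin r → Z) => Function.update p.2 k p.1)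
      (ν.prod (Measure.pi fun _ => ν)) (Measure.pi fun _ => ν) := by
  have hm : Measurable fun p : Z × (Fin r → Z) => Function.update p.2 k p.1 := by
    refine measurable_pi_iff.2 fun i => ?_
    by_cases h : i = k
    · subst h; simpa using measurable_fst
    · simp only [Function.update_of_ne h]
      exact (measurable_pi_apply i).comp measurable_snd
  refine ⟨hm, (Measure.pi_eq fun s hs => ?_).symm⟩
  rw [Measure.map_apply hm (MeasurableSet.univ_pi hs)]
  have : (fun p : Z × (Fin r → Z) => Function.update p.2 k p.1) ⁻¹' Set.univ.pi s =
      s k ×ˢ Set.univ.pi (Function.update s k Set.univ) := by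
    ext p
    simp only [Set.mem_preimage, Set.mem_univ_pi, Set.mem_prod]
    constructor
    · refine fun h => ⟨by simpa using h k, fun i => ?_⟩
      by_cases hi : i = k
      · subst hi; simp
      · simpa [Function.update_of_ne hi] using h i
    · rintro ⟨h1, h2⟩ i
      by_cases hi : i = k
      · subst hi; simpa using h1
      · simpa [Function.update_of_ne hi] using h2 i
  rw [this, Measure.prod_prod, Measure.pi_pi, ← Finset.mul_prod_erase _ _ (Finset.mem_univ k),
    ← Finset.mul_prod_erase Finset.univ (fun i => ν (s i)) (Finset.mem_univ k),
    Function.update_self, measure_univ, one_mul]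
  congr 1
  exact Finset.prod_congr rfl fun i hi => by rw [Function.update_of_ne (Finset.ne_of_mem_erase hi)]

/-- A bad event for coordinate `k` given data that do not depend on it. -/
theorem measure_pi_le_of_forall {Y : Type*} [MeasurableSpace Y] (k : Fin r) {f : (Fin r → Z) → Y}
    (hf : Measurable f) (hfk : ∀ z b, f (Function.update z k b) = f z) {T : Set (Y × Z)}
    (hT : MeasurableSet T) {c : ENNReal} (hc : ∀ y, ν {b | (y, b) ∈ T} ≤ c) :
    (Measure.pi fun _ : Fin r => ν) {z | (f z, z k) ∈ T} ≤ c := by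
  have hmeas : MeasurableSet {z : Fin r → Z | (f z, z k) ∈ T} :=
    (hf.prodMk (measurable_pi_apply k)) hT
  -- After resampling coordinate `k`, `f` sees only the old point, so Fubini reduces the event to
  -- its fibres.
  rw [← (measurePreserving_update ν k).measure_preimage hmeas.nullMeasurableSet,
    Measure.prod_apply_symm ((measurePreserving_update ν k).measurable hmeas)]
  refine (lintegral_mono fun z => ?_).trans_eq (by rw [lintegral_const, measure_univ, mul_one])
  refine le_trans (le_of_eq ?_) (hc (f z))
  congr 1
  ext b
  simp [hfk]

end Indep

/-! ### Union bound over the rounds -/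

/-- The law of one batch. -/
noncomputable def batchLaw (n m : ℕ) : Measure ((Fin m → Fin n → ℝ) × (Fin n → ℝ)) :=
  (Measure.pi fun _ => gauss n).prod (gauss n)

instance (n m : ℕ) : IsProbabilityMeasure (batchLaw n m) := by unfold batchLaw; infer_instance

/-- A failure after `ℓ + 1` rounds is either inherited or created by the fresh batch, and the latter
has probability at most `c` conditionally on the earlier vectors. -/
theorem measure_not_isClose_found_le {n r m : ℕ} {τ : ℝ}
    {eig : (Fin n → ℝ) → Matrix (Fin n) (Fin n) ℝ → Timed (Fin n → ℝ)} {F : (Fin n → ℝ) → ℝ}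
    (hF : Measurable F) (he : IsMeasurableEig eig) {U : Matrix (Fin n) (Fin r) ℝ} {b : ℕ → ℝ}
    (hb : ∀ ℓ < r, b ℓ ≤ b (ℓ + 1)) {c : ENNReal}
    (hc : ∀ ℓ < r, ∀ V : Fin ℓ → Fin n → ℝ, IsClose U (b ℓ) V →
      batchLaw n m {z | ¬ Extends U V (b (ℓ + 1)) (next τ eig F V z)} ≤ c) (ℓ : ℕ) (h : ℓ ≤ r) :
    (Measure.pi fun _ : Fin r => batchLaw n m) {z | ¬ IsClose U (b ℓ) (found τ eig F z ℓ h)} ≤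
      ℓ * c := by
  induction ℓ with
  | zero => simp [IsClose, IsOrtho]
  | succ ℓ ih =>
    have hℓ := Nat.le_of_succ_le h
    -- Closeness of the earlier vectors is part of the bad set, so that fibres over bad `V` are
    -- empty and the hypothesis is needed only for good ones.
    let T : Set ((Fin ℓ → Fin n → ℝ) × ((Fin m → Fin n → ℝ) × (Fin n → ℝ))) :=
      {p | IsClose U (b ℓ) p.1 ∧ ¬ Extends U p.1 (b (ℓ + 1)) (next τ eig F p.1 p.2)}
    have hT : MeasurableSet T :=
      (measurable_fst (measurableSet_isClose (b ℓ))).inter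
        ((measurable_fst.prodMk (measurable_next hF he)) (measurableSet_extends (b (ℓ + 1)))).compl
    have h1 := measure_pi_le_of_forall (batchLaw n m) ⟨ℓ, h⟩ (measurable_found (r := r) (m := m)
      (τ := τ) hF he ℓ hℓ) (fun z y => found_congr ℓ hℓ fun k hk => by
        rw [Function.update_of_ne (fun h => by rw [h] at hk; simp at hk)]) hT (c := c) (fun V => by
        by_cases hV : IsClose U (b ℓ) V
        · simpa [T, hV] using hc ℓ h V hV
        · simp [T, hV])
    refine (measure_mono ?_).trans ((measure_union_le _ _).trans (add_le_add (ih hℓ) h1)) |>.trans_eq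
      (by push_cast; ring)
    intro z hz
    by_contra hcon
    simp only [Set.mem_union, not_or, Set.mem_ofPred_eq, not_not, T, not_and] at hcon
    apply hz
    rw [found_succ]
    exact hcon.1.snoc (hb ℓ h) (hcon.2 hcon.1)

/-! ### Start vectors -/

/-- The density is at most `1/2` and the interval has length `2s`. -/
theorem gaussianReal_abs_lt_le (s : ℝ) :
    gaussianReal 0 1 {t | |t| < s} ≤ ENNReal.ofReal s := by
  have hset : {t : ℝ | |t| < s} = Set.Ioo (-s) s := by
    ext t; simp [abs_lt]
  have hpdf : ∀ t, gaussianPDF 0 1 t ≤ ENNReal.ofReal (1 / 2) := by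
    intro t
    rw [gaussianPDF]
    apply ENNReal.ofReal_le_ofReal
    rw [gaussianPDFReal]
    have h1 : (2 : ℝ) ≤ √(2 * Real.pi * (1 : NNReal)) := by
      apply Real.le_sqrt_of_sq_le
      have := Real.pi_gt_three
      norm_num
      linarith
    have h2 : Real.exp (-(t - 0) ^ 2 / (2 * ((1 : NNReal) : ℝ))) ≤ 1 := by
      apply Real.exp_le_one_iff.2
      apply div_nonpos_of_nonpos_of_nonneg
      · nlinarith [sq_nonneg (t - 0)]
      · positivity
    calc _ ≤ (2 : ℝ)⁻¹ * 1 := by gcongr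
      _ = _ := by norm_num
  rw [hset, gaussianReal_of_var_ne_zero 0 one_ne_zero, withDensity_apply _ measurableSet_Ioo]
  refine (lintegral_mono fun t => hpdf t).trans ?_
  rw [lintegral_const, Measure.restrict_apply_univ, Real.volume_Ioo, ← ENNReal.ofReal_mul
    (by norm_num)]
  apply ENNReal.ofReal_le_ofReal
  linarith

theorem integral_dot_self (n : ℕ) : ∫ g : Fin n → ℝ, g ⬝ᵥ g ∂gauss n = n := by
  have h : ∀ i : Fin n, ∫ g : Fin n → ℝ, g i * g i ∂gauss n = 1 := by
    intro i
    have := integral_dot_sq (Pi.single i (1 : ℝ) : Fin n → ℝ)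
    simpa [sq] using this
  have hi : ∀ i : Fin n, Integrable (fun g : Fin n → ℝ => g i * g i) (gauss n) := by
    intro i
    have := integrable_dot_mul_dot (Pi.single i (1 : ℝ) : Fin n → ℝ) (Pi.single i (1 : ℝ))
    simpa using this
  simp only [dotProduct]
  rw [integral_finsetSum _ fun i _ => hi i]
  simp [h]

theorem integrable_dot_self (n : ℕ) : Integrable (fun g : Fin n → ℝ => g ⬝ᵥ g) (gauss n) := by
  simp only [dotProduct]
  refine integrable_finsetSum _ fun i _ => ?_
  have := integrable_dot_mul_dot (Pi.single i (1 : ℝ) : Fin n → ℝ) (Pi.single i (1 : ℝ))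
  simpa using this

theorem gauss_lt_len_le {n : ℕ} {L : ℝ} (hL : 0 < L) :
    gauss n {g | L < len g} ≤ ENNReal.ofReal (n / L ^ 2) := by
  have h1 := mul_meas_ge_le_integral_of_nonneg (μ := gauss n)
    (ae_of_all _ fun g => dot_self_nonneg g) (integrable_dot_self n) (L ^ 2)
  rw [integral_dot_self] at h1
  have h2 : gauss n {g | L < len g} ≤ gauss n {g | L ^ 2 ≤ g ⬝ᵥ g} := by
    refine measure_mono fun g hg => ?_
    simp only [Set.mem_ofPred_eq] at hg ⊢
    rw [← len_sq]
    exact pow_le_pow_left₀ hL.le hg.le 2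
  refine h2.trans ?_
  rw [ENNReal.le_ofReal_iff_toReal_le (measure_ne_top _ _) (by positivity), le_div_iff₀ (by positivity),
    mul_comm]
  exact h1

/-- A small overlap is unlikely because `q ⬝ᵥ g` has bounded density, a long vector by Markov's
inequality and `E|g|² = n`. -/
theorem gauss_bad_start_le {n : ℕ} {q : Fin n → ℝ} (hq : q ⬝ᵥ q = 1) {s L : ℝ} (hs : 0 ≤ s)
    (hL : 0 < L) : gauss n {g | ¬ (s ≤ |q ⬝ᵥ g| ∧ len g ≤ L)} ≤
      ENNReal.ofReal (s + n / L ^ 2) := by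
  rw [ENNReal.ofReal_add hs (by positivity)]
  have h1 : gauss n {g | |q ⬝ᵥ g| < s} ≤ ENNReal.ofReal s := by
    have h := (measurePreserving_dotProduct q hq).measure_preimage
      (s := {t : ℝ | |t| < s}) (measurableSet_lt (by fun_prop) (by fun_prop)).nullMeasurableSet
    exact h.trans_le (gaussianReal_abs_lt_le s)
  refine (measure_mono ?_).trans ((measure_union_le _ _).trans
    (add_le_add h1 (gauss_lt_len_le (n := n) hL)))
  intro g hg
  simp only [Set.mem_ofPred_eq, not_and_or, not_le] at hg
  exact hg

/-- `G` need not be measurable, so its complement is replaced by a measurable hull. -/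
theorem measure_prod_le_of_forall_mem {X Y : Type*} [MeasurableSpace X] [MeasurableSpace Y]
    (μ : Measure X) (ν : Measure Y) [IsProbabilityMeasure μ] [IsProbabilityMeasure ν]
    {T : Set (X × Y)} (hT : MeasurableSet T) (G : Set X) {c : ENNReal}
    (h : ∀ x ∈ G, ν {y | (x, y) ∈ T} ≤ c) : (μ.prod ν) T ≤ μ Gᶜ + c := by
  rw [Measure.prod_apply hT, ← measure_toMeasurable Gᶜ]
  have hm := measurableSet_toMeasurable μ Gᶜ
  calc ∫⁻ x, ν (Prod.mk x ⁻¹' T) ∂μ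
      ≤ ∫⁻ x, ((toMeasurable μ Gᶜ).indicator 1 x + c) ∂μ := by
        refine lintegral_mono fun x => ?_
        by_cases hx : x ∈ toMeasurable μ Gᶜ
        · rw [Set.indicator_of_mem hx]
          exact prob_le_one.trans le_self_add
        · rw [Set.indicator_of_notMem hx, zero_add]
          refine h x ?_
          by_contra hxG
          exact hx (subset_toMeasurable μ _ hxG)
    _ = _ := by
      rw [lintegral_add_right _ measurable_const, lintegral_indicator_one hm, lintegral_const,
        measure_univ, mul_one]

/-! ### The error sequence -/

/-- The ratio of the deviation of the empirical matrices to the accuracy. -/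
noncomputable def devRatio (r : ℕ) (lam : ℝ) : ℝ := lam / (4 * r * leakConst r * growth r lam ^ r)

theorem one_le_growth (r : ℕ) {lam : ℝ} (h : 0 < lam) : 1 ≤ growth r lam := by
  have := one_le_leakConst r
  have : 0 ≤ 4 * leakConst r / lam := by positivity
  unfold growth; linarith

section
variable {r : ℕ} {lam ε : ℝ}

theorem devRatio_pos (hr : 1 ≤ r) (h : 0 < lam) : 0 < devRatio r lam := by
  have h1 := one_le_leakConst r
  have h2 := one_le_growth r h
  have h3 : (1 : ℝ) ≤ r := by exact_mod_cast hr
  unfold devRatio; positivity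

/-- `devRatio` is defined to make this hold: even after all rounds of growth the leak stays below
`lam / 2` and the error below `ε / (4r)`. -/
theorem leak_growth_le (hr : 1 ≤ r) (h : 0 < lam) (hε0 : 0 < ε) {ℓ : ℕ} (hℓ : ℓ ≤ r) :
    leakConst r * (growth r lam ^ ℓ * (devRatio r lam * ε)) ≤ lam * ε / (4 * r) := by
  have h1 := one_le_leakConst r
  have h2 := one_le_growth r h
  have h3 : (1 : ℝ) ≤ r := by exact_mod_cast hr
  have h4 : growth r lam ^ ℓ ≤ growth r lam ^ r := pow_le_pow_right₀ h2 hℓ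
  have hd := devRatio_pos hr h
  calc _ ≤ leakConst r * (growth r lam ^ r * (devRatio r lam * ε)) := by gcongr
    _ = _ := by unfold devRatio; field_simp

end

/-! ### Sample size -/

/-- The constant in the sample size of one batch. -/
noncomputable def batchConst (r : ℕ) (lam : ℝ) : ℝ :=
  4 + 36864 * bernsteinConst / devRatio r lam ^ 2 + 400 / lam + 80 / (lam * devRatio r lam)

section
variable {r n m N : ℕ} {lam ε δ : ℝ}

/-- The restriction `δ ≤ r / 2` keeps the logarithm away from zero, so that `n * log (r / δ)` can
absorb constants and multiples of `n`. -/
theorem half_le_log (hδ0 : 0 < δ) (hδr : δ ≤ (r : ℝ) / 2) : 1 / 2 ≤ Real.log (r / δ) := by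
  have h1 : (2 : ℝ) ≤ r / δ := by rw [le_div_iff₀ hδ0]; linarith
  have h2 := Real.log_le_log (by norm_num) h1
  have := Real.log_two_gt_d9
  linarith

/-- The four summands serve, in order, the rounding of batch sizes, the deviation probability, the
warm-up and the decay of the power iteration. -/
theorem batchConst_facts (hr : 1 ≤ r) (hlam : 0 < lam) : 4 ≤ batchConst r lam ∧
    36864 * bernsteinConst / devRatio r lam ^ 2 ≤ batchConst r lam ∧ 400 / lam ≤ batchConst r lam ∧
    80 / (lam * devRatio r lam) ≤ batchConst r lam := by
  have h1 := devRatio_pos hr hlam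
  have h2 := le_bernsteinConst
  have h3 : 0 ≤ 36864 * bernsteinConst / devRatio r lam ^ 2 := by
    apply div_nonneg <;> nlinarith
  have h4 : 0 ≤ 400 / lam := by positivity
  have h5 : 0 ≤ 80 / (lam * devRatio r lam) := by positivity
  unfold batchConst
  refine ⟨?_, ?_, ?_, ?_⟩ <;> linarith

/-- The factor `2` absorbs the rounding in `N / r`: with `Y` the required size, `2 Y < m + 1` and `Y
≥ 2` give `Y ≤ m`. -/
theorem le_batch_size (hr : 1 ≤ r) (hn : 1 ≤ n) (hlam : 0 < lam) (hε0 : 0 < ε) (hε : ε ≤ 1)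
    (hδ0 : 0 < δ) (hδr : δ ≤ (r : ℝ) / 2)
    (hN : 2 * r * batchConst r lam * n * Real.log (r / δ) / ε ^ 2 ≤ N) (hm : m = N / r) :
    batchConst r lam * (n * Real.log (r / δ)) / ε ^ 2 ≤ m := by
  have hr1 : (1 : ℝ) ≤ r := by exact_mod_cast hr
  have hn1 : (1 : ℝ) ≤ n := by exact_mod_cast hn
  have hΛ := half_le_log hδ0 hδr
  have hD := (batchConst_facts hr hlam).1
  have hX : 1 / 2 ≤ n * Real.log (r / δ) := by nlinarith
  have hX' : 2 ≤ batchConst r lam * (n * Real.log (r / δ)) := by nlinarith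
  have hε2 : 0 < ε ^ 2 := by positivity
  have hε2' : ε ^ 2 ≤ 1 := pow_le_one₀ hε0.le hε
  set Y := batchConst r lam * (n * Real.log (r / δ)) / ε ^ 2 with hY
  have hY2 : 2 ≤ Y := by rw [hY, le_div_iff₀ hε2]; nlinarith
  have hNY : 2 * r * Y ≤ N := by
    refine le_trans (le_of_eq ?_) hN
    rw [hY]; ring
  have hlt : (N : ℝ) < r * (m + 1) := by
    rw [hm]
    exact_mod_cast Nat.lt_mul_div_succ N (by omega)
  have h5 : 2 * Y < m + 1 := by
    have : r * (2 * Y) < r * ((m : ℝ) + 1) := by linarith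
    exact lt_of_mul_lt_mul_left this (by linarith)
  linarith

/-- As `36864 = 9 * 4 * 32²`, the exponent is at least `9 n log (r / δ)`. This covers `2n` for the
net, since `5 ≤ e²`, a further `2` for the constant, and `log (r / δ)` for the confidence. -/
theorem deviation_prob_le (hr : 1 ≤ r) (hn : 1 ≤ n) (hlam : 0 < lam) (hε0 : 0 < ε)
    (hδ0 : 0 < δ) (hδr : δ ≤ (r : ℝ) / 2)
    (hm : batchConst r lam * (n * Real.log (r / δ)) / ε ^ 2 ≤ m) :
    5 ^ n * (2 * Real.exp (-(m * (devRatio r lam * ε / 32) ^ 2 / (4 * bernsteinConst)))) ≤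
      δ / (2 * r) := by
  have hr1 : (1 : ℝ) ≤ r := by exact_mod_cast hr
  have hn1 : (1 : ℝ) ≤ n := by exact_mod_cast hn
  have hΛ := half_le_log hδ0 hδr
  have hB := le_bernsteinConst
  have hd := devRatio_pos hr hlam
  have hD := (batchConst_facts hr hlam).2.1
  have hX : 1 / 2 ≤ n * Real.log (r / δ) := by nlinarith
  have hE : 9 * (n * Real.log (r / δ)) ≤
      m * (devRatio r lam * ε / 32) ^ 2 / (4 * bernsteinConst) := by
    rw [le_div_iff₀ (by linarith)]
    rw [div_le_iff₀ (by positivity)] at hm hD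
    have h1 : 36864 * bernsteinConst * (n * Real.log (r / δ)) ≤
        batchConst r lam * devRatio r lam ^ 2 * (n * Real.log (r / δ)) := by gcongr
    have h2 : batchConst r lam * (n * Real.log (r / δ)) * devRatio r lam ^ 2 ≤
        m * ε ^ 2 * devRatio r lam ^ 2 := by gcongr
    nlinarith
  have hexp : Real.exp (-(m * (devRatio r lam * ε / 32) ^ 2 / (4 * bernsteinConst))) ≤
      Real.exp (-(2 * n + 2 + Real.log (r / δ))) := by
    apply Real.exp_le_exp.2
    nlinarith
  have h5 : (5 : ℝ) ^ n ≤ Real.exp (2 * n) := by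
    have : (5 : ℝ) ≤ Real.exp 2 := by
      have := Real.exp_one_gt_d9
      rw [show (2 : ℝ) = 1 + 1 by norm_num, Real.exp_add]; nlinarith
    rw [mul_comm, Real.exp_nat_mul]
    exact pow_le_pow_left₀ (by norm_num) this n
  have h4 : (4 : ℝ) ≤ Real.exp 2 := by
    have := Real.exp_one_gt_d9
    rw [show (2 : ℝ) = 1 + 1 by norm_num, Real.exp_add]; nlinarith
  have hlog : Real.exp (-(2 * n + 2 + Real.log (r / δ))) =
      (Real.exp (2 * n))⁻¹ * (Real.exp 2)⁻¹ * (δ / r) := by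
    rw [Real.exp_neg, Real.exp_add, Real.exp_add, Real.exp_log (by positivity), mul_inv, mul_inv,
      inv_div]
  calc _ ≤ Real.exp (2 * n) * (2 * ((Real.exp (2 * n))⁻¹ * (Real.exp 2)⁻¹ * (δ / r))) := by
        rw [← hlog]; gcongr
    _ = 2 * (Real.exp 2)⁻¹ * (δ / r) := by
        field_simp
    _ ≤ 2 * 4⁻¹ * (δ / r) := by gcongr
    _ = _ := by ring

theorem power_ratio_le (hlam : 0 < lam) (hlam1 : lam ≤ 1) :
    (2 + lam / 4) / (2 + lam / 2) ≤ Real.exp (-(lam / 10)) ∧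
      2 / (2 + lam / 4) ≤ Real.exp (-(lam / 10)) := by
  have h := Real.add_one_le_exp (-(lam / 10))
  constructor
  · refine le_trans ?_ h
    rw [div_le_iff₀ (by positivity)]; nlinarith
  · refine le_trans ?_ h
    rw [div_le_iff₀ (by positivity)]; nlinarith

/-- The `m` power steps are split into `m / 2` for the warm-up and `m - m / 2` for the decay. Since
`m ≥ 2`, rounding down still leaves a quarter of `m`. -/
theorem le_power_exponent (hr : 1 ≤ r) (hn : 1 ≤ n) (hlam : 0 < lam) (hε0 : 0 < ε) (hε : ε ≤ 1)
    (hδ0 : 0 < δ) (hδr : δ ≤ (r : ℝ) / 2)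
    (hm : batchConst r lam * (n * Real.log (r / δ)) / ε ^ 2 ≤ m) :
    batchConst r lam * (n * Real.log (r / δ)) / ε ^ 2 ≤ 4 * (m / 2 : ℕ) := by
  have hn1 : (1 : ℝ) ≤ n := by exact_mod_cast hn
  have hΛ := half_le_log hδ0 hδr
  have hX : 1 / 2 ≤ n * Real.log (r / δ) := by nlinarith
  have hD := (batchConst_facts hr hlam).1
  have h2 : (2 : ℝ) ≤ m := by
    refine le_trans ?_ hm
    rw [le_div_iff₀ (by positivity)]
    have : ε ^ 2 ≤ 1 := pow_le_one₀ hε0.le hε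
    nlinarith
  have h3 : 2 ≤ m := by exact_mod_cast h2
  have h4 : m ≤ 4 * (m / 2) := by omega
  refine hm.trans ?_
  exact_mod_cast h4

/-- The ratio of length to overlap of a typical start is at most `16 n (r / δ)²`, below `exp (3 + n
+ 2 log (r / δ))`. Each step gains at least the factor `exp (lam / 10)`, so the number of steps
required is of order `n log (r / δ) / lam`, which the batch size provides. -/
theorem power_warmup_lt (hr : 1 ≤ r) (hn : 1 ≤ n) (hlam : 0 < lam) (hlam1 : lam ≤ 1) (hε0 : 0 < ε)
    (hε : ε ≤ 1) (hδ0 : 0 < δ) (hδ1 : δ < 1) (hδr : δ ≤ (r : ℝ) / 2)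
    (hm : batchConst r lam * (n * Real.log (r / δ)) / ε ^ 2 ≤ m) :
    √(4 * r * n / δ) / (δ / (4 * r)) * (2 + lam / 4) ^ (m / 2) < (2 + lam / 2) ^ (m / 2) := by
  have hr1 : (1 : ℝ) ≤ r := by exact_mod_cast hr
  have hn1 : (1 : ℝ) ≤ n := by exact_mod_cast hn
  have hΛ := half_le_log hδ0 hδr
  have hX : 1 / 2 ≤ n * Real.log (r / δ) := by nlinarith
  have hD := (batchConst_facts hr hlam).2.2.1
  have hm' := le_power_exponent hr hn hlam hε0 hε hδ0 hδr hm
  set k := m / 2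
  have hε2 : ε ^ 2 ≤ 1 := pow_le_one₀ hε0.le hε
  have hk : 3 + n + 2 * Real.log (r / δ) ≤ k * (lam / 10) := by
    rw [div_le_iff₀ (by positivity)] at hm' hD
    have h1 : 4 * (k : ℝ) * ε ^ 2 ≤ 4 * k * 1 := by gcongr
    have h2 : 400 * (n * Real.log (r / δ)) ≤ batchConst r lam * lam * (n * Real.log (r / δ)) := by
      gcongr
    have h3 : lam * (batchConst r lam * (n * Real.log (r / δ))) ≤ lam * (4 * k * 1) :=
      mul_le_mul_of_nonneg_left (hm'.trans h1) hlam.le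
    nlinarith
  have hsq : √(4 * r * n / δ) ≤ 4 * r * n / δ := by
    rw [Real.sqrt_le_left (by positivity)]
    have : 1 ≤ 4 * r * n / δ := by
      rw [le_div_iff₀ hδ0]; nlinarith
    nlinarith
  have hR : √(4 * r * n / δ) / (δ / (4 * r)) < Real.exp (3 + n + 2 * Real.log (r / δ)) := by
    have h16 : (16 : ℝ) < Real.exp 3 := by
      have := Real.exp_one_gt_d9
      rw [show (3 : ℝ) = 1 + 1 + 1 by norm_num, Real.exp_add, Real.exp_add]
      have h2 : (7 : ℝ) < Real.exp 1 * Real.exp 1 := by nlinarith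
      nlinarith
    have hne : (n : ℝ) ≤ Real.exp n := by linarith [Real.add_one_le_exp (n : ℝ)]
    rw [Real.exp_add, Real.exp_add, two_mul, Real.exp_add, Real.exp_log (by positivity)]
    calc √(4 * r * n / δ) / (δ / (4 * r)) ≤ 4 * r * n / δ / (δ / (4 * r)) := by gcongr
      _ = 16 * n * (r / δ * (r / δ)) := by field_simp; norm_num
      _ < Real.exp 3 * Real.exp n * (r / δ * (r / δ)) := by
        have : 0 < r / δ * (r / δ) := by positivity
        refine mul_lt_mul_of_pos_right ?_ this
        exact mul_lt_mul h16 hne (by linarith) (by positivity)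
  have hpow : ((2 + lam / 4) / (2 + lam / 2)) ^ k ≤ Real.exp (-(k * (lam / 10))) := by
    rw [← mul_neg, Real.exp_nat_mul]
    exact pow_le_pow_left₀ (by positivity) (power_ratio_le hlam hlam1).1 k
  have hb : 0 < (2 + lam / 2) ^ k := by positivity
  rw [div_pow, div_le_iff₀ hb] at hpow
  have hR0 : 0 ≤ √(4 * r * n / δ) / (δ / (4 * r)) := by positivity
  calc _ ≤ √(4 * r * n / δ) / (δ / (4 * r)) * (Real.exp (-(k * (lam / 10))) * (2 + lam / 2) ^ k) :=
        mul_le_mul_of_nonneg_left hpow hR0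
    _ < Real.exp (k * (lam / 10)) * (Real.exp (-(k * (lam / 10))) * (2 + lam / 2) ^ k) :=
        mul_lt_mul_of_pos_right (hR.trans_le (Real.exp_le_exp.2 hk)) (by positivity)
    _ = _ := by rw [← mul_assoc, ← Real.exp_add, add_neg_cancel, Real.exp_zero, one_mul]

/-- The crude bound `exp (-x) ≤ 1 / x` suffices, because the number of steps already exceeds a
multiple of `1 / (lam * devRatio r lam * ε)`. -/
theorem power_decay_le (hr : 1 ≤ r) (hn : 1 ≤ n) (hlam : 0 < lam) (hlam1 : lam ≤ 1) (hε0 : 0 < ε)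
    (hε : ε ≤ 1) (hδ0 : 0 < δ) (hδr : δ ≤ (r : ℝ) / 2)
    (hm : batchConst r lam * (n * Real.log (r / δ)) / ε ^ 2 ≤ m) :
    (2 / (2 + lam / 4)) ^ (m - m / 2) ≤ devRatio r lam * ε := by
  have hn1 : (1 : ℝ) ≤ n := by exact_mod_cast hn
  have hΛ := half_le_log hδ0 hδr
  have hX : 1 / 2 ≤ n * Real.log (r / δ) := by nlinarith
  have hd := devRatio_pos hr hlam
  have hD := (batchConst_facts hr hlam).2.2.2
  have hD0 := (batchConst_facts hr hlam).1
  have hm' := le_power_exponent hr hn hlam hε0 hε hδ0 hδr hm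
  have hi : m / 2 ≤ m - m / 2 := by omega
  set k := m / 2
  have hratio := (power_ratio_le hlam hlam1).2
  have hbase : 2 / (2 + lam / 4) ≤ 1 := by rw [div_le_one (by positivity)]; linarith
  have hpow : (2 / (2 + lam / 4)) ^ (m - k) ≤ Real.exp (-(k * (lam / 10))) := by
    refine (pow_le_pow_of_le_one (by positivity) hbase hi).trans ?_
    rw [← mul_neg, Real.exp_nat_mul]
    exact pow_le_pow_left₀ (by positivity) hratio k
  have hy : (devRatio r lam * ε)⁻¹ ≤ k * (lam / 10) := by
    rw [div_le_iff₀ (by positivity)] at hm' hD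
    rw [inv_le_iff_one_le_mul₀ (by positivity)]
    have h0 : 0 ≤ lam * devRatio r lam := by positivity
    have h1 : batchConst r lam * (1 / 2) ≤ batchConst r lam * (n * Real.log (r / δ)) := by gcongr
    have h2 : 4 * (k : ℝ) * ε ^ 2 ≤ 4 * k * ε := by
      have : ε ^ 2 ≤ ε := by nlinarith
      gcongr
    have h3 := mul_le_mul_of_nonneg_right (h1.trans (hm'.trans h2)) h0
    nlinarith
  refine hpow.trans ?_
  rw [Real.exp_neg, inv_le_comm₀ (Real.exp_pos _) (by positivity)]
  linarith [Real.add_one_le_exp (k * (lam / 10))]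

end

/-! ### Success probability of one round -/

section
variable {n r m : ℕ} {τ lam ε δ : ℝ} {U : Matrix (Fin n) (Fin r) ℝ} {H : (Fin r → ℝ) → ℝ}

/-- The admissible error after `ℓ` rounds. -/
noncomputable def errBound (r : ℕ) (lam ε : ℝ) (ℓ : ℕ) : ℝ :=
  growth r lam ^ ℓ * (devRatio r lam * ε)

theorem errBound_succ (r : ℕ) (lam ε : ℝ) (ℓ : ℕ) :
    errBound r lam ε (ℓ + 1) = growth r lam * errBound r lam ε ℓ := by
  unfold errBound; ring

theorem errBound_le_succ (hr : 1 ≤ r) (hlam0 : 0 < lam) (hε0 : 0 < ε) (ℓ : ℕ) :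
    errBound r lam ε ℓ ≤ errBound r lam ε (ℓ + 1) := by
  have h1 := one_le_growth r hlam0
  have h2 := devRatio_pos hr hlam0
  have : 0 ≤ errBound r lam ε ℓ := by unfold errBound; positivity
  rw [errBound_succ]
  nlinarith

theorem errBound_facts (hr : 1 ≤ r) (hlam0 : 0 < lam) (hlam1 : lam ≤ 1) (hε0 : 0 < ε) (hε : ε ≤ 1)
    {ℓ : ℕ} (hℓ : ℓ ≤ r) : 0 ≤ errBound r lam ε ℓ ∧ devRatio r lam * ε ≤ errBound r lam ε ℓ ∧
      leakConst r * errBound r lam ε ℓ ≤ lam / 2 ∧ errBound r lam ε ℓ ≤ ε / (4 * r) ∧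
      errBound r lam ε ℓ ≤ 1 := by
  have hr1 : (1 : ℝ) ≤ r := by exact_mod_cast hr
  have h1 := one_le_growth r hlam0
  have h2 := devRatio_pos hr hlam0
  have h3 := one_le_leakConst r
  have h4 := leak_growth_le hr hlam0 hε0 hℓ
  have h0 : 0 ≤ errBound r lam ε ℓ := by unfold errBound; positivity
  rw [← errBound] at h4
  have h5 : lam * ε / (4 * r) ≤ lam / 2 := by
    rw [div_le_div_iff₀ (by positivity) (by norm_num)]; nlinarith [mul_pos hlam0 hε0]
  have h6 : lam * ε / (4 * r) ≤ ε / (4 * r) := by gcongr; nlinarith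
  have h7 : ε / (4 * r) ≤ 1 := by rw [div_le_one (by positivity)]; linarith
  have h8 : errBound r lam ε ℓ ≤ leakConst r * errBound r lam ε ℓ := by nlinarith
  refine ⟨h0, ?_, h4.trans h5, by linarith, by linarith⟩
  unfold errBound
  nlinarith [one_le_pow₀ h1 (n := ℓ), mul_pos h2 hε0]

theorem exists_good_batches (hr : 1 ≤ r) (hn : 1 ≤ n) (hlam0 : 0 < lam) (hlam1 : lam ≤ 1)
    (hε0 : 0 < ε) (hε : ε ≤ 1) (hδ0 : 0 < δ) (hδr : δ ≤ (r : ℝ) / 2)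
    (hm : batchConst r lam * (n * Real.log (r / δ)) / ε ^ 2 ≤ m) {w : (Fin n → ℝ) → ℝ}
    (hw : IsWeight w) :
    ∃ G : Set (Fin m → Fin n → ℝ),
      (Measure.pi fun _ : Fin m => gauss n) Gᶜ ≤ ENNReal.ofReal (δ / (2 * r)) ∧
      ∀ x ∈ G, ∀ a b, |a ⬝ᵥ (empMat w x - wMat w) *ᵥ b| ≤ devRatio r lam * ε * (len a * len b) := by
  obtain ⟨-, h1, -, -, h2⟩ := errBound_facts hr hlam0 hlam1 hε0 hε (Nat.zero_le r)
  have hd := devRatio_pos hr hlam0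
  have hm0 : 0 < m := by
    have hn1 : (1 : ℝ) ≤ n := by exact_mod_cast hn
    have hΛ := half_le_log hδ0 hδr
    have hD := (batchConst_facts hr hlam0).1
    have : (0 : ℝ) < m := lt_of_lt_of_le (by positivity) hm
    exact_mod_cast this
  obtain ⟨G, hG, hdev⟩ := measure_empMat_deviation_le hm0 hw (mul_pos hd hε0) (h1.trans h2)
  refine ⟨G, ?_, hdev⟩
  rw [← ofReal_measureReal]
  exact ENNReal.ofReal_le_ofReal (hG.trans (deviation_prob_le hr hn hlam0 hε0 hδ0 hδr hm))

theorem measurableSet_not_extends_next {ℓ : ℕ} {b : ℝ} {F : (Fin n → ℝ) → ℝ}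
    {eig : (Fin n → ℝ) → Matrix (Fin n) (Fin n) ℝ → Timed (Fin n → ℝ)}
    (hF : Measurable F) (he : IsMeasurableEig eig) (V : Fin ℓ → Fin n → ℝ) :
    MeasurableSet {z : (Fin m → Fin n → ℝ) × (Fin n → ℝ) |
      ¬ Extends U V b (next τ eig F V z)} := by
  have h : Measurable fun z : (Fin m → Fin n → ℝ) × (Fin n → ℝ) => (V, next τ eig F V z) :=
    measurable_const.prodMk (Measurable.comp
      (g := fun p : (Fin ℓ → Fin n → ℝ) × ((Fin m → Fin n → ℝ) × (Fin n → ℝ)) =>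
        next τ eig F p.1 p.2) (f := fun z : (Fin m → Fin n → ℝ) × (Fin n → ℝ) => (V, z))
      (measurable_next hF he) (measurable_const.prodMk measurable_id))
  exact (h (measurableSet_extends b)).compl

theorem batchLaw_not_extends_exact_le (hU : Uᵀ * U = 1) (hH : Measurable H)
    (hgap : HasGap τ lam H) (hn : 1 ≤ n) (hlam0 : 0 < lam) (hlam1 : lam ≤ 1)
    (hε0 : 0 < ε) (hε : ε ≤ 1) (hδ0 : 0 < δ) (hδr : δ ≤ (r : ℝ) / 2)
    (hm : batchConst r lam * (n * Real.log (r / δ)) / ε ^ 2 ≤ m)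
    {eig : (Fin n → ℝ) → Matrix (Fin n) (Fin n) ℝ → Timed (Fin n → ℝ)} (he : IsExactEig eig)
    {ℓ : ℕ} (hℓ : ℓ < r) {V : Fin ℓ → Fin n → ℝ} (hV : IsClose U (errBound r lam ε ℓ) V) :
    batchLaw n m {z | ¬ Extends U V (errBound r lam ε (ℓ + 1))
      (next τ eig (fun x => H (Uᵀ *ᵥ x)) V z)} ≤ ENNReal.ofReal (δ / r) := by
  have hr : 1 ≤ r := (Nat.zero_le ℓ).trans_lt hℓ
  have hF : Measurable fun x : Fin n → ℝ => H (Uᵀ *ᵥ x) := hH.comp (measurable_mulVec_left _)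
  obtain ⟨e0, e1, e2, -, -⟩ := errBound_facts hr hlam0 hlam1 hε0 hε hℓ.le
  obtain ⟨G, hG, hdev⟩ := exists_good_batches hr hn hlam0 hlam1 hε0 hε hδ0 hδr hm
    (isWeight_trim_comp τ V hH U)
  refine (measure_prod_le_of_forall_mem _ _ (measurableSet_not_extends_next hF he.1 V) G
    (c := 0) fun x hx => ?_).trans ?_
  · refine (measure_mono (t := ∅) ?_).trans measure_empty.le
    intro g hg
    refine (hg : ¬ Extends U V _ (next τ eig (fun x => H (Uᵀ *ᵥ x)) V (x, g))) ?_
    rw [errBound_succ]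
    have hSt := empMat_transpose (trim τ V fun x => H (Uᵀ *ᵥ x)) x
    exact extends_of_isTopEigenvector hU hH hgap hℓ hV e0 e1 hlam0 hlam1 e2 hSt (hdev x hx)
      (he.2 _ _ (projected_transpose hSt))
  · rw [add_zero]
    refine hG.trans (ENNReal.ofReal_le_ofReal ?_)
    have hr1 : (1 : ℝ) ≤ r := by exact_mod_cast hr
    gcongr
    linarith

theorem batchLaw_not_extends_power_le (hU : Uᵀ * U = 1) (hH : Measurable H)
    (hgap : HasGap τ lam H) (hn : 1 ≤ n) (hlam0 : 0 < lam) (hlam1 : lam ≤ 1)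
    (hε0 : 0 < ε) (hε : ε ≤ 1) (hδ0 : 0 < δ) (hδ1 : δ < 1) (hδr : δ ≤ (r : ℝ) / 2)
    (hm : batchConst r lam * (n * Real.log (r / δ)) / ε ^ 2 ≤ m)
    {ℓ : ℕ} (hℓ : ℓ < r) {V : Fin ℓ → Fin n → ℝ} (hV : IsClose U (errBound r lam ε ℓ) V) :
    batchLaw n m {z | ¬ Extends U V (errBound r lam ε (ℓ + 1))
      (next τ (powerIteration m) (fun x => H (Uᵀ *ᵥ x)) V z)} ≤ ENNReal.ofReal (δ / r) := by
  have hr : 1 ≤ r := (Nat.zero_le ℓ).trans_lt hℓ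
  have hr1 : (1 : ℝ) ≤ r := by exact_mod_cast hr
  have hn1 : (1 : ℝ) ≤ n := by exact_mod_cast hn
  have hF : Measurable fun x : Fin n → ℝ => H (Uᵀ *ᵥ x) := hH.comp (measurable_mulVec_left _)
  obtain ⟨e0, e1, e2, -, -⟩ := errBound_facts hr hlam0 hlam1 hε0 hε hℓ.le
  obtain ⟨G, hG, hdev⟩ := exists_good_batches hr hn hlam0 hlam1 hε0 hε hδ0 hδr hm
    (isWeight_trim_comp τ V hH U)
  -- The budget `δ / r` of a round is split into `δ / (2r)` for the batch, `δ / (4r)` for a small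
  -- overlap, and `n / L² = δ / (4r)` for a long start vector, where `L² = 4 r n / δ`.
  have hs : 0 < δ / (4 * r) := by positivity
  have hL : 0 < √(4 * r * n / δ) := Real.sqrt_pos.2 (by positivity)
  refine (measure_prod_le_of_forall_mem _ _
    (measurableSet_not_extends_next hF (isMeasurableEig_powerIteration m) V) G
    (c := ENNReal.ofReal (δ / (2 * r))) fun x hx => ?_).trans ?_
  · obtain ⟨q, hq, hext⟩ := extends_of_powerIteration hU hH hgap hℓ hV e0 e1 hlam0 hlam1 e2
      (empMat_transpose _ x) (hdev x hx) hs
      (power_warmup_lt hr hn hlam0 hlam1 hε0 hε hδ0 hδ1 hδr hm)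
      ((power_decay_le hr hn hlam0 hlam1 hε0 hε hδ0 hδr hm).trans e1)
    refine (measure_mono (t := {g | ¬ (δ / (4 * r) ≤ |q ⬝ᵥ g| ∧ len g ≤ √(4 * r * n / δ))})
      ?_).trans ((gauss_bad_start_le hq hs.le hL).trans_eq ?_)
    · intro g hg hgood
      refine (hg : ¬ Extends U V _
        (next τ (powerIteration m) (fun x => H (Uᵀ *ᵥ x)) V (x, g))) ?_
      have h := hext g (powSeq (projected V (empMat (trim τ V fun x => H (Uᵀ *ᵥ x)) x))
        (projMat V *ᵥ g)) hgood.1 hgood.2 rfl fun k => rfl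
      rw [Nat.add_sub_cancel' (Nat.div_le_self m 2), ← powerIteration_val, ← errBound_succ] at h
      exact h
    · congr 1
      rw [Real.sq_sqrt (by positivity)]
      field_simp
      norm_num
  · refine (add_le_add_left hG _).trans ?_
    rw [← ENNReal.ofReal_add (by positivity) (by positivity)]
    apply ENNReal.ofReal_le_ofReal
    apply le_of_eq
    field_simp
    norm_num

end

/-! ### Success probability of the algorithm -/

theorem succeeds_of_isClose {n r : ℕ} {U : Matrix (Fin n) (Fin r) ℝ} (hU : Uᵀ * U = 1)
    (hr : 1 ≤ r) {ε b : ℝ} (hε0 : 0 < ε) (hε : ε ≤ 1) (hb : b ≤ ε / (4 * r))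
    {V : Fin r → Fin n → ℝ} (hV : IsClose U b V) : Succeeds ε U V := by
  refine ⟨hV.1, procrustes_le hU hV.1 hε hε0.le fun j => ?_⟩
  have hr1 : (1 : ℝ) ≤ r := by exact_mod_cast hr
  have h := pow_le_pow_left₀ (len_nonneg _) ((hV.2 j).trans hb) 2
  refine h.trans ?_
  rw [div_pow]
  gcongr
  nlinarith

/-- Regrouping: the input keeps samples and start vectors in separate arrays, while the argument by
rounds needs one independent pair per round. -/
theorem measurePreserving_inputLaw (n r m : ℕ) :
    MeasurePreserving (MeasurableEquiv.arrowProdEquivProdArrow (Fin m → Fin n → ℝ) (Fin n → ℝ)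
      (Fin r)) (Measure.pi fun _ => batchLaw n m) (inputLaw n r m) :=
  measurePreserving_arrowProdEquivProdArrow _ _ _ _ _

theorem inputLaw_not_succeeds_le {n r m : ℕ} {τ lam ε δ : ℝ} {U : Matrix (Fin n) (Fin r) ℝ}
    (hU : Uᵀ * U = 1) (hr : 1 ≤ r) (hlam0 : 0 < lam) (hlam1 : lam ≤ 1) (hε0 : 0 < ε) (hε : ε ≤ 1)
    {eig : (Fin n → ℝ) → Matrix (Fin n) (Fin n) ℝ → Timed (Fin n → ℝ)}
    (he : IsMeasurableEig eig) (P : MvPolynomial (Fin n) ℝ)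
    (hc : ∀ ℓ < r, ∀ V : Fin ℓ → Fin n → ℝ, IsClose U (errBound r lam ε ℓ) V →
      batchLaw n m {z | ¬ Extends U V (errBound r lam ε (ℓ + 1))
        (next τ eig (fun x => MvPolynomial.eval x P) V z)} ≤ ENNReal.ofReal (δ / r)) :
    inputLaw n r m {ω | ¬ Succeeds ε U (runOn τ eig P ω).val} ≤ ENNReal.ofReal δ := by
  have hr1 : (0 : ℝ) < r := by exact_mod_cast hr
  rw [← (measurePreserving_inputLaw n r m).measure_preimage_equiv]
  have h := measure_not_isClose_found_le (measurable_eval P) he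
    (fun ℓ _ => errBound_le_succ hr hlam0 hε0 ℓ) hc r le_rfl
  refine (measure_mono ?_).trans (h.trans_eq ?_)
  · intro z hz hclose
    exact hz (succeeds_of_isClose hU hr hε0 hε
      (errBound_facts hr hlam0 hlam1 hε0 hε le_rfl).2.2.2.1 hclose)
  · rw [← ENNReal.ofReal_natCast, ← ENNReal.ofReal_mul hr1.le, mul_div_cancel₀ _ hr1.ne']

/-! ### Running time -/

section Steps
variable {n m ℓ r : ℕ}

theorem dot_steps (v w : Fin n → ℝ) : (Timed.dot v w).steps = 2 * n := by
  change ∑ _i : Fin n, (1 + 1) = _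
  simp [mul_comm]

theorem matVec_steps (A : Matrix (Fin n) (Fin n) ℝ) (v : Fin n → ℝ) :
    (Timed.matVec A v).steps = n * (2 * n + 1) := by
  change ∑ i, ((Timed.dot (A i) v).steps + 1) = _
  simp [dot_steps]

theorem matMul_steps (A B : Matrix (Fin n) (Fin n) ℝ) :
    (Timed.matMul A B).steps = n * (n * (2 * n + 1) + 1) := by
  change ∑ _i : Fin n, (∑ _j : Fin n, (∑ _k : Fin n, (1 + 1) + 1) + 1) = _
  simp [mul_comm]

theorem keep_steps_le (τ : ℝ) (V : Fin ℓ → Fin n → ℝ) (x : Fin n → ℝ) (y : ℝ) :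
    (keep τ V x y).steps ≤ 2 + ℓ * (2 * n + 3) := by
  have h : ∀ j, (1 + (if |(Timed.dot (V j) x).val| ≤ 1 then (0 : ℕ) else 0)) = 1 := by
    intro j; split_ifs <;> rfl
  change 1 + (1 + if |y| ≤ τ then 0 else ∑ j, (((Timed.dot (V j) x).steps +
    (1 + (1 + if |(Timed.dot (V j) x).val| ≤ 1 then 0 else 0))) + 1)) ≤ _
  simp only [h, dot_steps, Finset.sum_const, Finset.card_univ, Fintype.card_fin, smul_eq_mul]
  split_ifs
  · omega
  · exact le_of_eq (by ring)

theorem secondMoment_steps_le (τ : ℝ) (V : Fin ℓ → Fin n → ℝ) (x : Fin m → Fin n → ℝ)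
    (y : Fin m → ℝ) : (secondMoment τ V x y).steps ≤
      m * (3 + ℓ * (2 * n + 3)) + n * (n * (4 * m + 2) + 1) := by
  change ∑ a, ((keep τ V (x a) (y a)).steps + 1) +
    ∑ _i : Fin n, (∑ _j : Fin n, ((∑ _a : Fin m, ((1 + (1 + 1)) + 1) + 1) + 1) + 1) ≤ _
  refine add_le_add ?_ (le_of_eq ?_)
  · refine (Finset.sum_le_sum fun a _ => add_le_add_left (keep_steps_le τ V (x a) (y a)) 1).trans
      (le_of_eq ?_)
    simp only [Finset.sum_const, Finset.card_univ, Fintype.card_fin, smul_eq_mul]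
    ring
  · simp only [Finset.sum_const, Finset.card_univ, Fintype.card_fin, smul_eq_mul]
    ring

theorem projPerp_steps (V : Fin ℓ → Fin n → ℝ) :
    (projPerp V).steps = n * (n * (2 * ℓ + 2) + 1) := by
  change ∑ _i : Fin n, (∑ _j : Fin n, ((∑ _k : Fin ℓ, (1 + 1) + 1) + 1) + 1) = _
  simp only [Finset.sum_const, Finset.card_univ, Fintype.card_fin, smul_eq_mul]
  ring

/-- The extra `n` on the left pays for storing the new vector in `rounds`. The condition `ℓ ≤ n`
turns the trimming cost `ℓ n m` into `n² m`, so the constant is absolute. -/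
theorem oneRound_steps_le (hn : 1 ≤ n) (hℓ : ℓ ≤ n) (τ : ℝ)
    (eig : (Fin n → ℝ) → Matrix (Fin n) (Fin n) ℝ → Timed (Fin n → ℝ)) {T : ℕ}
    (hT : ∀ g M, (eig g M).steps ≤ T) (V : Fin ℓ → Fin n → ℝ) (x : Fin m → Fin n → ℝ)
    (y : Fin m → ℝ) (g : Fin n → ℝ) :
    (oneRound τ eig V x y g).steps + n ≤ 20 * (n ^ 2 * m + n ^ 3) + T := by
  change (secondMoment τ V x y).steps + ((projPerp V).steps + ((Timed.matMul _ _).steps +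
    ((Timed.matMul _ _).steps + ((Timed.matVec _ _).steps + (eig _ _).steps)))) + n ≤ _
  rw [projPerp_steps, matMul_steps, matMul_steps, matVec_steps]
  have h1 := secondMoment_steps_le τ V x y
  have h2 : m * (3 + ℓ * (2 * n + 3)) ≤ m * (3 + n * (2 * n + 3)) := by gcongr
  have h3 : n * (n * (2 * ℓ + 2) + 1) ≤ n * (n * (2 * n + 2) + 1) := by gcongr
  have h4 : n ≤ n ^ 2 := Nat.le_self_pow (by norm_num) n
  have h5 : n ^ 2 ≤ n ^ 3 := Nat.pow_le_pow_right hn (by norm_num)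
  have h6 : m * 1 ≤ m * n ^ 2 := Nat.mul_le_mul_left m (hn.trans h4)
  have h7 : m * n ≤ m * n ^ 2 := Nat.mul_le_mul_left m h4
  have h8 := hT ((Timed.matVec (projPerp V).val g).val)
    ((Timed.matMul (Timed.matMul (projPerp V).val (secondMoment τ V x y).val).val
      (projPerp V).val).val)
  nlinarith

theorem rounds_steps_le (hn : 1 ≤ n) (hr : r ≤ n) (τ : ℝ)
    (eig : (Fin n → ℝ) → Matrix (Fin n) (Fin n) ℝ → Timed (Fin n → ℝ)) {T : ℕ}
    (hT : ∀ g M, (eig g M).steps ≤ T) (x : Fin r → Fin m → Fin n → ℝ) (y : Fin r → Fin m → ℝ)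
    (g : Fin r → Fin n → ℝ) (ℓ : ℕ) (h : ℓ ≤ r) :
    (rounds τ eig x y g ℓ h).steps ≤ ℓ * (20 * (n ^ 2 * m + n ^ 3) + T) := by
  induction ℓ with
  | zero => exact Nat.zero_le _
  | succ ℓ ih =>
    have h' := Nat.le_of_succ_le h
    change (rounds τ eig x y g ℓ h').steps + ((oneRound τ eig (rounds τ eig x y g ℓ h').val
      (x ⟨ℓ, h⟩) (y ⟨ℓ, h⟩) (g ⟨ℓ, h⟩)).steps + (∑ _i : Fin n, (0 + 1) + 0)) ≤ _
    have h1 := oneRound_steps_le hn (h'.trans hr) τ eig hT (rounds τ eig x y g ℓ h').val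
      (x ⟨ℓ, h⟩) (y ⟨ℓ, h⟩) (g ⟨ℓ, h⟩)
    have h2 : ∑ _i : Fin n, (0 + 1) + 0 = n := by simp
    rw [h2, Nat.succ_mul]
    exact add_le_add (ih h') h1

theorem powerIteration_steps_le (hn : 1 ≤ n) (k : ℕ) (g : Fin n → ℝ)
    (M : Matrix (Fin n) (Fin n) ℝ) :
    (powerIteration k g M).steps ≤ 8 * (n ^ 2 * k + n ^ 3) := by
  have hit : ∀ (A : Matrix (Fin n) (Fin n) ℝ) (k : ℕ),
      (Timed.iterate (Timed.matVec A) k g).steps = k * (n * (2 * n + 1)) := by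
    intro A k
    induction k with
    | zero => simp [Timed.iterate, pure]
    | succ k ih =>
      change (Timed.iterate (Timed.matVec A) k g).steps + (Timed.matVec A _).steps = _
      rw [ih, matVec_steps, Nat.add_one_mul k]
  change ∑ _i : Fin n, (∑ _j : Fin n, (1 + 1) + 1) + ((Timed.iterate (Timed.matVec _) k g).steps +
    ((Timed.dot _ _).steps + (1 + ∑ _i : Fin n, (1 + 1)))) ≤ _
  rw [hit, dot_steps]
  simp only [Finset.sum_const, Finset.card_univ, Fintype.card_fin, smul_eq_mul]
  have h4 : n ≤ n ^ 2 := Nat.le_self_pow (by norm_num) n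
  have h5 : n ^ 2 ≤ n ^ 3 := Nat.pow_le_pow_right hn (by norm_num)
  have h7 : k * n ≤ k * n ^ 2 := Nat.mul_le_mul_left k h4
  nlinarith

end Steps

theorem le_of_transpose_mul_self_eq_one {n r : ℕ} {U : Matrix (Fin n) (Fin r) ℝ}
    (hU : Uᵀ * U = 1) : r ≤ n := by
  have h1 : (Uᵀ * U).rank = r := by rw [hU, rank_one, Fintype.card_fin]
  have h2 := (rank_mul_le_right Uᵀ U).trans (rank_le_card_height U)
  rw [h1, Fintype.card_fin] at h2
  exact h2

end TrimPCA

/-! ### Assembly of the theorem. -/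

theorem mainTheorem2 :
    ∃ K : ℕ, ∀ (r d : ℕ) (α : ℝ), 1 ≤ r → 0 < α →
      ∃ C : ℝ, 0 < C ∧ ∃ τ : ℝ, 0 < τ ∧
        ∀ (n : ℕ) (P : MvPolynomial (Fin n) ℝ) (U : Matrix (Fin n) (Fin r) ℝ) (ε δ : ℝ) (N m : ℕ),
          TrimPCA.IsLowRank d α P U → 0 < ε → ε ≤ 1 → 0 < δ → δ < 1 → δ ≤ (r : ℝ) / 2 →
          C * n * Real.log (r / δ) / ε ^ 2 ≤ N → m = N / r →
          -- TrimmedPCA with an exact top-eigenvector subroutine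
          (∀ eig : (Fin n → ℝ) → Matrix (Fin n) (Fin n) ℝ → TrimPCA.Timed (Fin n → ℝ),
            TrimPCA.IsExactEig eig →
            TrimPCA.inputLaw n r m
                {ω | ¬ TrimPCA.Succeeds ε U (TrimPCA.runOn τ eig P ω).val} ≤ ENNReal.ofReal δ ∧
            ∀ T : ℕ, (∀ g M, (eig g M).steps ≤ T) →
              ∀ ω : (Fin r → Fin m → Fin n → ℝ) × (Fin r → Fin n → ℝ),
                (TrimPCA.runOn τ eig P ω).steps ≤ K * (r * (n ^ 2 * m + n ^ 3)) + r * T) ∧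
          -- TrimmedPCA with the eigenvectors computed numerically, all steps counted
          (TrimPCA.inputLaw n r m
              {ω | ¬ TrimPCA.Succeeds ε U
                (TrimPCA.runOn τ (TrimPCA.powerIteration m) P ω).val} ≤ ENNReal.ofReal δ ∧
            ∀ ω : (Fin r → Fin m → Fin n → ℝ) × (Fin r → Fin n → ℝ),
              (TrimPCA.runOn τ (TrimPCA.powerIteration m) P ω).steps ≤
                K * (r * (n ^ 2 * m + n ^ 3))) := by
  -- `20` for the work of a round outside the subroutine and `8` for the power iteration.
  refine ⟨28, fun r d α hr hα => ?_⟩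
  obtain ⟨τ, hτ, lam', hlam', hgap'⟩ := TrimPCA.exists_threshold_gap r d hr hα
  -- The gap is capped at `1`, as the error and exponent estimates assume.
  obtain ⟨lam, hlam0, hlam1, hlam⟩ : ∃ lam : ℝ, 0 < lam ∧ lam ≤ 1 ∧ lam ≤ lam' :=
    ⟨min lam' 1, lt_min hlam' one_pos, min_le_right _ _, min_le_left _ _⟩
  have hr0 : (0 : ℝ) < r := by exact_mod_cast hr
  have hD := (TrimPCA.batchConst_facts hr hlam0).1
  refine ⟨2 * r * TrimPCA.batchConst r lam, by positivity, τ, hτ, ?_⟩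
  rintro n P U ε δ N m ⟨hU, h, hdeg, -, hnorm, hP⟩ hε0 hε hδ0 hδ1 hδr hN hm
  have hrn := TrimPCA.le_of_transpose_mul_self_eq_one hU
  have hn : 1 ≤ n := hr.trans hrn
  have hgap : TrimPCA.HasGap τ lam fun z => MvPolynomial.eval z h := by
    intro ℓ hℓ p hp hp1
    obtain ⟨c, h1, h2, h3⟩ := hgap' h hdeg hnorm ℓ hℓ p hp hp1
    exact ⟨c, h1, h2, hlam.trans h3⟩
  have hH := TrimPCA.measurable_eval h
  have hsize := TrimPCA.le_batch_size hr hn hlam0 hε0 hε hδ0 hδr hN hm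
  have hPe : (fun x => MvPolynomial.eval x P) = fun x => MvPolynomial.eval (Uᵀ *ᵥ x) h := funext hP
  refine ⟨fun eig heig => ⟨?_, fun T hT ω => ?_⟩, ?_, fun ω => ?_⟩
  · refine TrimPCA.inputLaw_not_succeeds_le hU hr hlam0 hlam1 hε0 hε heig.1 P fun ℓ hℓ V hV => ?_
    rw [hPe]
    exact TrimPCA.batchLaw_not_extends_exact_le hU hH hgap hn hlam0 hlam1 hε0 hε hδ0 hδr hsize
      heig hℓ hV
  · refine (TrimPCA.rounds_steps_le hn hrn τ eig hT _ _ _ r le_rfl).trans ?_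
    have : r * (20 * (n ^ 2 * m + n ^ 3) + T) = 20 * (r * (n ^ 2 * m + n ^ 3)) + r * T := by ring
    rw [this]
    gcongr
    norm_num
  · refine TrimPCA.inputLaw_not_succeeds_le hU hr hlam0 hlam1 hε0 hε
      (TrimPCA.isMeasurableEig_powerIteration m) P fun ℓ hℓ V hV => ?_
    rw [hPe]
    exact TrimPCA.batchLaw_not_extends_power_le hU hH hgap hn hlam0 hlam1 hε0 hε hδ0 hδ1 hδr hsize
      hℓ hV
  · refine (TrimPCA.rounds_steps_le hn hrn τ _
      (TrimPCA.powerIteration_steps_le hn m) _ _ _ r le_rfl).trans (le_of_eq ?_)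
    ring
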